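/- Let \(q\) be real-valued on \([-1,1]\) with \(a:=q(-1)<b:=q(1)\), and put \(\Pi=\{\lambda\in\mathbb C: a<\operatorname{Re}\lambda<b,\ \operatorname{Im}\lambda<0\}\). Assume \(q\in AM\), that is: \(q\) is analytic in a domain \(G\supset[-1,1]\) with \(\Pi\subset q(G)\), and, with \(D=q^{-1}(\Pi)\subset G\), \(q\) is continuous on \(\overline D\) and maps \(\overline D\) one-to-one onto \(\overline\Pi\). For \(\lambda\in\Pi\) let \(\xi_\lambda\in\overline D\) be the root of \(q(\xi)=\lambda\), and let \[Q^{\pm}(\lambda)=\int_{\xi_\lambda}^{\pm1}\sqrt{i(q(\xi)-\lambda)}\,d\xi ,\] the integral being taken along a path in \(D\). Let \(\tilde\gamma_\pm=\{\lambda\in\Pi:\operatorname{Re}Q^\pm(\lambda)=0\}\), let \(\lambda_0\) be the intersection point of \(\tilde\gamma_+\) and \(\tilde\gamma_-\), and let \(\gamma_+\) (respectively \(\gamma_-\)) be the part of \(\tilde\gamma_+\) (respectively \(\tilde\gamma_-\)) that connects \(\lambda_0\) with \(b\) (respectively with \(a\)). Let \(\Omega\) be the domain bounded by \(\gamma_+\),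 \(\gamma_-\) and the segment \([a,b]\). For \(\varepsilon>0\) let \(L=L(\varepsilon)\) be the operator in \(L_2(-1,1)\) associated with the problem \[i\varepsilon^2z''+q(x)z=\lambda z,\qquad z(-1)=z(1)=0,\] i.e. \(Lz=i\varepsilon^2z''+qz\) with domain \(\{z\in H^2(-1,1): z(\pm1)=0\}\). (1) For every compact \(K\subset\Omega\) there are \(\tau>0\) and \(\varepsilon_0>0\) such that \[\|(L(\varepsilon)-\lambda)^{-1}\|\ge e^{\tau/\varepsilon}\qquad\text{for all }\lambda\in K\text{ and }0<\varepsilon<\varepsilon_0,\] where, as usual, \(\|(L-\lambda)^{-1}\|=\infty\) if \(\lambda\) belongs to the spectrum of \(L\). (2) There are \(\eta>0\) and \(\varepsilon_1>0\) such that the following holds for every \(0<\varepsilon<\varepsilon_1\) for which \(L(\varepsilon)\) has no associated functions. Let \(\{z_k\}_{k\ge1}\) be the system of all normed eigenfunctions of \(L(\varepsilon)\) (one for each eigenvalue), let \(T\) be the bounded and boundedly invertible operator in \(\ell_2\) generated by the Gram matrix \(\{(z_k,z_j)_{L_2(-1,1)}\}_{k,j}\), and let \(C(\varepsilon)=\|T\|\,\|T^{-1}\|\)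 be the Riesz constant of the system (\(C(\varepsilon)=\infty\) if there is no such \(T\)). Then \(C(\varepsilon)\ge e^{\eta/\varepsilon}\). -/

import Mathlib

open MeasureTheory Set
open scoped ENNReal InnerProductSpace

noncomputable section

namespace OrrSommerfeldModel

/-! ### The class `AM` -/

/-- The open semistrip `Π = {λ : a < Re λ < b, Im λ < 0}`, where `a = q(-1)`, `b = q(1)`. -/
def strip (q : ℂ → ℂ) : Set ℂ :=
  {l | (q (-1)).re < l.re ∧ l.re < (q 1).re ∧ l.im < 0}

/-- The set `D = q⁻¹(Π) ⊆ G`. -/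
def preStrip (q : ℂ → ℂ) (G : Set ℂ) : Set ℂ := G ∩ q ⁻¹' strip q

/-- The class `AM`: the profile `q` is real on the segment `[-1,1]`, `q(-1) < q(1)`, and `q` is
analytic in a domain `G ⊇ [-1,1]` such that `Π ⊆ q(G)`; with `D = q⁻¹(Π) ⊆ G`, the function `q` is
continuous on the closure of `D` and maps it one-to-one onto the closure of `Π`.  (Points of the
closure of `D` may lie outside `G`; there `q` stands for the continuous extension.) -/
structure IsAM (q : ℂ → ℂ) (G : Set ℂ) : Prop where
  isOpen : IsOpen G
  isConnected : IsConnected G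
  segment_subset : ∀ x ∈ Icc (-1 : ℝ) 1, (x : ℂ) ∈ G
  analytic : AnalyticOnNhd ℂ q G
  real_on_segment : ∀ x ∈ Icc (-1 : ℝ) 1, (q x).im = 0
  endpoints_lt : (q (-1)).re < (q 1).re
  strip_subset_range : strip q ⊆ q '' G
  continuousOn_closure : ContinuousOn q (closure (preStrip q G))
  bijOn_closure : BijOn q (closure (preStrip q G)) (closure (strip q))

/-! ### The functions `Q^±` and the domain `Ω` -/

/-- The root `ξ_λ ∈ closure D` of the equation `q(ξ) = λ`. -/
def root (q : ℂ → ℂ) (G : Set ℂ) (l : ℂ) : ℂ :=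
  Function.invFunOn q (closure (preStrip q G)) l

/-- The branch `√(i w) = e^{iπ/4} w^{1/2}` (principal power), whose square is `i w`. It is
continuous off the negative real half-axis of the `w`-plane. -/
def sqrtI (w : ℂ) : ℂ := Complex.exp (Complex.I * (Real.pi / 4)) * w ^ (1 / 2 : ℂ)

/-- The path `t ↦ ξ_{λ + t (e - λ)}`, `0 ≤ t ≤ 1`, which runs in `closure D` from `ξ_λ` to `ξ_e`;
for `λ ∈ Π` and `e = q(±1)` its end is `ξ_e = ±1`, and it lies in `D` for `t < 1`. -/
def path (q : ℂ → ℂ) (G : Set ℂ) (l e : ℂ) (t : ℝ) : ℂ := root q G (l + t * (e - l))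

/-- The integral `∫ √(i (q(ξ) - λ)) dξ` from `ξ_λ` to `ξ_e`, taken along `path`. As `D` is simply
connected and `ξ_λ` is the only zero of `q - λ` in it, another path in `D` can change at most the
sign. For `λ ∈ Π` and `e = q(±1)` the values `q(ξ) - λ = t (e - λ)` stay on a ray on which `sqrtI`
is continuous. -/
def actionTo (q : ℂ → ℂ) (G : Set ℂ) (e l : ℂ) : ℂ :=
  ∫ t in (0 : ℝ)..1, sqrtI (q (path q G l e t) - l) * deriv (path q G l e) t

/-- `Q⁺(λ)`, the integral from `ξ_λ` to `1`. -/
def Qplus (q : ℂ → ℂ) (G : Set ℂ) (l : ℂ) : ℂ := actionTo q G (q 1) l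

/-- `Q⁻(λ)`, the integral from `ξ_λ` to `-1`. -/
def Qminus (q : ℂ → ℂ) (G : Set ℂ) (l : ℂ) : ℂ := actionTo q G (q (-1)) l

/-- The full curve `Re Q⁺(λ) = 0` in `Π`. -/
def curvePlus (q : ℂ → ℂ) (G : Set ℂ) : Set ℂ := {l ∈ strip q | (Qplus q G l).re = 0}

/-- The full curve `Re Q⁻(λ) = 0` in `Π`. -/
def curveMinus (q : ℂ → ℂ) (G : Set ℂ) : Set ℂ := {l ∈ strip q | (Qminus q G l).re = 0}

/-- The part of the curve `C` that connects its point `r` with its end `p` (which need not belong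
to `C`): the points of simple arcs from `p` to `r` that, apart from `p`, run in `C`. -/
def arcPart (C : Set ℂ) (p r : ℂ) : Set ℂ :=
  {z | ∃ f : ℝ → ℂ, ContinuousOn f (Icc 0 1) ∧ InjOn f (Icc 0 1) ∧ f 0 = p ∧ f 1 = r ∧
    (∀ t ∈ Ioc (0 : ℝ) 1, f t ∈ C) ∧ z ∈ f '' Icc 0 1}

/-- `γ₊`: the part of `Re Q⁺ = 0` connecting the intersection point `λ₀` with `b = q(1)`. -/
def gammaPlus (q : ℂ → ℂ) (G : Set ℂ) (l₀ : ℂ) : Set ℂ := arcPart (curvePlus q G) (q 1) l₀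

/-- `γ₋`: the part of `Re Q⁻ = 0` connecting the intersection point `λ₀` with `a = q(-1)`. -/
def gammaMinus (q : ℂ → ℂ) (G : Set ℂ) (l₀ : ℂ) : Set ℂ := arcPart (curveMinus q G) (q (-1)) l₀

/-- The contour formed by `γ₊`, `γ₋` and the segment `[a,b]`. -/
def contour (q : ℂ → ℂ) (G : Set ℂ) (l₀ : ℂ) : Set ℂ :=
  gammaPlus q G l₀ ∪ gammaMinus q G l₀ ∪ segment ℝ (q (-1)) (q 1)

/-- The domain `Ω` bounded by the contour: the bounded part of its complement. -/
def Omega (q : ℂ → ℂ) (G : Set ℂ) (l₀ : ℂ) : Set ℂ :=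
  {z | z ∉ contour q G l₀ ∧ Bornology.IsBounded (connectedComponentIn (contour q G l₀)ᶜ z)}

/-! ### The operator `L(ε)` -/

/-- The Hilbert space `L₂(-1,1)`. -/
abbrev L2 : Type := Lp ℂ 2 ((volume : Measure ℝ).restrict (Ioo (-1) 1))

/-- `IsH2Dirichlet z v`: on `[-1,1]` the function `z` is continuously differentiable, its
derivative is absolutely continuous with second derivative `v ∈ L₂(-1,1)`, and
`z(-1) = z(1) = 0`. -/
def IsH2Dirichlet (z : ℝ → ℂ) (v : L2) : Prop :=
  ∃ z₁ : ℝ → ℂ,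
    (∀ x ∈ Icc (-1 : ℝ) 1, HasDerivWithinAt z (z₁ x) (Icc (-1) 1) x) ∧
    (∀ x ∈ Icc (-1 : ℝ) 1, z₁ x = z₁ (-1) + ∫ t in (-1 : ℝ)..x, v t) ∧
    z (-1) = 0 ∧ z 1 = 0

lemma intervalIntegrable_L2 (v : L2) {x : ℝ} (hx : x ∈ Icc (-1 : ℝ) 1) :
    IntervalIntegrable v volume (-1) x := by
  have h : Integrable v ((volume : Measure ℝ).restrict (Ioo (-1) 1)) :=
    (Lp.memLp v).integrable (by norm_num)
  rw [intervalIntegrable_iff_integrableOn_Ioo_of_le hx.1]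
  exact IntegrableOn.mono_set h (Ioo_subset_Ioo_right hx.2)

lemma integral_congr_L2 {f g : ℝ → ℂ}
    (h : f =ᵐ[(volume : Measure ℝ).restrict (Ioo (-1) 1)] g) {x : ℝ}
    (hx : x ∈ Icc (-1 : ℝ) 1) : ∫ t in (-1 : ℝ)..x, f t = ∫ t in (-1 : ℝ)..x, g t := by
  rw [intervalIntegral.integral_of_le hx.1, intervalIntegral.integral_of_le hx.1,
    integral_Ioc_eq_integral_Ioo, integral_Ioc_eq_integral_Ioo]
  exact integral_congr_ae
    (ae_restrict_of_ae_restrict_of_subset (Ioo_subset_Ioo_right hx.2) h)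

lemma IsH2Dirichlet.add {z w : ℝ → ℂ} {v u : L2} (h : IsH2Dirichlet z v)
    (k : IsH2Dirichlet w u) : IsH2Dirichlet (z + w) (v + u) := by
  obtain ⟨z₁, a1, a2, a3, a4⟩ := h
  obtain ⟨w₁, b1, b2, b3, b4⟩ := k
  refine ⟨z₁ + w₁, fun x hx => (a1 x hx).add (b1 x hx), fun x hx => ?_, by simp [a3, b3],
    by simp [a4, b4]⟩
  rw [integral_congr_L2 (Lp.coeFn_add v u) hx]
  simp only [Pi.add_apply]
  rw [intervalIntegral.integral_add (intervalIntegrable_L2 v hx) (intervalIntegrable_L2 u hx),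
    a2 x hx, b2 x hx]
  ring

lemma IsH2Dirichlet.smul {z : ℝ → ℂ} {v : L2} (c : ℂ) (h : IsH2Dirichlet z v) :
    IsH2Dirichlet (c • z) (c • v) := by
  obtain ⟨z₁, a1, a2, a3, a4⟩ := h
  refine ⟨c • z₁, fun x hx => (a1 x hx).const_smul c, fun x hx => ?_, by simp [a3],
    by simp [a4]⟩
  rw [integral_congr_L2 (Lp.coeFn_smul c v) hx]
  simp only [Pi.smul_apply]
  rw [intervalIntegral.integral_smul, a2 x hx, smul_add]

lemma IsH2Dirichlet.zero : IsH2Dirichlet 0 0 := by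
  refine ⟨0, fun x hx => hasDerivWithinAt_const x _ (0 : ℂ), fun x hx => ?_, rfl, rfl⟩
  rw [integral_congr_L2 (Lp.coeFn_zero ℂ 2 _) hx]
  simp

/-- The graph of `L(ε)`: the pairs `(z, iε² z'' + q z)` with `z ∈ H²(-1,1)`, `z(±1) = 0`. -/
def modelGraph (q : ℂ → ℂ) (ε : ℝ) : Submodule ℂ (L2 × L2) where
  carrier := {p | ∃ (z : ℝ → ℂ) (v : L2), IsH2Dirichlet z v ∧
    p.1 =ᵐ[(volume : Measure ℝ).restrict (Ioo (-1) 1)] z ∧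
    p.2 =ᵐ[(volume : Measure ℝ).restrict (Ioo (-1) 1)]
      fun x => Complex.I * (ε : ℂ) ^ 2 * v x + q x * z x}
  add_mem' := by
    rintro ⟨f, g⟩ ⟨f', g'⟩ ⟨z, v, h, h1, h2⟩ ⟨z', v', h', h1', h2'⟩
    refine ⟨z + z', v + v', h.add h', ?_, ?_⟩
    · filter_upwards [Lp.coeFn_add f f', h1, h1'] with x e1 e2 e3
      simp_all
    · filter_upwards [Lp.coeFn_add g g', Lp.coeFn_add v v', h2, h2'] with x e1 e2 e3 e4
      simp only [Prod.mk_add_mk, e1, e2, Pi.add_apply] at *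
      rw [e3, e4]
      ring
  zero_mem' := by
    refine ⟨0, 0, IsH2Dirichlet.zero, Lp.coeFn_zero ℂ 2 _, ?_⟩
    filter_upwards [Lp.coeFn_zero ℂ 2 ((volume : Measure ℝ).restrict (Ioo (-1) 1))] with x e
    have e' : (0 : L2) x = 0 := e
    change (0 : L2) x = Complex.I * (ε : ℂ) ^ 2 * (0 : L2) x + q x * 0
    rw [e']
    simp
  smul_mem' := by
    rintro c ⟨f, g⟩ ⟨z, v, h, h1, h2⟩
    refine ⟨c • z, c • v, h.smul c, ?_, ?_⟩
    · filter_upwards [Lp.coeFn_smul c f, h1] with x e1 e2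
      simp_all
    · filter_upwards [Lp.coeFn_smul c g, Lp.coeFn_smul c v, h2] with x e1 e2 e3
      simp only [Prod.smul_mk, e1, e2, Pi.smul_apply, smul_eq_mul] at *
      rw [e3]
      ring

/-- The operator `L(ε)` in `L₂(-1,1)` associated with `iε² z'' + q z = λ z`, `z(±1) = 0`. -/
def modelOp (q : ℂ → ℂ) (ε : ℝ) : L2 →ₗ.[ℂ] L2 := (modelGraph q ε).toLinearPMap

/-- `modelGraph` is single-valued, so that it is the graph of `modelOp`. -/
lemma modelOp_graph (q : ℂ → ℂ) (ε : ℝ) : (modelOp q ε).graph = modelGraph q ε := by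
  refine Submodule.toLinearPMap_graph_eq _ ?_
  rintro ⟨f, g⟩ ⟨z, v, ⟨z₁, a1, a2, a3, a4⟩, h1, h2⟩ (rfl : f = 0)
  have hz0 : z =ᵐ[(volume : Measure ℝ).restrict (Ioo (-1) 1)] fun _ => (0 : ℂ) := by
    filter_upwards [h1, Lp.coeFn_zero ℂ 2 ((volume : Measure ℝ).restrict (Ioo (-1) 1))] with x e e'
    rw [← e, e']; rfl
  have hzc : ContinuousOn z (Ioo (-1) 1) := fun x hx =>
    ((a1 x (Ioo_subset_Icc_self hx)).continuousWithinAt).mono Ioo_subset_Icc_self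
  have hz : EqOn z (fun _ => 0) (Ioo (-1) 1) :=
    Measure.eqOn_open_of_ae_eq hz0 isOpen_Ioo hzc continuousOn_const
  have hz1 : ∀ x ∈ Ioo (-1 : ℝ) 1, z₁ x = 0 := fun x hx => by
    have hd : HasDerivAt z (z₁ x) x :=
      (a1 x (Ioo_subset_Icc_self hx)).hasDerivAt (Icc_mem_nhds hx.1 hx.2)
    have hd' : HasDerivAt z 0 x := (hasDerivAt_const x (0 : ℂ)).congr_of_eventuallyEq
      (Filter.eventuallyEq_of_mem (isOpen_Ioo.mem_nhds hx) hz)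
    exact hd.unique hd'
  have hv : v =ᵐ[(volume : Measure ℝ).restrict (Ioo (-1) 1)] fun _ => (0 : ℂ) := by
    rw [Filter.EventuallyEq, ae_restrict_iff' measurableSet_Ioo]
    have hi := (intervalIntegrable_L2 v (x := 1) (by simp)).ae_hasDerivAt_integral
    filter_upwards [hi] with x hx hxm
    have hd := hx (by rw [uIcc_of_le (by norm_num)]; exact Ioo_subset_Icc_self hxm) (-1)
      (by simp)
    have hd' : HasDerivAt (fun y => ∫ t in (-1 : ℝ)..y, v t) 0 x := by
      refine (hasDerivAt_const x (-z₁ (-1))).congr_of_eventuallyEq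
        (Filter.eventuallyEq_of_mem (isOpen_Ioo.mem_nhds hxm) fun y hy => ?_)
      have := a2 y (Ioo_subset_Icc_self hy)
      rw [hz1 y hy] at this
      linear_combination -this
    exact hd.unique hd'
  refine Lp.ext ?_
  filter_upwards [h2, hv, hz0, Lp.coeFn_zero ℂ 2 ((volume : Measure ℝ).restrict (Ioo (-1) 1))]
    with x e1 e2 e3 e4
  rw [e4]
  change g x = _ at e1
  rw [e1, e2, e3]
  simp

/-! ### Resolvents -/

/-- `R` is the bounded inverse `(A - λ)⁻¹`, defined on the whole space. -/
def IsResolventAt (A : L2 →ₗ.[ℂ] L2) (l : ℂ) (R : L2 →L[ℂ] L2) : Prop :=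
  (∀ g : L2, ∃ h : R g ∈ A.domain, A ⟨R g, h⟩ - l • R g = g) ∧
    ∀ u : A.domain, R (A u - l • (u : L2)) = u

/-- `‖(A - λ)⁻¹‖`, with the usual convention that it is `∞` if `λ` is in the spectrum of `A`.
(There is at most one `R` with `IsResolventAt A l R`.) -/
def resolventNorm (A : L2 →ₗ.[ℂ] L2) (l : ℂ) : ℝ≥0∞ :=
  ⨅ (R : L2 →L[ℂ] L2) (_ : IsResolventAt A l R), ‖R‖ₑ

/-! ### The Riesz constant -/

/-- `z` is an eigenfunction of `A` with the eigenvalue `m`. -/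
def IsEigenfunction (A : L2 →ₗ.[ℂ] L2) (m : ℂ) (z : L2) : Prop :=
  z ≠ 0 ∧ ∃ h : z ∈ A.domain, A ⟨z, h⟩ = m • z

/-- `A` has no associated functions: `(A - m) u = z` is not solvable for an eigenfunction `z` with
the eigenvalue `m`. -/
def NoAssociatedFunctions (A : L2 →ₗ.[ℂ] L2) : Prop :=
  ∀ (m : ℂ) (z : L2), IsEigenfunction A m z → ∀ u : A.domain, A u - m • (u : L2) ≠ z

/-- `z` is the system of all normed eigenfunctions of `A`: one for every eigenvalue, and every
eigenfunction is a multiple of one of them. -/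
def IsNormedEigensystem (A : L2 →ₗ.[ℂ] L2) (z : ℕ → L2) : Prop :=
  (∃ m : ℕ → ℂ, Function.Injective m ∧ ∀ k, IsEigenfunction A (m k) (z k)) ∧
    (∀ k, ‖z k‖ = 1) ∧
    ∀ (m : ℂ) (y : L2), IsEigenfunction A m y → ∃ (k : ℕ) (c : ℂ), y = c • z k

/-- The space `l₂`. -/
abbrev l2 : Type := lp (fun _ : ℕ => ℂ) 2

/-- `T` is the operator in `l₂` generated by the Gram matrix with the entries
`(z_k, z_j) = ∫ z_k conj(z_j)` (row `k`, column `j`). -/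
def IsGramOperator (z : ℕ → L2) (T : l2 →L[ℂ] l2) : Prop :=
  ∀ j k : ℕ, T (lp.single 2 j (1 : ℂ)) k = ⟪z j, z k⟫_ℂ

/-- The Riesz constant `C = ‖T‖ ‖T⁻¹‖`, where `T` is the operator generated by the Gram matrix of
`z`; it is `∞` if the Gram matrix generates no bounded and boundedly invertible operator, i.e. if
`z` is not a Riesz basis of its closed span. (There is at most one such `T`.) -/
def rieszConstant (z : ℕ → L2) : ℝ≥0∞ :=
  ⨅ (T : l2 ≃L[ℂ] l2) (_ : IsGramOperator z (T : l2 →L[ℂ] l2)),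
    ‖(T : l2 →L[ℂ] l2)‖ₑ * ‖(T.symm : l2 →L[ℂ] l2)‖ₑ

end OrrSommerfeldModel

end

open OrrSommerfeldModel

/-!
# Exponential growth of the resolvent and of the Riesz constant of the model operator

Let `q` be analytic near `[-1, 1]` and real there, and let `ν` be any point of the semistrip
`a < Re ν < b`, `Im ν < 0`. Since `a = q(-1)` and `b = q(1)`, there is a point `x₀` at which
`q - Re ν` changes its sign from `-` to `+` (`exists_crossing`). Put `S' = -i √(-i (q - λ))` with
the principal branch of the root. On the real axis the derivative of `Re S` has, for `λ = ν`, the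
sign of `Re ν - q`, so that `Re S` has a strict maximum at `x₀`; for `λ` near `ν` the real part of
the phase changes little, uniformly. A WKB solution `exp (S/ε) w`, cut off around `x₀`, is therefore
exponentially small where the cutoff acts. To make the rest of the residual exponentially small as
well, the equation of the amplitude `w` is solved approximately by a number of iterations of the
order of `1/ε` in a complex disc around `x₀`: integration along rays that start below `x₀`, along
which `Re S` increases, makes each iteration gain the factor `1/3`, uniformly in `ε`
(`IsPhase.exists_iterate`). The result is `exists_pseudomode`: near each point of the strip there
are `φ ≠ 0` with `‖(L - λ) φ‖ ≤ exp (-τ/ε) ‖φ‖`, uniformly in `λ`.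

For the resolvent this, compactness, and the inclusion of `Ω` in the strip (`Omega_subset_strip`)
suffice. The inclusion holds since the contour lies in the union of the strip and the segment
`[a, b]`, from whose complement every point off the strip can escape to infinity along a ray.

For the Riesz constant, let `W φ = (∫ φ z_k)_k`. The operator `L` is symmetric with respect to the
bilinear form `∫ f g`, so `W` turns `L` into multiplication by the eigenvalues `m_k`
(`IsSolution.lagrange`). The eigenfunctions are complete (`eq_zero_of_forall_bilin_eq_zero`): on
the annihilator of all of them the resolvent is entire, and it tends to zero on large contours.
Hence the frame bounds `‖φ‖² ≤ ‖T⁻¹‖ ‖W φ‖²` and `‖W φ‖² ≤ ‖T‖ ‖φ‖²` hold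
(`exists_analysis_operator`), and for a pseudomode at `λ` they give
`dist(λ, {m_k})² ≤ ‖T‖ ‖T⁻¹‖ exp (-2τ/ε)`. Finally the number of eigenvalues in a disc is
`O(ε⁻⁴ ‖T‖)` (`card_eigenvalues_le`), so that some `λ` in the disc has at least the distance
`c ε⁴ / ‖T‖` from all of them, and `‖T‖ ‖T⁻¹‖` is exponentially large.
-/

/-! ### Primitives of integrable functions on `[-1,1]` -/

/-- `F` is absolutely continuous on `[-1,1]` with derivative `f`, encoded as `F` being an indefinite
Lebesgue integral of `f`. -/
structure IsPrimitive (F f : ℝ → ℂ) : Prop where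
  intervalIntegrable : IntervalIntegrable f volume (-1) 1
  eq_integral : ∀ x ∈ Icc (-1 : ℝ) 1, F x = F (-1) + ∫ t in (-1 : ℝ)..x, f t

lemma absolutelyContinuous_integral {f : ℝ → ℂ} (hf : IntervalIntegrable f volume (-1) 1) :
    AbsolutelyContinuousOnInterval (fun x => ∫ t in (-1 : ℝ)..x, f t) (-1) 1 := by
  have ofReal : ∀ g : ℝ → ℝ, AbsolutelyContinuousOnInterval g (-1) 1 →
      AbsolutelyContinuousOnInterval (fun x => (g x : ℂ)) (-1) 1 := by
    intro g hg
    rw [absolutelyContinuousOnInterval_iff] at hg ⊢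
    simpa only [Complex.dist_of_im_eq (Complex.ofReal_im _ |>.trans (Complex.ofReal_im _).symm),
      Complex.ofReal_re] using hg
  have hre : IntervalIntegrable (fun x => (f x).re) volume (-1) 1 := ⟨hf.1.re, hf.2.re⟩
  have him : IntervalIntegrable (fun x => (f x).im) volume (-1) 1 := ⟨hf.1.im, hf.2.im⟩
  have h1 := ofReal _ (hre.absolutelyContinuousOnInterval_intervalIntegral (c := -1) (by simp))
  have h2 := ofReal _ (him.absolutelyContinuousOnInterval_intervalIntegral (c := -1) (by simp))
  have h := h1.add (h2.const_smul Complex.I)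
  rw [absolutelyContinuousOnInterval_iff] at h ⊢
  refine fun e he => (h e he).imp fun d hd => ⟨hd.1, fun E hE hs => ?_⟩
  refine (Finset.sum_congr rfl fun i hi => ?_).trans_lt (hd.2 E hE hs)
  have key : ∀ x ∈ uIcc (-1 : ℝ) 1, ∫ t in (-1 : ℝ)..x, f t =
      ((∫ t in (-1 : ℝ)..x, (f t).re : ℝ) : ℂ) +
        Complex.I • ((∫ t in (-1 : ℝ)..x, (f t).im : ℝ) : ℂ) := by
    intro x hx
    have hfx : IntervalIntegrable f volume (-1) x := hf.mono_set (uIcc_subset_uIcc_left hx)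
    rw [uIcc_of_le (by norm_num)] at hx
    rw [intervalIntegral.integral_of_le hx.1, intervalIntegral.integral_of_le hx.1,
      intervalIntegral.integral_of_le hx.1, ← integral_re_add_im hfx.1]
    simp [mul_comm]
  have hm := hE.1 i hi
  rw [key _ hm.1, key _ hm.2]
  rfl

namespace IsPrimitive

variable {F G f g : ℝ → ℂ}

lemma mono_intervalIntegrable (h : IsPrimitive F f) {x : ℝ} (hx : x ∈ Icc (-1 : ℝ) 1) :
    IntervalIntegrable f volume (-1) x :=
  h.intervalIntegrable.mono_set (by
    rw [uIcc_of_le hx.1, uIcc_of_le (by norm_num)]; exact Icc_subset_Icc_right hx.2)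

lemma continuousOn (h : IsPrimitive F f) : ContinuousOn F (Icc (-1) 1) := by
  have := (absolutelyContinuous_integral h.intervalIntegrable).continuousOn
  rw [uIcc_of_le (by norm_num)] at this
  exact (continuousOn_const.add this).congr h.eq_integral

lemma intervalIntegrable_mul (hf : IntervalIntegrable f volume (-1) 1)
    (hG : ContinuousOn G (Icc (-1) 1)) :
    IntervalIntegrable (fun x => f x * G x) volume (-1) 1 :=
  hf.mul_continuousOn (by rwa [uIcc_of_le (by norm_num)])

lemma add (h : IsPrimitive F f) (k : IsPrimitive G g) :
    IsPrimitive (fun x => F x + G x) (fun x => f x + g x) := by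
  refine ⟨h.1.add k.1, fun x hx => ?_⟩
  rw [intervalIntegral.integral_add (h.mono_intervalIntegrable hx) (k.mono_intervalIntegrable hx),
    h.2 x hx, k.2 x hx]
  ring

lemma const_mul (h : IsPrimitive F f) (c : ℂ) :
    IsPrimitive (fun x => c * F x) (fun x => c * f x) := by
  refine ⟨h.1.const_mul c, fun x hx => ?_⟩
  rw [intervalIntegral.integral_const_mul, h.2 x hx]
  ring

lemma sub (h : IsPrimitive F f) (k : IsPrimitive G g) :
    IsPrimitive (fun x => F x - G x) (fun x => f x - g x) := by
  simpa [sub_eq_add_neg] using h.add (k.const_mul (-1))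

lemma congr_ae (h : IsPrimitive F f)
    (hfg : f =ᵐ[(volume : Measure ℝ).restrict (Ioo (-1) 1)] g) : IsPrimitive F g := by
  refine ⟨?_, fun x hx => (h.2 x hx).trans (by rw [integral_congr_L2 hfg hx])⟩
  have := h.1
  rw [intervalIntegrable_iff_integrableOn_Ioo_of_le (by norm_num)] at this ⊢
  exact Integrable.congr this hfg

/-- The product rule for absolutely continuous functions. -/
lemma mul (h : IsPrimitive F f) (k : IsPrimitive G g) :
    IsPrimitive (fun x => F x * G x) (fun x => f x * G x + F x * g x) := by
  have hFi : IntervalIntegrable (fun x => F x * g x) volume (-1) 1 := by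
    simpa only [mul_comm] using intervalIntegrable_mul k.1 h.continuousOn
  have hI := (intervalIntegrable_mul h.1 k.continuousOn).add hFi
  refine ⟨hI, ?_⟩
  have huI : uIcc (-1 : ℝ) 1 = Icc (-1) 1 := uIcc_of_le (by norm_num)
  set V : ℝ → ℂ := fun x => F (-1) + ∫ t in (-1 : ℝ)..x, f t
  set W : ℝ → ℂ := fun x => G (-1) + ∫ t in (-1 : ℝ)..x, g t
  have const_ac : ∀ c : ℂ, AbsolutelyContinuousOnInterval (fun _ : ℝ => c) (-1) 1 := fun c =>
    (contDiff_const.contDiffOn).absolutelyContinuousOnInterval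
  have hV : AbsolutelyContinuousOnInterval V (-1) 1 :=
    (const_ac _).add (absolutelyContinuous_integral h.1)
  have hW : AbsolutelyContinuousOnInterval W (-1) 1 :=
    (const_ac _).add (absolutelyContinuous_integral k.1)
  have hH := ((hV.smul hW).sub (absolutelyContinuous_integral hI))
  obtain ⟨C, hC⟩ := hH.const_of_ae_hasDerivAt_zero (by
    filter_upwards [h.1.ae_hasDerivAt_integral, k.1.ae_hasDerivAt_integral,
      hI.ae_hasDerivAt_integral] with x h1 h2 h3 hx
    have d1 : HasDerivAt V (f x) x := (h1 hx (-1) (by simp)).const_add _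
    have d2 : HasDerivAt W (g x) x := (h2 hx (-1) (by simp)).const_add _
    have d3 := h3 hx (-1) (by simp)
    have := (d1.mul d2).sub d3
    rw [huI] at hx
    rw [h.2 x hx, k.2 x hx] at this
    convert! this using 1
    simp [V, W])
  intro x hx
  have e1 := hC x (by rwa [huI])
  have e0 := hC (-1) (by simp)
  rw [← e0] at e1
  simp only [Pi.sub_apply, smul_eq_mul, Pi.mul_apply, intervalIntegral.integral_same, sub_zero,
    V, W, add_zero] at e1
  rw [h.2 x hx, k.2 x hx]
  linear_combination e1

lemma of_hasDerivWithinAt (hF : ∀ x ∈ Icc (-1 : ℝ) 1, HasDerivWithinAt F (f x) (Icc (-1) 1) x)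
    (hf : ContinuousOn f (Icc (-1) 1)) : IsPrimitive F f := by
  have hi : IntervalIntegrable f volume (-1) 1 :=
    ContinuousOn.intervalIntegrable (by rwa [uIcc_of_le (by norm_num)])
  refine ⟨hi, fun x hx => ?_⟩
  rw [intervalIntegral.integral_eq_sub_of_hasDerivAt_of_le hx.1
    (fun y hy => ((hF y ⟨hy.1, hy.2.trans hx.2⟩).continuousWithinAt).mono
      (Icc_subset_Icc_right hx.2))
    (fun y hy => (hF y ⟨hy.1.le, hy.2.le.trans hx.2⟩).hasDerivAt
      (Icc_mem_nhds hy.1 (hy.2.trans_le hx.2)))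
    (hi.mono_set (by
      rw [uIcc_of_le hx.1, uIcc_of_le (by norm_num)]; exact Icc_subset_Icc_right hx.2))]
  ring

lemma of_hasDerivAt (hF : ∀ x ∈ Icc (-1 : ℝ) 1, HasDerivAt F (f x) x)
    (hf : ContinuousOn f (Icc (-1) 1)) : IsPrimitive F f :=
  of_hasDerivWithinAt (fun x hx => (hF x hx).hasDerivWithinAt) hf

lemma hasDerivWithinAt (h : IsPrimitive F f) (hf : ContinuousOn f (Icc (-1) 1)) {x : ℝ}
    (hx : x ∈ Icc (-1 : ℝ) 1) : HasDerivWithinAt F (f x) (Icc (-1) 1) x := by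
  have hm := hf.stronglyMeasurableAtFilter_nhdsWithin measurableSet_Icc (μ := volume) x
  have : Fact (x ∈ Icc (-1 : ℝ) 1) := ⟨hx⟩
  have h' := intervalIntegral.integral_hasDerivWithinAt_right (h.mono_intervalIntegrable hx)
    (s := Icc (-1) 1) (t := Icc (-1) 1) hm (hf x hx)
  exact (h'.const_add (F (-1))).congr h.eq_integral (h.eq_integral x hx)

end IsPrimitive

lemma IsH2Dirichlet_iff {z : ℝ → ℂ} {v : L2} : IsH2Dirichlet z v ↔
    ∃ z₁ : ℝ → ℂ, IsPrimitive z z₁ ∧ IsPrimitive z₁ v ∧ z (-1) = 0 ∧ z 1 = 0 := by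
  constructor
  · rintro ⟨z₁, h1, h2, h3, h4⟩
    have : IsPrimitive z₁ v := ⟨intervalIntegrable_L2 v (by simp), h2⟩
    exact ⟨z₁, .of_hasDerivWithinAt h1 this.continuousOn, this, h3, h4⟩
  · rintro ⟨z₁, h1, h2, h3, h4⟩
    exact ⟨z₁, fun x hx => h1.hasDerivWithinAt h2.continuousOn hx, h2.2, h3, h4⟩

/-! ### The initial value problem for `z'' = p z + f` -/

lemma IsPrimitive.of_integral {f : ℝ → ℂ} (hf : IntervalIntegrable f volume (-1) 1) (c : ℂ) :
    IsPrimitive (fun x => c + ∫ t in (-1 : ℝ)..x, f t) f :=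
  ⟨hf, fun x _ => by simp⟩

lemma norm_integral_le_of_norm_le_exp {g : ℝ → ℂ} {C k x : ℝ} (hk : 0 < k) (hC : 0 ≤ C)
    (hx : -1 ≤ x) (hg : ∀ t ∈ Icc (-1 : ℝ) x, ‖g t‖ ≤ C * Real.exp (k * t)) :
    ‖∫ t in (-1 : ℝ)..x, g t‖ ≤ C / k * Real.exp (k * x) := by
  have hd : ∀ t : ℝ, HasDerivAt (fun s => C / k * Real.exp (k * s)) (C * Real.exp (k * t)) t := by
    intro t
    have := (((hasDerivAt_id t).const_mul k).exp).const_mul (C / k)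
    convert! this using 1
    simp only [id]
    field_simp
  have hint : ∫ t in (-1 : ℝ)..x, C * Real.exp (k * t) =
      C / k * Real.exp (k * x) - C / k * Real.exp (k * (-1)) :=
    intervalIntegral.integral_eq_sub_of_hasDerivAt (fun t _ => hd t)
      (Continuous.intervalIntegrable (by fun_prop) _ _)
  refine (intervalIntegral.norm_integral_le_of_norm_le hx
    (.of_forall fun t ht => hg t (Ioc_subset_Icc_self ht))
    (Continuous.intervalIntegrable (by fun_prop) _ _)).trans ?_
  rw [hint]
  have : 0 ≤ C / k * Real.exp (k * (-1)) := by positivity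
  linarith

/-- The initial value problem `z'' = p z + f`, `z(-1) = 0`, `z'(-1) = α` is solvable on all of
`[-1,1]`. The integral equation for `x ↦ exp (-kx) z x` is a contraction once `k² > sup |p|`. -/
lemma exists_initial_value_solution {p f : ℝ → ℂ} (hp : ContinuousOn p (Icc (-1) 1))
    (hf : IntervalIntegrable f volume (-1) 1) (α : ℂ) :
    ∃ z z₁ : ℝ → ℂ, IsPrimitive z z₁ ∧ IsPrimitive z₁ (fun x => p x * z x + f x) ∧
      z (-1) = 0 ∧ z₁ (-1) = α := by
  obtain ⟨M, hM⟩ := isCompact_Icc.exists_bound_of_continuousOn hp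
  have hM0 : 0 ≤ M := (norm_nonneg _).trans (hM 0 (by simp))
  set k : ℝ := M + 1
  have hk : 0 < k := by positivity
  have h11 : (-1 : ℝ) ≤ 1 := by norm_num
  let E := C(Icc (-1 : ℝ) 1, ℂ)
  let y : E → ℝ → ℂ := fun w x => Real.exp (k * x) * IccExtend h11 w x
  have hy : ∀ w : E, Continuous (y w) := fun w => by
    have : Continuous (IccExtend h11 w) := w.continuous.Icc_extend'
    fun_prop
  have hi : ∀ w : E, IntervalIntegrable (fun x => p x * y w x + f x) volume (-1) 1 := fun w =>
    (ContinuousOn.intervalIntegrable (by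
      rw [uIcc_of_le h11]; exact hp.mul (hy w).continuousOn)).add hf
  let u₁ : E → ℝ → ℂ := fun w x => α + ∫ t in (-1 : ℝ)..x, (p t * y w t + f t)
  have hu₁ : ∀ w, IsPrimitive (u₁ w) _ := fun w => IsPrimitive.of_integral (hi w) α
  have hi₁ : ∀ w, IntervalIntegrable (u₁ w) volume (-1) 1 := fun w =>
    ContinuousOn.intervalIntegrable (by rw [uIcc_of_le h11]; exact (hu₁ w).continuousOn)
  let u : E → ℝ → ℂ := fun w x => 0 + ∫ t in (-1 : ℝ)..x, u₁ w t
  have hu : ∀ w, IsPrimitive (u w) (u₁ w) := fun w => IsPrimitive.of_integral (hi₁ w) 0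
  let Φ : E → E := fun w => ⟨fun x => Real.exp (-(k * x)) * u w x,
    (Continuous.mul (by fun_prop) (continuousOn_iff_continuous_domRestrict.1 (hu w).continuousOn))⟩
  have hbound : ∀ w w' : E, ∀ x ∈ Icc (-1 : ℝ) 1,
      ‖u w x - u w' x‖ ≤ M * dist w w' / k / k * Real.exp (k * x) := by
    intro w w' x hx
    have e : u w x - u w' x = ∫ t in (-1 : ℝ)..x, (u₁ w t - u₁ w' t) := by
      rw [intervalIntegral.integral_sub ((hu w).mono_intervalIntegrable hx)
        ((hu w').mono_intervalIntegrable hx)]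
      simp [u]
    rw [e]
    refine norm_integral_le_of_norm_le_exp hk (by positivity) hx.1 fun t ht => ?_
    have ht' : t ∈ Icc (-1 : ℝ) 1 := ⟨ht.1, ht.2.trans hx.2⟩
    have e' : u₁ w t - u₁ w' t =
        ∫ s in (-1 : ℝ)..t, ((p s * y w s + f s) - (p s * y w' s + f s)) := by
      rw [intervalIntegral.integral_sub ((hu₁ w).mono_intervalIntegrable ht')
        ((hu₁ w').mono_intervalIntegrable ht')]
      simp [u₁]
    rw [e']
    refine norm_integral_le_of_norm_le_exp hk (by positivity) ht.1 fun s hs => ?_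
    have hs' : s ∈ Icc (-1 : ℝ) 1 := ⟨hs.1, hs.2.trans ht'.2⟩
    have e'' : (p s * y w s + f s) - (p s * y w' s + f s) =
        p s * (w ⟨s, hs'⟩ - w' ⟨s, hs'⟩) * Real.exp (k * s) := by
      simp only [y, IccExtend_of_mem h11 _ hs']
      ring
    rw [e'', norm_mul, norm_mul, Complex.norm_real, Real.norm_eq_abs, Real.abs_exp, ← dist_eq_norm]
    gcongr
    · exact hM s hs'
    · exact ContinuousMap.dist_apply_le_dist _
  have hMk : 0 ≤ M / k / k := by positivity
  have hΦ : ContractingWith (M / k / k).toNNReal Φ := by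
    constructor
    · rw [Real.toNNReal_lt_one, div_div, div_lt_one (by positivity)]
      simp only [k]; nlinarith
    · refine LipschitzWith.of_dist_le_mul fun w w' => ?_
      rw [Real.coe_toNNReal _ hMk, ContinuousMap.dist_le (by positivity)]
      intro x
      have hb := hbound w w' x x.2
      rw [dist_eq_norm]
      change ‖(Real.exp (-(k * x)) : ℂ) * u w x - Real.exp (-(k * x)) * u w' x‖
        ≤ M / k / k * dist w w'
      rw [← mul_sub, norm_mul, Complex.norm_real, Real.norm_eq_abs, Real.abs_exp]
      calc _ ≤ Real.exp (-(k * x)) * (M * dist w w' / k / k * Real.exp (k * x)) := by gcongr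
        _ = M / k / k * dist w w' := by rw [Real.exp_neg]; field_simp
  set w := ContractingWith.fixedPoint Φ hΦ
  have hw : Φ w = w := hΦ.fixedPoint_isFixedPt
  have huy : ∀ x ∈ Icc (-1 : ℝ) 1, y w x = u w x := by
    intro x hx
    have : Φ w ⟨x, hx⟩ = w ⟨x, hx⟩ := by rw [hw]
    change (Real.exp (-(k * x)) : ℂ) * u w x = w ⟨x, hx⟩ at this
    simp only [y, IccExtend_of_mem h11 _ hx]
    rw [← this, ← mul_assoc, ← Complex.ofReal_mul, ← Real.exp_add]
    simp
  refine ⟨u w, u₁ w, hu w, (hu₁ w).congr_ae ?_, by simp [u], by simp [u₁]⟩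
  filter_upwards [ae_restrict_mem measurableSet_Ioo] with x hx
  rw [huy x (Ioo_subset_Icc_self hx)]

/-! ### The bilinear form on `L₂(-1,1)` -/

lemma L2_norm_star (f : L2) : ‖star f‖ = ‖f‖ := by
  rw [Lp.norm_def, Lp.norm_def, eLpNorm_congr_ae (Lp.coeFn_star f)]
  congr 1
  exact eLpNorm_congr_norm_ae (.of_forall fun x => by simp)

/-- The bilinear form `∫ f g` on `L₂(-1,1)`, with respect to which the model operator is
symmetric. -/
noncomputable def bilin (f g : L2) : ℂ := ⟪star f, g⟫_ℂ

lemma integrable_mul_L2 (f g : L2) :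
    Integrable (fun x => f x * g x) ((volume : Measure ℝ).restrict (Ioo (-1) 1)) :=
  MemLp.integrable_mul (Lp.memLp f) (Lp.memLp g)

lemma bilin_eq_integral (f g : L2) :
    bilin f g = ∫ x, f x * g x ∂((volume : Measure ℝ).restrict (Ioo (-1) 1)) := by
  rw [bilin, L2.inner_def]
  refine integral_congr_ae ?_
  filter_upwards [Lp.coeFn_star f] with x hx
  rw [hx]
  simp [mul_comm]

lemma bilin_comm (f g : L2) : bilin f g = bilin g f := by
  simp only [bilin_eq_integral, mul_comm]

lemma bilin_star_self (f : L2) : bilin (star f) f = (‖f‖ : ℂ) ^ 2 := by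
  rw [bilin, star_star, inner_self_eq_norm_sq_to_K]
  rfl

lemma bilin_add_right (f g h : L2) : bilin f (g + h) = bilin f g + bilin f h :=
  inner_add_right _ _ _

lemma bilin_smul_right (c : ℂ) (f g : L2) : bilin f (c • g) = c * bilin f g :=
  inner_smul_right _ _ _

lemma bilin_smul_left (c : ℂ) (f g : L2) : bilin (c • f) g = c * bilin f g := by
  rw [bilin_comm, bilin_smul_right, bilin_comm]

lemma bilin_zero_left (f : L2) : bilin 0 f = 0 := by
  simpa using bilin_smul_left 0 0 f

/-! ### Solutions of `(L - λ) u = f` -/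

/-- `u` belongs to the domain of `L = L(ε)` and `(L - l) u = f`. -/
def IsSolution (q : ℂ → ℂ) (ε : ℝ) (l : ℂ) (u f : L2) : Prop := (u, f + l • u) ∈ modelGraph q ε

lemma memLp_of_continuousOn {z : ℝ → ℂ} (hz : ContinuousOn z (Icc (-1) 1)) :
    MemLp z 2 ((volume : Measure ℝ).restrict (Ioo (-1) 1)) := by
  obtain ⟨C, hC⟩ := isCompact_Icc.exists_bound_of_continuousOn hz
  refine MemLp.of_bound ((hz.mono Ioo_subset_Icc_self).aestronglyMeasurable measurableSet_Ioo) C ?_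
  filter_upwards [ae_restrict_mem measurableSet_Ioo] with x hx
  exact hC x (Ioo_subset_Icc_self hx)

namespace IsSolution

variable {q : ℂ → ℂ} {ε : ℝ} {l m : ℂ} {u y f g : L2}

lemma add (h : IsSolution q ε l u f) (k : IsSolution q ε l y g) :
    IsSolution q ε l (u + y) (f + g) := by
  have := (modelGraph q ε).add_mem h k
  rwa [Prod.mk_add_mk, add_add_add_comm, ← smul_add] at this

lemma smul (c : ℂ) (h : IsSolution q ε l u f) : IsSolution q ε l (c • u) (c • f) := by
  have := (modelGraph q ε).smul_mem c h
  rwa [Prod.smul_mk, smul_add, smul_comm c l u] at this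

lemma shift (h : IsSolution q ε l u f) (m : ℂ) : IsSolution q ε m u (f + (l - m) • u) := by
  unfold IsSolution at h ⊢
  rwa [add_assoc, ← add_smul, sub_add_cancel]

/-- Unfolding of `IsSolution` in terms of the continuously differentiable representative `z`
of `u`. -/
lemma iff_exists_primitive (hq : ContinuousOn (fun x : ℝ => q x) (Icc (-1) 1)) (hε : ε ≠ 0) :
    IsSolution q ε l u f ↔ ∃ z z₁ : ℝ → ℂ, IsPrimitive z z₁ ∧
      IsPrimitive z₁ (fun x => (f x - (q x - l) * z x) / (Complex.I * (ε : ℂ) ^ 2)) ∧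
      z (-1) = 0 ∧ z 1 = 0 ∧ u =ᵐ[(volume : Measure ℝ).restrict (Ioo (-1) 1)] z := by
  have hc : Complex.I * (ε : ℂ) ^ 2 ≠ 0 := by simp [hε]
  constructor
  · rintro ⟨z, v, h, h1, h2⟩
    obtain ⟨z₁, a1, a2, a3, a4⟩ := IsH2Dirichlet_iff.1 h
    refine ⟨z, z₁, a1, a2.congr_ae ?_, a3, a4, h1⟩
    filter_upwards [h1, h2, Lp.coeFn_add f (l • u), Lp.coeFn_smul l u] with x e1 e2 e3 e4
    simp only [Pi.add_apply, e4, Pi.smul_apply, smul_eq_mul] at e3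
    change u x = _ at e1
    change (f + l • u : L2) x = _ at e2
    rw [eq_div_iff hc]
    rw [e3, e1] at e2
    linear_combination -e2
  · rintro ⟨z, z₁, h1, h2, h3, h4, h5⟩
    have hv : MemLp (fun x => (f x - (q x - l) * z x) / (Complex.I * (ε : ℂ) ^ 2)) 2
        ((volume : Measure ℝ).restrict (Ioo (-1) 1)) := by
      have hqz : ContinuousOn (fun x : ℝ => (q x - l) * z x) (Icc (-1) 1) :=
        (hq.sub continuousOn_const).mul h1.continuousOn
      simpa only [div_eq_inv_mul, Pi.sub_apply] using
        ((Lp.memLp f).sub (memLp_of_continuousOn hqz)).const_mul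
          ((Complex.I * (ε : ℂ) ^ 2)⁻¹)
    refine ⟨z, hv.toLp, IsH2Dirichlet_iff.2 ⟨z₁, h1, h2.congr_ae hv.coeFn_toLp.symm, h3, h4⟩,
      h5, ?_⟩
    filter_upwards [h5, hv.coeFn_toLp, Lp.coeFn_add f (l • u), Lp.coeFn_smul l u]
      with x e1 e2 e3 e4
    simp only [Pi.add_apply, e4, Pi.smul_apply, smul_eq_mul] at e3
    rw [e2, mul_div_cancel₀ _ hc]
    change (f + l • u : L2) x = _
    rw [e3, e1]
    ring

/-- Lagrange's identity for two functions in the domain of `L`. -/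
lemma lagrange (hq : ContinuousOn (fun x : ℝ => q x) (Icc (-1) 1)) (hε : ε ≠ 0)
    (h : IsSolution q ε l u f) (k : IsSolution q ε m y g) :
    bilin f y - bilin u g + (l - m) * bilin u y = 0 := by
  have hc : Complex.I * (ε : ℂ) ^ 2 ≠ 0 := by simp [hε]
  obtain ⟨z, z₁, a1, a2, a3, a4, a5⟩ := (iff_exists_primitive hq hε).1 h
  obtain ⟨w, w₁, b1, b2, b3, b4, b5⟩ := (iff_exists_primitive hq hε).1 k
  have hp := (a2.mul b1).sub (a1.mul b2)
  have hp1 := hp.eq_integral 1 (by simp)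
  simp only [a3, a4, b3, b4, mul_zero, zero_mul, sub_zero, zero_add] at hp1
  rw [intervalIntegral.integral_of_le (by norm_num), integral_Ioc_eq_integral_Ioo] at hp1
  have hi : Integrable (fun x => f x * y x - u x * g x)
      ((volume : Measure ℝ).restrict (Ioo (-1) 1)) :=
    (integrable_mul_L2 _ _).sub (integrable_mul_L2 _ _)
  rw [bilin_eq_integral, bilin_eq_integral, bilin_eq_integral, ← integral_const_mul,
    ← integral_sub (integrable_mul_L2 _ _) (integrable_mul_L2 _ _),
    ← integral_add hi ((integrable_mul_L2 _ _).const_mul _)]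
  have : Complex.I * (ε : ℂ) ^ 2 * 0 = (0 : ℂ) := mul_zero _
  rw [← this, hp1, ← integral_const_mul]
  refine integral_congr_ae ?_
  filter_upwards [a5, b5] with x e1 e2
  rw [e1, e2]
  have hε' : (ε : ℂ) ≠ 0 := Complex.ofReal_ne_zero.2 hε
  field_simp
  ring

end IsSolution

section ModelOperator

variable {q : ℂ → ℂ} {ε : ℝ} {l m : ℂ}

lemma exists_modelOp_eq_iff {z w : L2} :
    (∃ h : z ∈ (modelOp q ε).domain, modelOp q ε ⟨z, h⟩ = w) ↔ (z, w) ∈ modelGraph q ε := by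
  rw [← modelOp_graph, LinearPMap.mem_graph_iff]
  constructor
  · rintro ⟨h, e⟩
    exact ⟨⟨z, h⟩, rfl, e⟩
  · rintro ⟨⟨y, hy⟩, rfl, e⟩
    exact ⟨hy, e⟩

lemma isEigenfunction_iff {z : L2} :
    IsEigenfunction (modelOp q ε) m z ↔ z ≠ 0 ∧ IsSolution q ε m z 0 := by
  rw [IsEigenfunction, exists_modelOp_eq_iff, IsSolution, zero_add]

lemma OrrSommerfeldModel.NoAssociatedFunctions.not_isSolution
    (h : NoAssociatedFunctions (modelOp q ε)) {z u : L2}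
    (hz : IsEigenfunction (modelOp q ε) m z) : ¬ IsSolution q ε m u z := by
  intro hu
  obtain ⟨hd, e⟩ := exists_modelOp_eq_iff.2 hu
  exact h m z hz ⟨u, hd⟩ (by rw [e]; simp)

/-- The Fredholm alternative for `L - l`: either it is onto, or it has an eigenfunction `e` and its
range contains the annihilator of `e` with respect to the bilinear form. -/
lemma fredholm_alternative (hq : ContinuousOn (fun x : ℝ => q x) (Icc (-1) 1)) (hε : ε ≠ 0)
    (l : ℂ) :
    (∃ e, IsEigenfunction (modelOp q ε) l e ∧ ∀ f, bilin f e = 0 → ∃ u, IsSolution q ε l u f) ∨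
      ∀ f, ∃ u, IsSolution q ε l u f := by
  have hc : Complex.I * (ε : ℂ) ^ 2 ≠ 0 := by simp [hε]
  set p : ℝ → ℂ := fun x => -(q x - l) / (Complex.I * (ε : ℂ) ^ 2)
  have hp : ContinuousOn p (Icc (-1) 1) := (hq.sub continuousOn_const).neg.div_const _
  obtain ⟨s, s₁, i1, i2, i3, i4⟩ :=
    exists_initial_value_solution (f := fun _ => 0) hp intervalIntegrable_const 1
  simp only [add_zero] at i2
  -- A solution for the forcing `f` with vanishing Cauchy data at `-1`.
  have forced : ∀ f : L2, ∃ y y₁, IsPrimitive y y₁ ∧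
      IsPrimitive y₁ (fun x => p x * y x + f x / (Complex.I * (ε : ℂ) ^ 2)) ∧
      y (-1) = 0 ∧ y₁ (-1) = 0 := fun f =>
    exists_initial_value_solution hp ((intervalIntegrable_L2 f (by simp)).div_const _) 0
  have finish : ∀ (f : L2) (y y₁ : ℝ → ℂ), IsPrimitive y y₁ →
      IsPrimitive y₁ (fun x => p x * y x + f x / (Complex.I * (ε : ℂ) ^ 2)) →
      y (-1) = 0 → y 1 = 0 → ∃ u, IsSolution q ε l u f := by
    intro f y y₁ h1 h2 h3 h4
    have hy := memLp_of_continuousOn h1.continuousOn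
    refine ⟨hy.toLp, (IsSolution.iff_exists_primitive hq hε).2
      ⟨y, y₁, h1, ?_, h3, h4, hy.coeFn_toLp⟩⟩
    convert h2 using 2
    simp only [p]
    ring
  by_cases hs : s 1 = 0
  · left
    have hsL := memLp_of_continuousOn i1.continuousOn
    set e : L2 := hsL.toLp
    have he : e ≠ 0 := by
      intro h0
      have hs0 : s =ᵐ[(volume : Measure ℝ).restrict (Ioo (-1) 1)] fun _ => 0 := by
        filter_upwards [hsL.coeFn_toLp, Lp.coeFn_zero ℂ 2
          ((volume : Measure ℝ).restrict (Ioo (-1) 1))] with x e1 e2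
        rw [← e1]
        change e x = 0
        rw [h0, e2]
        rfl
      have hs0' : EqOn s (fun _ => 0) (Icc (-1) 1) :=
        Measure.eqOn_Icc_of_ae_eq _ (by norm_num)
          (by rwa [restrict_Ioo_eq_restrict_Icc] at hs0) i1.continuousOn continuousOn_const
      have h1 : HasDerivWithinAt s (s₁ (-1)) (Icc (-1) 1) (-1) :=
        i1.hasDerivWithinAt i2.continuousOn (by simp)
      have h2 : HasDerivWithinAt s 0 (Icc (-1) 1) (-1) :=
        (hasDerivWithinAt_const _ _ (0 : ℂ)).congr hs0' i3
      have := (uniqueDiffOn_Icc (by norm_num : (-1 : ℝ) < 1) (-1) (by simp)).eq_deriv _ h1 h2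
      rw [i4] at this
      exact one_ne_zero this
    have hsol : IsSolution q ε l e 0 := by
      refine (IsSolution.iff_exists_primitive hq hε).2
        ⟨s, s₁, i1, i2.congr_ae ?_, i3, hs, hsL.coeFn_toLp⟩
      filter_upwards [Lp.coeFn_zero ℂ 2 ((volume : Measure ℝ).restrict (Ioo (-1) 1))] with x e2
      rw [e2]
      simp [p]
      ring
    -- The Wronskian of a forced solution and `s`.
    have wronskian : ∀ (f : L2) (y y₁ : ℝ → ℂ), IsPrimitive y y₁ →
        IsPrimitive y₁ (fun x => p x * y x + f x / (Complex.I * (ε : ℂ) ^ 2)) →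
        y (-1) = 0 → y₁ (-1) = 0 → Complex.I * (ε : ℂ) ^ 2 * (y 1 * s₁ 1) = - bilin f e := by
      intro f y y₁ h1 h2 h3 h4
      have hw := ((h2.mul i1).sub (h1.mul i2)).eq_integral 1 (by simp)
      simp only [h3, h4, hs, i3, mul_zero, zero_mul, sub_zero, zero_add, zero_sub] at hw
      rw [intervalIntegral.integral_of_le (by norm_num), integral_Ioc_eq_integral_Ioo] at hw
      rw [← neg_neg (y 1 * s₁ 1), hw, bilin_eq_integral, mul_neg, ← integral_const_mul]
      congr 1
      refine integral_congr_ae ?_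
      filter_upwards [hsL.coeFn_toLp] with x e1
      rw [e1]
      have hε' : (ε : ℂ) ≠ 0 := Complex.ofReal_ne_zero.2 hε
      field_simp
      ring
    have hs₁ : s₁ 1 ≠ 0 := by
      intro h0
      obtain ⟨y, y₁, h1, h2, h3, h4⟩ := forced (star e)
      have := wronskian _ y y₁ h1 h2 h3 h4
      rw [h0, bilin_star_self] at this
      simp at this
      exact he this
    refine ⟨e, isEigenfunction_iff.2 ⟨he, hsol⟩, fun f hf => ?_⟩
    obtain ⟨y, y₁, h1, h2, h3, h4⟩ := forced f
    have := wronskian _ y y₁ h1 h2 h3 h4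
    rw [hf, neg_zero] at this
    exact finish f y y₁ h1 h2 h3 (by simpa [hc, hs₁, hε] using this)
  · right
    intro f
    obtain ⟨y, y₁, h1, h2, h3, h4⟩ := forced f
    have k1 := h1.sub (i1.const_mul (y 1 / s 1))
    have k2 := h2.sub (i2.const_mul (y 1 / s 1))
    refine finish f _ _ k1 ?_ (by simp [h3, i3]) (by field_simp; ring)
    convert k2 using 2
    ring

end ModelOperator

/-! ### Green's function of `z'' + κ² z` and an a priori estimate -/

/-- `-κ sin (2κ)` times the Green function of `d²/dx² + κ²` on `[-1,1]` with Dirichlet boundary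
conditions. -/
noncomputable def greenKernel (κ : ℂ) (x t : ℝ) : ℂ :=
  Complex.sin (κ * (1 - max x t : ℝ)) * Complex.sin (κ * (1 + min x t : ℝ))

lemma continuous_greenKernel (κ : ℂ) (x : ℝ) : Continuous (greenKernel κ x) := by
  unfold greenKernel
  fun_prop

lemma norm_sin_le_exp_abs_im (w : ℂ) : ‖Complex.sin w‖ ≤ Real.exp |w.im| := by
  rw [Complex.sin, norm_div, norm_mul, Complex.norm_I, mul_one, Complex.norm_ofNat,
    div_le_iff₀ two_pos]
  refine (norm_sub_le _ _).trans ?_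
  rw [Complex.norm_exp, Complex.norm_exp]
  have h1 : (-w * Complex.I).re ≤ |w.im| := by simpa using le_abs_self _
  have h2 : (w * Complex.I).re ≤ |w.im| := by simpa using neg_le_abs _
  linarith [Real.exp_le_exp.2 h1, Real.exp_le_exp.2 h2]

lemma norm_greenKernel_le (κ : ℂ) {x t : ℝ} (hx : x ∈ Icc (-1 : ℝ) 1) (ht : t ∈ Icc (-1 : ℝ) 1) :
    ‖greenKernel κ x t‖ ≤ Real.exp (2 * |κ.im|) := by
  have h1 : 0 ≤ 1 - max x t := sub_nonneg.2 (max_le hx.2 ht.2)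
  have h2 : 0 ≤ 1 + min x t := by linarith [le_min hx.1 ht.1]
  have h3 : min x t ≤ max x t := min_le_max
  rw [greenKernel, norm_mul]
  refine (mul_le_mul (norm_sin_le_exp_abs_im _) (norm_sin_le_exp_abs_im _) (norm_nonneg _)
    (Real.exp_pos _).le).trans ?_
  rw [← Real.exp_add, Complex.im_mul_ofReal, Complex.im_mul_ofReal, abs_mul, abs_mul,
    abs_of_nonneg h1, abs_of_nonneg h2]
  refine Real.exp_le_exp.2 ?_
  nlinarith [abs_nonneg κ.im]

/-- Green's representation formula. -/
lemma IsPrimitive.green_formula {z z₁ v : ℝ → ℂ} (h : IsPrimitive z z₁) (k : IsPrimitive z₁ v)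
    (h0 : z (-1) = 0) (h1 : z 1 = 0) (κ : ℂ) {x : ℝ} (hx : x ∈ Icc (-1 : ℝ) 1) :
    κ * Complex.sin (2 * κ) * z x =
      - ∫ t in (-1 : ℝ)..1, greenKernel κ x t * (v t + κ ^ 2 * z t) := by
  have hlin : ∀ (a b : ℝ) (t : ℝ),
      HasDerivAt (fun s : ℝ => κ * ((a + b * s : ℝ) : ℂ)) (κ * b) t := by
    intro a b t
    have h1 : HasDerivAt (fun s : ℝ => a + b * s) b t := by
      simpa using ((hasDerivAt_id t).const_mul b).const_add a
    exact h1.ofReal_comp.const_mul κ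
  have hS : ∀ a b : ℝ, IsPrimitive (fun t => Complex.sin (κ * ((a + b * t : ℝ) : ℂ)))
      (fun t => Complex.cos (κ * ((a + b * t : ℝ) : ℂ)) * (κ * b)) := fun a b =>
    .of_hasDerivAt (fun t _ => (Complex.hasDerivAt_sin _).comp t (hlin a b t))
      (Continuous.continuousOn (by fun_prop))
  have hC : ∀ a b : ℝ, IsPrimitive (fun t => Complex.cos (κ * ((a + b * t : ℝ) : ℂ)))
      (fun t => -Complex.sin (κ * ((a + b * t : ℝ) : ℂ)) * (κ * b)) := fun a b =>
    .of_hasDerivAt (fun t _ => (Complex.hasDerivAt_cos _).comp t (hlin a b t))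
      (Continuous.continuousOn (by fun_prop))
  -- For `b = ±1` the bracket `z' S - b κ z C` is a primitive of `S (v + κ² z)`.
  have key : ∀ a b : ℝ, b ^ 2 = 1 → IsPrimitive
      (fun t => z₁ t * Complex.sin (κ * ((a + b * t : ℝ) : ℂ)) -
        b * κ * (z t * Complex.cos (κ * ((a + b * t : ℝ) : ℂ))))
      (fun t => Complex.sin (κ * ((a + b * t : ℝ) : ℂ)) * (v t + κ ^ 2 * z t)) := by
    intro a b hb
    have hb' : (b : ℂ) ^ 2 = 1 := by exact_mod_cast hb
    convert (k.mul (hS a b)).sub ((h.mul (hC a b)).const_mul (b * κ)) using 2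
    linear_combination (- κ ^ 2 * z _ * Complex.sin _) * hb'
  have kA := key 1 1 (by norm_num)
  have kB := key 1 (-1) (by norm_num)
  have eA := kA.eq_integral x hx
  have eB1 := kB.eq_integral 1 (by simp)
  have eBx := kB.eq_integral x hx
  have hsplit := intervalIntegral.integral_add_adjacent_intervals (μ := volume)
    (a := (-1 : ℝ)) (b := x) (c := 1) (f := fun t => greenKernel κ x t * (v t + κ ^ 2 * z t))
  have hint : IntervalIntegrable (fun t => greenKernel κ x t * (v t + κ ^ 2 * z t)) volume
      (-1) 1 := by
    have hv : IntervalIntegrable (fun t => v t + κ ^ 2 * z t) volume (-1) 1 :=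
      k.1.add (ContinuousOn.intervalIntegrable (by
        rw [uIcc_of_le (by norm_num)]; exact continuousOn_const.mul h.continuousOn))
    simpa only [mul_comm] using
      IsPrimitive.intervalIntegrable_mul hv (continuous_greenKernel κ x).continuousOn
  have hx' : x ∈ uIcc (-1 : ℝ) 1 := by rwa [uIcc_of_le (by norm_num)]
  rw [← hsplit (hint.mono_set (uIcc_subset_uIcc_left hx'))
    (hint.mono_set (uIcc_subset_uIcc_right hx'))]
  have e1 : ∫ t in (-1 : ℝ)..x, greenKernel κ x t * (v t + κ ^ 2 * z t) =
      Complex.sin (κ * ((1 + -1 * x : ℝ) : ℂ)) *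
        ∫ t in (-1 : ℝ)..x, Complex.sin (κ * ((1 + 1 * t : ℝ) : ℂ)) * (v t + κ ^ 2 * z t) := by
    rw [← intervalIntegral.integral_const_mul]
    refine intervalIntegral.integral_congr fun t ht => ?_
    rw [uIcc_of_le hx.1] at ht
    simp only [greenKernel, max_eq_left ht.2, min_eq_right ht.2]
    rw [show (1 + -1 * x : ℝ) = 1 - x by ring, one_mul, mul_assoc]
  have e2 : ∫ t in x..1, greenKernel κ x t * (v t + κ ^ 2 * z t) =
      Complex.sin (κ * ((1 + 1 * x : ℝ) : ℂ)) *
        ∫ t in x..1, Complex.sin (κ * ((1 + -1 * t : ℝ) : ℂ)) * (v t + κ ^ 2 * z t) := by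
    rw [← intervalIntegral.integral_const_mul]
    refine intervalIntegral.integral_congr fun t ht => ?_
    rw [uIcc_of_le hx.2] at ht
    simp only [greenKernel, max_eq_right ht.1, min_eq_left ht.1]
    rw [show (1 + -1 * t : ℝ) = 1 - t by ring, one_mul]
    ring
  have eB := intervalIntegral.integral_interval_sub_left kB.1 (kB.mono_intervalIntegrable hx)
  rw [e1, e2, ← eB]
  have hsin : Complex.sin (2 * κ) = Complex.sin (κ * ((1 + 1 * x : ℝ) : ℂ)) *
      Complex.cos (κ * ((1 + -1 * x : ℝ) : ℂ)) + Complex.cos (κ * ((1 + 1 * x : ℝ) : ℂ)) *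
      Complex.sin (κ * ((1 + -1 * x : ℝ) : ℂ)) := by
    rw [← Complex.sin_add]
    congr 1
    push_cast
    ring
  rw [hsin]
  simp only [h0, h1, zero_mul, mul_zero, sub_zero] at eA eB1 eBx
  norm_num at eA eB1 eBx ⊢
  linear_combination -Complex.sin (κ * (1 + -x)) * eA - Complex.sin (κ * (1 + x)) * (eB1 - eBx)

/-- The product of a function continuous on `[-1,1]` and `greenKernel κ x`, as an element of
`L₂(-1,1)`. -/
noncomputable def greenL2 {p : ℝ → ℂ} (hp : ContinuousOn p (Icc (-1) 1)) (κ : ℂ) (x : ℝ) : L2 :=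
  (memLp_of_continuousOn (hp.mul (continuous_greenKernel κ x).continuousOn)).toLp

lemma L2_norm_le_of_ae_bound {f : L2} {C : ℝ} (hC : 0 ≤ C)
    (h : ∀ᵐ x ∂((volume : Measure ℝ).restrict (Ioo (-1) 1)), ‖f x‖ ≤ C) : ‖f‖ ≤ 2 * C := by
  refine (Lp.norm_le_of_ae_bound hC h).trans ?_
  gcongr
  simp only [measureUnivNNReal, Measure.restrict_apply_univ, Real.volume_Ioo]
  norm_num
  calc (2 : ℝ) ^ (1 / 2 : ℝ) ≤ 2 ^ (1 : ℝ) :=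
        Real.rpow_le_rpow_of_exponent_le (by norm_num) (by norm_num)
    _ = 2 := by norm_num

lemma norm_greenL2_le {p : ℝ → ℂ} (hp : ContinuousOn p (Icc (-1) 1)) {P : ℝ}
    (hP : ∀ x ∈ Icc (-1 : ℝ) 1, ‖p x‖ ≤ P) (κ : ℂ) {x : ℝ} (hx : x ∈ Icc (-1 : ℝ) 1) :
    ‖greenL2 hp κ x‖ ≤ 2 * (P * Real.exp (2 * |κ.im|)) := by
  have hP0 : 0 ≤ P := (norm_nonneg _).trans (hP 0 (by simp))
  refine L2_norm_le_of_ae_bound (by positivity) ?_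
  filter_upwards [MemLp.coeFn_toLp (memLp_of_continuousOn
    (hp.mul (continuous_greenKernel κ x).continuousOn)), ae_restrict_mem measurableSet_Ioo]
    with t e ht
  rw [greenL2, e, Pi.mul_apply, norm_mul]
  have ht' := Ioo_subset_Icc_self ht
  exact mul_le_mul (hP t ht') (norm_greenKernel_le κ hx ht') (norm_nonneg _) hP0

lemma norm_bilin_le (f g : L2) : ‖bilin f g‖ ≤ ‖f‖ * ‖g‖ := by
  rw [← L2_norm_star f]
  exact norm_inner_le_norm _ _

namespace IsSolution

variable {q : ℂ → ℂ} {ε : ℝ} {l : ℂ} {u f : L2}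

/-- A solution of `(L - l) u = f` is expressed through the Green function of `d²/dx² + κ²`,
the potential term being treated as a perturbation. -/
lemma green_formula (hq : ContinuousOn (fun x : ℝ => q x) (Icc (-1) 1)) (hε : ε ≠ 0)
    (h : IsSolution q ε l u f) : ∃ z : ℝ → ℂ,
      u =ᵐ[(volume : Measure ℝ).restrict (Ioo (-1) 1)] z ∧ ∀ κ : ℂ, ∀ x ∈ Icc (-1 : ℝ) 1,
        Complex.I * (ε : ℂ) ^ 2 * (κ * Complex.sin (2 * κ)) * z x =
          bilin (greenL2 hq κ x) u
            - bilin (greenL2 (p := fun _ => 1) continuousOn_const κ x)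
              (f + (l + Complex.I * (ε : ℂ) ^ 2 * κ ^ 2) • u) := by
  have hc : Complex.I * (ε : ℂ) ^ 2 ≠ 0 := by simp [hε]
  obtain ⟨z, z₁, h1, h2, h3, h4, h5⟩ := (iff_exists_primitive hq hε).1 h
  refine ⟨z, h5, fun κ x hx => ?_⟩
  rw [mul_assoc, h1.green_formula h2 h3 h4 κ hx, bilin_eq_integral, bilin_eq_integral,
    ← integral_sub (integrable_mul_L2 _ _) (integrable_mul_L2 _ _), mul_neg, ← neg_mul,
    intervalIntegral.integral_of_le (by norm_num), integral_Ioc_eq_integral_Ioo,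
    ← integral_const_mul]
  refine integral_congr_ae ?_
  filter_upwards [h5, Lp.coeFn_add f ((l + Complex.I * (ε : ℂ) ^ 2 * κ ^ 2) • u),
    Lp.coeFn_smul (l + Complex.I * (ε : ℂ) ^ 2 * κ ^ 2) u,
    MemLp.coeFn_toLp (memLp_of_continuousOn
      (hq.mul (continuous_greenKernel κ x).continuousOn)),
    MemLp.coeFn_toLp (memLp_of_continuousOn
      (ContinuousOn.mul (f := fun _ => (1 : ℂ)) continuousOn_const
        (continuous_greenKernel κ x).continuousOn))] with t e1 e2 e3 e4 e5
  rw [greenL2, greenL2, e4, e5, e2, Pi.add_apply, e3, Pi.smul_apply, e1, smul_eq_mul,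
    Pi.mul_apply, Pi.mul_apply]
  have hε' : (ε : ℂ) ≠ 0 := Complex.ofReal_ne_zero.2 hε
  field_simp
  ring

/-- The a priori estimate for `λ = -iε²κ²`, where `κ` stays away from the zeros of `sin (2κ)`. -/
lemma norm_le (hq : ContinuousOn (fun x : ℝ => q x) (Icc (-1) 1)) (hε : 0 < ε) {Q : ℝ}
    (hQ : ∀ x ∈ Icc (-1 : ℝ) 1, ‖q x‖ ≤ Q) {κ : ℂ}
    (hκ : Real.exp (2 * |κ.im|) ≤ 4 * ‖Complex.sin (2 * κ)‖) (hκQ : 32 * Q < ε ^ 2 * ‖κ‖)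
    (h : IsSolution q ε (-(Complex.I * (ε : ℂ) ^ 2 * κ ^ 2)) u f) :
    ‖u‖ ≤ 32 / (ε ^ 2 * ‖κ‖) * ‖f‖ := by
  have hQ0 : 0 ≤ Q := (norm_nonneg _).trans (hQ 0 (by simp))
  have hpos : 0 < ε ^ 2 * ‖κ‖ := by linarith
  obtain ⟨z, hz, hg⟩ := h.green_formula hq hε.ne'
  have hzx : ∀ x ∈ Icc (-1 : ℝ) 1, ‖z x‖ ≤ 8 * (‖f‖ + Q * ‖u‖) / (ε ^ 2 * ‖κ‖) := by
    intro x hx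
    have e := congrArg norm (hg κ x hx)
    rw [neg_add_cancel, zero_smul, add_zero] at e
    have b1 := (norm_bilin_le (greenL2 hq κ x) u).trans
      (mul_le_mul_of_nonneg_right (norm_greenL2_le hq hQ κ hx) (norm_nonneg _))
    have b2 := (norm_bilin_le (greenL2 (p := fun _ => 1) continuousOn_const κ x) f).trans
      (mul_le_mul_of_nonneg_right (norm_greenL2_le (P := 1) continuousOn_const (by simp) κ hx)
        (norm_nonneg _))
    have b3 := e.le.trans ((norm_sub_le _ _).trans (add_le_add b1 b2))
    simp only [norm_mul, Complex.norm_I, one_mul, norm_pow, Complex.norm_real, Real.norm_eq_abs,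
      abs_of_pos hε] at b3
    rw [le_div_iff₀ hpos]
    have hE := Real.exp_pos (2 * |κ.im|)
    set E := Real.exp (2 * |κ.im|)
    refine le_of_mul_le_mul_left ?_ hE
    calc E * (‖z x‖ * (ε ^ 2 * ‖κ‖)) ≤ 4 * ‖Complex.sin (2 * κ)‖ * (‖z x‖ * (ε ^ 2 * ‖κ‖)) := by
          gcongr
      _ = 4 * (ε ^ 2 * (‖κ‖ * ‖Complex.sin (2 * κ)‖) * ‖z x‖) := by ring
      _ ≤ 4 * (2 * (Q * E) * ‖u‖ + 2 * E * ‖f‖) := by gcongr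
      _ = E * (8 * (‖f‖ + Q * ‖u‖)) := by ring
  have hu : ‖u‖ ≤ 2 * (8 * (‖f‖ + Q * ‖u‖) / (ε ^ 2 * ‖κ‖)) := by
    refine L2_norm_le_of_ae_bound (by positivity) ?_
    filter_upwards [hz, ae_restrict_mem measurableSet_Ioo] with x e hx
    rw [e]
    exact hzx x (Ioo_subset_Icc_self hx)
  rw [div_mul_eq_mul_div, le_div_iff₀ hpos]
  rw [← mul_div_assoc, le_div_iff₀ hpos] at hu
  nlinarith [norm_nonneg u, mul_le_mul_of_nonneg_right hκQ.le (norm_nonneg u)]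

end IsSolution

/-! ### Completeness of the eigenfunctions -/

lemma exp_abs_im_le_norm_sin {w : ℂ} (h : Real.cos w.re = 0 ∨ 1 ≤ |w.im|) :
    Real.exp |w.im| ≤ 4 * ‖Complex.sin w‖ := by
  rcases h with h | h
  · have h1 : |Real.sin w.re| = 1 := by
      have := Real.sin_sq_add_cos_sq w.re
      rw [h] at this
      rw [← sq_eq_sq₀ (abs_nonneg _) zero_le_one, sq_abs]
      linarith
    have h2 : (Complex.sin w).re = Real.sin w.re * Real.cosh w.im := by
      rw [Complex.sin_eq, ← Complex.ofReal_sin, ← Complex.ofReal_cosh, ← Complex.ofReal_cos,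
        ← Complex.ofReal_sinh]
      simp [h, Complex.sin_ofReal_re]
    have h3 := Complex.abs_re_le_norm (Complex.sin w)
    rw [h2, abs_mul, h1, one_mul, abs_of_pos (Real.cosh_pos _), ← Real.cosh_abs, Real.cosh_eq] at h3
    linarith [Real.exp_pos (-|w.im|), Real.exp_pos |w.im|]
  · have h1 : Real.exp |w.im| - Real.exp (-|w.im|) ≤ 2 * ‖Complex.sin w‖ := by
      have e : 2 * ‖Complex.sin w‖ =
          ‖Complex.exp (-w * Complex.I) - Complex.exp (w * Complex.I)‖ := by
        rw [Complex.sin, norm_div, norm_mul, Complex.norm_I, Complex.norm_ofNat]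
        ring
      have e1 : ‖Complex.exp (-w * Complex.I)‖ = Real.exp w.im := by
        rw [Complex.norm_exp]; simp
      have e2 : ‖Complex.exp (w * Complex.I)‖ = Real.exp (-w.im) := by
        rw [Complex.norm_exp]; simp
      rw [e]
      have := abs_norm_sub_norm_le (Complex.exp (-w * Complex.I)) (Complex.exp (w * Complex.I))
      rw [e1, e2] at this
      refine le_trans ?_ this
      rcases abs_cases w.im with ⟨h', -⟩ | ⟨h', -⟩ <;> rw [h']
      · exact le_abs_self _
      · rw [neg_neg]; exact (le_abs_self _).trans (abs_sub_comm _ _).le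
    have h2 : 2 ≤ Real.exp |w.im| := by linarith [Real.add_one_le_exp |w.im|]
    have h3 : Real.exp (-|w.im|) * Real.exp |w.im| = 1 := by rw [← Real.exp_add]; simp
    nlinarith [Real.exp_pos (-|w.im|)]

/-- Half the side of the `n`-th square in the `κ`-plane on whose boundary `sin (2κ)` is large. -/
noncomputable def squareRadius (n : ℕ) : ℝ := (2 * n + 1) * Real.pi / 4

lemma squareRadius_ge (n : ℕ) : (n : ℝ) ≤ squareRadius n := by
  unfold squareRadius
  nlinarith [Real.pi_gt_three, (Nat.cast_nonneg n : (0 : ℝ) ≤ n)]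

lemma half_le_squareRadius (n : ℕ) : 1 / 2 ≤ squareRadius n := by
  unfold squareRadius
  nlinarith [Real.pi_gt_three, (Nat.cast_nonneg n : (0 : ℝ) ≤ n)]

lemma exp_le_norm_sin_of_mem_square {n : ℕ} {κ : ℂ}
    (h : |κ.re| = squareRadius n ∨ |κ.im| = squareRadius n) :
    Real.exp (2 * |κ.im|) ≤ 4 * ‖Complex.sin (2 * κ)‖ := by
  have e1 : (2 * κ).im = 2 * κ.im := by simp
  have e2 : (2 * κ).re = 2 * κ.re := by simp
  have e3 : 2 * |κ.im| = |(2 * κ).im| := by rw [e1, abs_mul, abs_two]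
  rw [e3]
  refine exp_abs_im_le_norm_sin (h.imp (fun h => ?_) fun h => ?_)
  · rw [e2, ← Real.cos_abs, abs_mul, abs_two, h, Real.cos_eq_zero_iff]
    exact ⟨n, by unfold squareRadius; push_cast; ring⟩
  · rw [← e3, h]
    linarith [half_le_squareRadius n]

section Completeness

variable {q : ℂ → ℂ} {ε : ℝ}

/-- Without associated functions, the bilinear square `∫ z²` of an eigenfunction does not vanish:
otherwise the Fredholm alternative would yield an associated function. -/
lemma bilin_self_ne_zero (hq : ContinuousOn (fun x : ℝ => q x) (Icc (-1) 1)) (hε : ε ≠ 0)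
    (hNA : NoAssociatedFunctions (modelOp q ε)) {z : ℕ → L2} {m : ℕ → ℂ}
    (hm : Function.Injective m) (hz : ∀ k, IsEigenfunction (modelOp q ε) (m k) (z k))
    (hall : ∀ l y, IsEigenfunction (modelOp q ε) l y → ∃ k, ∃ c : ℂ, l = m k ∧ y = c • z k)
    (k : ℕ) : bilin (z k) (z k) ≠ 0 := by
  intro h0
  rcases fredholm_alternative hq hε (m k) with ⟨e, he, hs⟩ | hs
  · obtain ⟨j, c, hj, rfl⟩ := hall _ _ he
    obtain rfl := hm hj
    obtain ⟨u, hu⟩ := hs (z k) (by rw [bilin_smul_right, h0, mul_zero])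
    exact hNA.not_isSolution (hz k) hu
  · obtain ⟨u, hu⟩ := hs (z k)
    exact hNA.not_isSolution (hz k) hu

lemma differentiable_inverse_one_sub_smul {X : Type*} [NormedAddCommGroup X] [NormedSpace ℂ X]
    [CompleteSpace X] {R : X →L[ℂ] X} {l₀ : ℂ} (h : ∀ l : ℂ, IsUnit (1 - (l - l₀) • R)) (x : X) :
    Differentiable ℂ fun l : ℂ => Ring.inverse (1 - (l - l₀) • R) x := by
  intro l
  have h1 : DifferentiableAt ℂ (fun l : ℂ => 1 - (l - l₀) • R) l :=
    (differentiableAt_const _).sub ((differentiableAt_id.sub_const l₀).smul_const R)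
  have h2 : DifferentiableAt ℂ (fun l : ℂ => Ring.inverse (1 - (l - l₀) • R)) l := by
    have h3 : DifferentiableAt ℂ (Ring.inverse : (X →L[ℂ] X) → _) (1 - (l - l₀) • R) :=
      differentiableAt_inverse (h l)
    exact h3.comp l h1
  exact h2.clm_apply (differentiableAt_const _)

/-- A function annihilated by all eigenfunctions is zero. On the space `N` of these functions
`L - l` is bijective for every `l`, so that `(L - l)⁻¹ f` is an entire function of `l`, and the
a priori estimate on large contours forces it to vanish. -/
lemma eq_zero_of_forall_bilin_eq_zero (hq : ContinuousOn (fun x : ℝ => q x) (Icc (-1) 1))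
    (hε : 0 < ε) (hNA : NoAssociatedFunctions (modelOp q ε)) {z : ℕ → L2} {m : ℕ → ℂ}
    (hm : Function.Injective m) (hz : ∀ k, IsEigenfunction (modelOp q ε) (m k) (z k))
    (hall : ∀ l y, IsEigenfunction (modelOp q ε) l y → ∃ k, ∃ c : ℂ, l = m k ∧ y = c • z k)
    {f₀ : L2} (hf₀ : ∀ k, bilin (z k) f₀ = 0) : f₀ = 0 := by
  have hB := bilin_self_ne_zero hq hε.ne' hNA hm hz hall
  have hsol := fun k => (isEigenfunction_iff.1 (hz k)).2
  set N : Submodule ℂ L2 := (Submodule.span ℂ (range fun k => star (z k)))ᗮ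
  have memN : ∀ f, f ∈ N ↔ ∀ k, bilin (z k) f = 0 := by
    intro f
    rw [Submodule.mem_orthogonal]
    refine ⟨fun h k => h _ (Submodule.subset_span ⟨k, rfl⟩), fun h u hu => ?_⟩
    induction hu using Submodule.span_induction with
    | mem x hx => obtain ⟨k, rfl⟩ := hx; exact h k
    | zero => exact inner_zero_left _
    | add x y _ _ hx hy => rw [inner_add_left, hx, hy, add_zero]
    | smul a x _ hx => rw [inner_smul_left, hx, mul_zero]
  have uniq : ∀ l, ∀ u ∈ N, IsSolution q ε l u 0 → u = 0 := by
    intro l u hu hs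
    by_contra h0
    obtain ⟨k, c, -, rfl⟩ := hall l u (isEigenfunction_iff.2 ⟨h0, hs⟩)
    have := (memN _).1 hu k
    rw [bilin_smul_right] at this
    rcases mul_eq_zero.1 this with rfl | h
    · exact h0 (zero_smul _ _)
    · exact hB k h
  -- Lagrange's identity against `z k`.
  have lag : ∀ {l u f}, f ∈ N → IsSolution q ε l u f → ∀ k, l ≠ m k → bilin (z k) u = 0 := by
    intro l u f hf hs k hk
    have := hs.lagrange hq hε.ne' (hsol k)
    rw [bilin_comm f, (memN f).1 hf k, bilin_comm u 0, bilin_zero_left, bilin_comm u] at this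
    simpa [sub_ne_zero.2 hk] using this
  -- At an eigenvalue, a multiple of the eigenfunction corrects the solution to one in `N`.
  have exN : ∀ l, ∀ f ∈ N, ∃ u ∈ N, IsSolution q ε l u f := by
    intro l f hf
    rcases fredholm_alternative hq hε.ne' l with ⟨e, he, hs⟩ | hs
    · obtain ⟨k, c, rfl, rfl⟩ := hall _ _ he
      obtain ⟨u, hu⟩ := hs f (by rw [bilin_smul_right, bilin_comm, (memN f).1 hf k, mul_zero])
      have hu' := hu.add ((hsol k).smul (-(bilin (z k) u / bilin (z k) (z k))))
      rw [smul_zero, add_zero] at hu'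
      refine ⟨_, (memN _).2 fun j => ?_, hu'⟩
      by_cases hj : m k = m j
      · obtain rfl := hm hj
        have := hB k
        rw [bilin_add_right, bilin_smul_right]
        field_simp
        ring
      · exact lag hf hu' j hj
    · obtain ⟨u, hu⟩ := hs f
      refine ⟨u, (memN u).2 fun k => lag hf hu k ?_, hu⟩
      rintro rfl
      obtain ⟨w, hw⟩ := hs (z k)
      exact hNA.not_isSolution (hz k) hw
  obtain ⟨Q, hQ⟩ := isCompact_Icc.exists_bound_of_continuousOn hq
  -- On the boundary of the `n`-th square, `n ≥ n₀`, the a priori estimate is available.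
  have apriori : ∀ n : ℕ, 32 * Q < ε ^ 2 * n → ∀ κ : ℂ,
      (|κ.re| = squareRadius n ∨ |κ.im| = squareRadius n) → ∀ u f,
      IsSolution q ε (-(Complex.I * (ε : ℂ) ^ 2 * κ ^ 2)) u f →
        ‖u‖ ≤ 32 / (ε ^ 2 * squareRadius n) * ‖f‖ := by
    intro n hn κ hκ u f hu
    have h1 : squareRadius n ≤ ‖κ‖ := by
      rcases hκ with h | h <;> rw [← h]
      · exact Complex.abs_re_le_norm κ
      · exact Complex.abs_im_le_norm κ
    have h2 := half_le_squareRadius n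
    refine (hu.norm_le hq hε hQ (exp_le_norm_sin_of_mem_square hκ) (hn.trans_le ?_)).trans ?_
    · gcongr
      exact (squareRadius_ge n).trans h1
    · gcongr
  obtain ⟨n₀, hn₀⟩ := exists_nat_gt (32 * Q / ε ^ 2)
  rw [div_lt_iff₀' (by positivity)] at hn₀
  set l₀ : ℂ := -(Complex.I * (ε : ℂ) ^ 2 * (squareRadius n₀ : ℂ) ^ 2)
  choose S hSN hS using exN l₀
  have sEq : ∀ u v f, u ∈ N → v ∈ N → IsSolution q ε l₀ u f → IsSolution q ε l₀ v f → u = v := by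
    intro u v f hu hv h1 h2
    have := h1.add (h2.smul (-1))
    rw [neg_one_smul, neg_one_smul, add_neg_cancel, ← sub_eq_add_neg] at this
    exact sub_eq_zero.1 (uniq l₀ _ (N.sub_mem hu hv) this)
  let R₀ : N →ₗ[ℂ] N :=
    { toFun := fun f => ⟨S f f.2, hSN f f.2⟩
      map_add' := fun f g => Subtype.ext <| sEq _ _ _ (hSN _ _) (N.add_mem (hSN _ _) (hSN _ _))
        (hS (f + g : N) (f + g).2) ((hS f f.2).add (hS g g.2))
      map_smul' := fun c f => Subtype.ext <| sEq _ _ _ (hSN _ _) (N.smul_mem c (hSN _ _))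
        (hS (c • f : N) (c • f).2) ((hS f f.2).smul c) }
  let R : N →L[ℂ] N := R₀.mkContinuous (32 / (ε ^ 2 * squareRadius n₀)) fun f =>
    apriori n₀ hn₀ (squareRadius n₀) (Or.inl (by
      rw [Complex.ofReal_re, abs_of_pos (by linarith [half_le_squareRadius n₀])])) _ _ (hS f f.2)
  have hR : ∀ f : N, IsSolution q ε l₀ (R f : L2) f := fun f => hS f f.2
  let A : ℂ → (N →L[ℂ] N) := fun l => 1 - (l - l₀) • R
  have hA : ∀ l (f : N), A l f = f - (l - l₀) • R f := fun l f => rfl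
  -- A solution in `N` of `(L - l) u = f` is characterized by `A l u = R f`.
  have hAR : ∀ l (u f : N), A l u = R f → IsSolution q ε l (u : L2) f := by
    intro l u f h
    rw [hA, sub_eq_iff_eq_add, ← map_smul, ← map_add] at h
    have := (hR (f + (l - l₀) • u)).shift l
    rw [← h] at this
    convert this using 1
    push_cast
    module
  have hunit : ∀ l, IsUnit (A l) := by
    intro l
    have hbij : Function.Bijective (A l) := by
      constructor
      · rw [injective_iff_map_eq_zero]
        intro u hu
        exact Subtype.ext (uniq l u u.2 (hAR l u 0 (by rw [hu, map_zero])))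
      · intro h
        obtain ⟨g, hg, hgs⟩ := exN l h h.2
        refine ⟨h + (l - l₀) • ⟨g, hg⟩, ?_⟩
        have e : R (h + (l - l₀) • ⟨g, hg⟩) = ⟨g, hg⟩ :=
          Subtype.ext (sEq _ _ _ (R _).2 hg (hR _) (hgs.shift l₀))
        rw [hA, e, add_sub_cancel_right]
    exact ⟨(ContinuousLinearEquiv.unitsEquiv ℂ N).symm (ContinuousLinearEquiv.ofBijective (A l)
      (LinearMap.ker_eq_bot.2 hbij.1) (LinearMap.range_eq_top.2 hbij.2)), by ext; rfl⟩
  set f : N := ⟨f₀, (memN f₀).2 hf₀⟩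
  let F : ℂ → N := fun l => Ring.inverse (A l) (R f)
  have hF : ∀ l, IsSolution q ε l (F l : L2) f := fun l => hAR l _ _ (by
    change (A l * Ring.inverse (A l)) (R f) = R f
    rw [Ring.mul_inverse_cancel _ (hunit l)]
    rfl)
  have hFd : Differentiable ℂ F :=
    differentiable_inverse_one_sub_smul hunit (R f)
  -- The maximum principle on the squares, for `F` as a function of `κ` with `l = -iε²κ²`.
  have hF0 : F 0 = 0 := by
    have hbound : ∀ n : ℕ, n₀ ≤ n → ‖F 0‖ ≤ 32 / (ε ^ 2 * squareRadius n) * ‖f‖ := by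
      intro n hn
      have hn' : 32 * Q < ε ^ 2 * n := hn₀.trans_le (by gcongr)
      have hpos : 0 < squareRadius n := by linarith [half_le_squareRadius n]
      let U : Set ℂ := Ioo (-squareRadius n) (squareRadius n) ×ℂ
        Ioo (-squareRadius n) (squareRadius n)
      have hU : Bornology.IsBounded U :=
        (Metric.isBounded_Ioo _ _).reProdIm (Metric.isBounded_Ioo _ _)
      have hG : Differentiable ℂ fun κ : ℂ => F (-(Complex.I * (ε : ℂ) ^ 2 * κ ^ 2)) :=
        hFd.comp (by fun_prop)
      have := Complex.norm_le_of_forall_mem_frontier_norm_le hU hG.diffContOnCl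
        (C := 32 / (ε ^ 2 * squareRadius n) * ‖f‖) (z := 0) (fun κ hκ => ?_)
        (subset_closure ?_)
      · simpa using this
      · refine apriori n hn' κ ?_ _ _ (hF _)
        have hne : -squareRadius n ≠ squareRadius n := by linarith
        rw [Complex.frontier_reProdIm, closure_Ioo hne, frontier_Ioo (by linarith)] at hκ
        rcases hκ with ⟨-, h⟩ | ⟨h, -⟩
        · right
          rcases h with h | h
          · rw [h, abs_neg, abs_of_pos hpos]
          · rw [mem_singleton_iff.1 h, abs_of_pos hpos]
        · left
          rcases h with h | h
          · rw [h, abs_neg, abs_of_pos hpos]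
          · rw [mem_singleton_iff.1 h, abs_of_pos hpos]
      · simp [U, Complex.mem_reProdIm, hpos]
    refine norm_le_zero_iff.1 (ge_of_tendsto (x := Filter.atTop) ?_
      (Filter.eventually_atTop.2 ⟨n₀, hbound⟩))
    have h1 : Filter.Tendsto (fun n : ℕ => ε ^ 2 * squareRadius n) Filter.atTop Filter.atTop :=
      (Filter.tendsto_atTop_mono squareRadius_ge tendsto_natCast_atTop_atTop).const_mul_atTop
        (by positivity)
    simpa using (h1.const_div_atTop 32).mul_const ‖f‖
  have h0 := hF 0
  rw [hF0, ZeroMemClass.coe_zero, IsSolution, smul_zero, add_zero] at h0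
  obtain ⟨hd, e⟩ := exists_modelOp_eq_iff.2 h0
  change (f : L2) = 0
  rw [← e]
  exact (modelOp q ε).map_zero

end Completeness

/-! ### Gram operators -/

section Gram

variable {H : Type*} [NormedAddCommGroup H] [InnerProductSpace ℂ H]

/-- Bessel's inequality for a system with a bounded Gram operator. -/
lemma sum_norm_inner_sq_le {y : ℕ → H} {T : l2 →L[ℂ] l2}
    (hT : ∀ j k, T (lp.single 2 j (1 : ℂ)) k = ⟪y k, y j⟫_ℂ) (φ : H) (s : Finset ℕ) :
    ∑ k ∈ s, ‖⟪y k, φ⟫_ℂ‖ ^ 2 ≤ ‖T‖ * ‖φ‖ ^ 2 := by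
  set a : ℕ → ℂ := fun k => ⟪y k, φ⟫_ℂ
  set c : l2 := ∑ k ∈ s, lp.single 2 k (a k)
  set v : H := ∑ k ∈ s, a k • y k
  set S : ℝ := ∑ k ∈ s, ‖a k‖ ^ 2
  have hS0 : 0 ≤ S := Finset.sum_nonneg fun _ _ => by positivity
  have hc : ‖c‖ ^ 2 = S := by
    have := lp.norm_sum_single (p := 2) (E := fun _ : ℕ => ℂ) (by norm_num) a s
    simpa using this
  have hv1 : ⟪v, φ⟫_ℂ = S := by
    simp only [v, sum_inner, inner_smul_left, S, Complex.ofReal_sum]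
    refine Finset.sum_congr rfl fun k _ => ?_
    change _ * a k = _
    rw [mul_comm, Complex.mul_conj']
    push_cast
    rfl
  have hTc : ∀ k, T c k = ⟪y k, v⟫_ℂ := by
    intro k
    simp only [c, v, map_sum, inner_sum, inner_smul_right, lp.coeFn_sum, Finset.sum_apply]
    refine Finset.sum_congr rfl fun j _ => ?_
    rw [← hT, show lp.single 2 j (a j) = a j • (lp.single 2 j (1 : ℂ) : l2) by
      rw [← lp.single_smul, smul_eq_mul, mul_one], map_smul]
    rfl
  have hv2 : ‖v‖ ^ 2 ≤ ‖T‖ * S := by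
    have e : ⟪c, T c⟫_ℂ = ⟪v, v⟫_ℂ := by
      simp only [c, sum_inner, lp.inner_single_left]
      change ∑ k ∈ s, ⟪a k, T c k⟫_ℂ = _
      simp only [hTc, v, sum_inner, inner_smul_left]
      refine Finset.sum_congr rfl fun k _ => ?_
      rw [RCLike.inner_apply, mul_comm]
    rw [inner_self_eq_norm_sq_to_K] at e
    have h1 : ‖v‖ ^ 2 = ‖⟪c, T c⟫_ℂ‖ := by
      rw [e]; simp
    rw [h1, ← hc]
    calc ‖⟪c, T c⟫_ℂ‖ ≤ ‖c‖ * (‖T‖ * ‖c‖) :=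
          (norm_inner_le_norm _ _).trans (by gcongr; exact T.le_opNorm c)
      _ = ‖T‖ * ‖c‖ ^ 2 := by ring
  have h3 : S ≤ ‖v‖ * ‖φ‖ := by
    have := norm_inner_le_norm (𝕜 := ℂ) v φ
    rwa [hv1, Complex.norm_real, Real.norm_of_nonneg hS0] at this
  have h4 : S * S ≤ S * (‖T‖ * ‖φ‖ ^ 2) :=
    calc S * S ≤ (‖v‖ * ‖φ‖) * (‖v‖ * ‖φ‖) := by gcongr
      _ = ‖v‖ ^ 2 * ‖φ‖ ^ 2 := by ring
      _ ≤ ‖T‖ * S * ‖φ‖ ^ 2 := by gcongr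
      _ = _ := by ring
  rcases hS0.eq_or_lt with h | h
  · rw [← h]; positivity
  · exact le_of_mul_le_mul_left h4 h

/-- The analysis operator `φ ↦ (⟪y k, φ⟫)ₖ` of a complete system whose Gram operator `T` is bounded
and boundedly invertible, with its frame bounds. The lower one follows from the reconstruction
formula `φ = W* T⁻¹ W φ`. -/
lemma exists_analysis_operator [CompleteSpace H] {y : ℕ → H} (T : l2 ≃L[ℂ] l2)
    (hT : ∀ j k, T (lp.single 2 j (1 : ℂ)) k = ⟪y k, y j⟫_ℂ)
    (hy : ∀ φ : H, (∀ k, ⟪y k, φ⟫_ℂ = 0) → φ = 0) :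
    ∃ W : H →L[ℂ] l2, (∀ φ k, W φ k = ⟪y k, φ⟫_ℂ) ∧ Function.Surjective W ∧
      (∀ φ, ‖W φ‖ ^ 2 ≤ ‖(T : l2 →L[ℂ] l2)‖ * ‖φ‖ ^ 2) ∧
      ∀ φ, ‖φ‖ ^ 2 ≤ ‖(T.symm : l2 →L[ℂ] l2)‖ * ‖W φ‖ ^ 2 := by
  have bessel := sum_norm_inner_sq_le (T := (T : l2 →L[ℂ] l2)) (y := y) hT
  have h2 : (2 : ℝ≥0∞).toReal = 2 := by norm_num
  have hmem : ∀ φ : H, Memℓp (fun k => ⟪y k, φ⟫_ℂ) 2 := fun φ =>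
    memℓp_gen' (C := ‖(T : l2 →L[ℂ] l2)‖ * ‖φ‖ ^ 2) fun s => by
      simpa [h2] using bessel φ s
  let W₀ : H →ₗ[ℂ] l2 :=
    { toFun := fun φ => ⟨fun k => ⟪y k, φ⟫_ℂ, hmem φ⟩
      map_add' := fun φ ψ => lp.ext <| funext fun k => inner_add_right _ _ _
      map_smul' := fun c φ => lp.ext <| funext fun k => inner_smul_right _ _ _ }
  have hnorm : ∀ φ, ‖W₀ φ‖ ≤ √‖(T : l2 →L[ℂ] l2)‖ * ‖φ‖ := fun φ => by
    refine lp.norm_le_of_forall_sum_le (by norm_num) (by positivity) fun s => ?_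
    have := bessel φ s
    simp only [h2, Real.rpow_ofNat, mul_pow, Real.sq_sqrt (norm_nonneg _)]
    exact this
  let W : H →L[ℂ] l2 := W₀.mkContinuous _ hnorm
  have hW : ∀ φ k, W φ k = ⟪y k, φ⟫_ℂ := fun φ k => rfl
  set Z := ContinuousLinearMap.adjoint W
  have hZ : ∀ j, Z (lp.single 2 j (1 : ℂ)) = y j := by
    intro j
    refine ext_inner_right ℂ fun ψ => ?_
    rw [ContinuousLinearMap.adjoint_inner_left, lp.inner_single_left, hW]
    simp
  have hWZ : W.comp Z = (T : l2 →L[ℂ] l2) := by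
    refine lp.ext_continuousLinearMap (by norm_num) fun j => ?_
    refine ContinuousLinearMap.ext_ring (lp.ext <| funext fun k => ?_)
    change W (Z (lp.single 2 j (1 : ℂ))) k = T (lp.single 2 j (1 : ℂ)) k
    rw [hZ, hW, hT]
  have hWZ' : ∀ c, W (Z (T.symm c)) = c := by
    intro c
    have := DFunLike.congr_fun hWZ (T.symm c)
    simpa only [ContinuousLinearMap.comp_apply, ContinuousLinearEquiv.coe_coe,
      ContinuousLinearEquiv.apply_symm_apply] using this
  refine ⟨W, hW, fun c => ⟨Z (T.symm c), hWZ' c⟩, fun φ => ?_, fun φ => ?_⟩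
  · calc ‖W φ‖ ^ 2 ≤ (√‖(T : l2 →L[ℂ] l2)‖ * ‖φ‖) ^ 2 := by
          gcongr; exact hnorm φ
      _ = _ := by rw [mul_pow, Real.sq_sqrt (norm_nonneg _)]
  · have hφ : φ = Z (T.symm (W φ)) := by
      refine sub_eq_zero.1 (hy _ fun k => ?_)
      have e : W (φ - Z (T.symm (W φ))) = 0 := by rw [map_sub, hWZ', sub_self]
      rw [← hW, e]
      rfl
    have e : ⟪φ, φ⟫_ℂ = ⟪W φ, T.symm (W φ)⟫_ℂ := by
      rw [← ContinuousLinearMap.adjoint_inner_right, ← hφ]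
    have h1 : ‖φ‖ ^ 2 = ‖⟪W φ, T.symm (W φ)⟫_ℂ‖ := by
      rw [← e, inner_self_eq_norm_sq_to_K]; simp
    rw [h1]
    calc ‖⟪W φ, T.symm (W φ)⟫_ℂ‖ ≤ ‖W φ‖ * (‖(T.symm : l2 →L[ℂ] l2)‖ * ‖W φ‖) :=
          (norm_inner_le_norm _ _).trans (by
            gcongr; exact (T.symm : l2 →L[ℂ] l2).le_opNorm _)
      _ = _ := by ring

end Gram

/-! ### Eigenvalue counting and the lower bound of the Riesz constant -/

section RieszConstant

variable {q : ℂ → ℂ} {ε : ℝ}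

lemma integral_norm_sq_L2 (f : L2) :
    ∫ x, ‖f x‖ ^ 2 ∂((volume : Measure ℝ).restrict (Ioo (-1) 1)) = ‖f‖ ^ 2 := by
  have h : ((‖f‖ ^ 2 : ℝ) : ℂ) = ⟪f, f⟫_ℂ := by
    rw [inner_self_eq_norm_sq_to_K]; simp
  rw [L2.inner_def] at h
  simp_rw [inner_self_eq_norm_sq_to_K] at h
  rw [← Complex.ofReal_inj, h, ← integral_complex_ofReal]
  simp

/-- The number of eigenvalues in a disc is `O(ε⁻⁴)` times the upper frame bound: by Green's formula
the values `z k x` are coefficients of functions with bounded norm, so `∑ |z k x|²` is bounded by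
Bessel's inequality. -/
lemma card_eigenvalues_le (hq : ContinuousOn (fun x : ℝ => q x) (Icc (-1) 1)) (hε : 0 < ε)
    (hε1 : ε ≤ 1) {Q M B : ℝ} (hQ : ∀ x ∈ Icc (-1 : ℝ) 1, ‖q x‖ ≤ Q) {z : ℕ → L2} {m : ℕ → ℂ}
    (hz : ∀ k, IsSolution q ε (m k) (z k) 0) (hz1 : ∀ k, ‖z k‖ = 1) (hB : 0 ≤ B)
    (bessel : ∀ (s : Finset ℕ) (φ : L2), ∑ k ∈ s, ‖bilin (z k) φ‖ ^ 2 ≤ B * ‖φ‖ ^ 2)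
    {s : Finset ℕ} (hs : ∀ k ∈ s, ‖m k‖ ≤ M) (hM : 0 ≤ M) :
    ε ^ 4 * s.card ≤ 64 * (Q ^ 2 + (M + 1) ^ 2) * B := by
  have hQ0 : 0 ≤ Q := (norm_nonneg _).trans (hQ 0 (by simp))
  -- With `κ = π / 4` one has `sin (2κ) = 1`.
  set κ : ℂ := ((Real.pi / 4 : ℝ) : ℂ)
  have hκim : κ.im = 0 := Complex.ofReal_im _
  have hsin : Complex.sin (2 * κ) = 1 := by
    rw [show 2 * κ = ((Real.pi / 2 : ℝ) : ℂ) by simp only [κ]; push_cast; ring,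
      ← Complex.ofReal_sin, Real.sin_pi_div_two, Complex.ofReal_one]
  have hκn : ‖κ‖ = Real.pi / 4 := by
    rw [Complex.norm_real, Real.norm_of_nonneg (by positivity)]
  choose y hy hg using fun k => (hz k).green_formula hq hε.ne'
  have h1c : ContinuousOn (fun _ : ℝ => (1 : ℂ)) (Icc (-1) 1) := continuousOn_const
  have pointwise : ∀ x ∈ Icc (-1 : ℝ) 1,
      ∑ k ∈ s, ‖y k x‖ ^ 2 ≤ 32 * (Q ^ 2 + (M + 1) ^ 2) * B / ε ^ 4 := by
    intro x hx
    have b1 := norm_greenL2_le hq hQ κ hx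
    have b2 := norm_greenL2_le (P := 1) h1c (by simp) κ hx
    rw [hκim, abs_zero, mul_zero, Real.exp_zero] at b1 b2
    have term : ∀ k ∈ s, ε ^ 4 * ‖y k x‖ ^ 2 ≤
        4 * ‖bilin (z k) (greenL2 hq κ x)‖ ^ 2
          + 4 * (M + 1) ^ 2 * ‖bilin (z k) (greenL2 h1c κ x)‖ ^ 2 := by
      intro k hk
      have e := congrArg norm (hg k κ x hx)
      rw [zero_add, hsin, mul_one, bilin_smul_right, bilin_comm _ (z k), bilin_comm _ (z k)] at e
      have hc : ‖m k + Complex.I * (ε : ℂ) ^ 2 * κ ^ 2‖ ≤ M + 1 := by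
        refine (norm_add_le _ _).trans (add_le_add (hs k hk) ?_)
        rw [norm_mul, norm_mul, norm_pow, norm_pow, hκn, Complex.norm_I, Complex.norm_real,
          Real.norm_of_nonneg hε.le, one_mul]
        have : Real.pi / 4 ≤ 1 := by linarith [Real.pi_le_four]
        exact mul_le_one₀ (pow_le_one₀ hε.le hε1) (by positivity)
          (pow_le_one₀ (by positivity) this)
      have e2 := e.le.trans (norm_sub_le _ _)
      rw [norm_mul, norm_mul, norm_mul, norm_mul, norm_pow, hκn, Complex.norm_I,
        Complex.norm_real, Real.norm_of_nonneg hε.le, one_mul] at e2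
      set α := ‖bilin (z k) (greenL2 hq κ x)‖
      set β := ‖bilin (z k) (greenL2 h1c κ x)‖
      have hβ : 0 ≤ β := norm_nonneg _
      have e3 : ε ^ 2 * (Real.pi / 4) * ‖y k x‖ ≤ α + (M + 1) * β :=
        e2.trans (by gcongr)
      have e4 : (ε ^ 2 * (Real.pi / 4) * ‖y k x‖) ^ 2 ≤ (α + (M + 1) * β) ^ 2 := by gcongr
      have e5 : 1 / 2 ≤ (Real.pi / 4) ^ 2 := by nlinarith [Real.pi_gt_three]
      have e6 : 0 ≤ ε ^ 4 * ‖y k x‖ ^ 2 := by positivity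
      nlinarith [sq_nonneg (α - (M + 1) * β), mul_le_mul_of_nonneg_left e5 e6]
    have hsum := Finset.sum_le_sum term
    rw [Finset.sum_add_distrib, ← Finset.mul_sum, ← Finset.mul_sum, ← Finset.mul_sum] at hsum
    have s1 := bessel s (greenL2 hq κ x)
    have s2 := bessel s (greenL2 h1c κ x)
    have s3 : ‖greenL2 hq κ x‖ ^ 2 ≤ (2 * (Q * 1)) ^ 2 := by gcongr
    have s4 : ‖greenL2 h1c κ x‖ ^ 2 ≤ (2 * (1 * 1)) ^ 2 := by gcongr
    rw [le_div_iff₀ (by positivity), mul_comm]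
    calc _ ≤ _ := hsum
      _ ≤ 4 * (B * (2 * (Q * 1)) ^ 2) + 4 * (M + 1) ^ 2 * (B * (2 * (1 * 1)) ^ 2) := by
          gcongr
          · exact s1.trans (by gcongr)
          · exact s2.trans (by gcongr)
      _ ≤ 32 * (Q ^ 2 + (M + 1) ^ 2) * B := by
          nlinarith [mul_nonneg hB (sq_nonneg Q), mul_nonneg hB (sq_nonneg (M + 1))]
  have hi : ∀ k, Integrable (fun x => ‖z k x‖ ^ 2) ((volume : Measure ℝ).restrict (Ioo (-1) 1)) :=
    fun k => (Lp.memLp (z k)).integrable_norm_pow (by norm_num)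
  have hcard : (s.card : ℝ) = ∫ x, ∑ k ∈ s, ‖z k x‖ ^ 2
      ∂((volume : Measure ℝ).restrict (Ioo (-1) 1)) := by
    rw [integral_finsetSum _ fun k _ => hi k]
    simp [integral_norm_sq_L2, hz1]
  have hle : (s.card : ℝ) ≤ ∫ _, 32 * (Q ^ 2 + (M + 1) ^ 2) * B / ε ^ 4
      ∂((volume : Measure ℝ).restrict (Ioo (-1) 1)) := by
    rw [hcard]
    refine integral_mono_ae (integrable_finsetSum _ fun k _ => hi k) (integrable_const _) ?_
    filter_upwards [ae_all_iff.2 hy, ae_restrict_mem measurableSet_Ioo] with x e hx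
    simp only [e]
    exact pointwise x (Ioo_subset_Icc_self hx)
  simp only [integral_const, smul_eq_mul, measureReal_restrict_apply_univ,
    Real.volume_real_Ioo] at hle
  norm_num at hle
  rw [← mul_div_assoc, le_div_iff₀ (by positivity)] at hle
  linarith

/-- If at most `n` terms of the sequence `m` lie in a disc that contains `ball l (2ρ)`, some point
of `ball l ρ` keeps a distance of order `ρ / n` from all terms: each of `n + 1` equidistant points
would otherwise have a term of its own nearby. -/
lemma exists_far_point {m : ℕ → ℂ} {l : ℂ} {ρ : ℝ} (hρ : 0 < ρ) {n : ℕ}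
    (hn : ∀ s : Finset ℕ, (∀ k ∈ s, ‖m k‖ ≤ ‖l‖ + 2 * ρ) → s.card ≤ n) :
    ∃ l' ∈ Metric.ball l ρ, ∀ k, ρ / (2 * (n + 1)) ≤ ‖m k - l'‖ := by
  by_contra! hcon
  have hn1 : (0 : ℝ) < n + 1 := by positivity
  let p : Fin (n + 1) → ℂ := fun j => l + ((ρ * (j / (n + 1)) : ℝ) : ℂ)
  have hd : ∀ i j, ‖p i - p j‖ = ρ / (n + 1) * |(i : ℝ) - j| := by
    intro i j
    have : p i - p j = ((ρ / (n + 1) * ((i : ℝ) - j) : ℝ) : ℂ) := by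
      simp only [p]; push_cast; ring
    rw [this, Complex.norm_real, Real.norm_eq_abs, abs_mul, abs_of_pos (by positivity)]
  have hp : ∀ j, p j ∈ Metric.ball l ρ := by
    intro j
    have hj : (j : ℝ) < n + 1 := by exact_mod_cast j.2
    rw [mem_ball_iff_norm, add_sub_cancel_left, Complex.norm_real,
      Real.norm_of_nonneg (by positivity)]
    exact mul_lt_of_lt_one_right hρ ((div_lt_one hn1).2 hj)
  choose k hk using fun j => hcon (p j) (hp j)
  have hinj : Function.Injective k := by
    intro i j hij
    by_contra hne
    have h1 : (1 : ℝ) ≤ |(i : ℝ) - j| := by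
      have : (1 : ℤ) ≤ |(i : ℤ) - j| := Int.one_le_abs (sub_ne_zero.2 (by
        exact_mod_cast fun h => hne (Fin.ext h)))
      exact_mod_cast this
    have h2 : ‖p i - p j‖ ≤ ‖m (k j) - p j‖ + ‖m (k i) - p i‖ := by
      rw [← hij]
      calc ‖p i - p j‖ = ‖(m (k i) - p j) - (m (k i) - p i)‖ := by congr 1; ring
        _ ≤ _ := norm_sub_le _ _
    have h3 : ρ / (2 * (n + 1)) + ρ / (2 * (n + 1)) = ρ / (n + 1) := by field_simp; norm_num
    have h4 : ρ / (n + 1) * 1 ≤ ρ / (n + 1) * |(i : ℝ) - j| := by gcongr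
    linarith [hk i, hk j, hd i j]
  have := hn (Finset.univ.image k) (by
    intro k' hk'
    obtain ⟨j, -, rfl⟩ := Finset.mem_image.1 hk'
    have h1 : ρ / (2 * (n + 1)) ≤ ρ := div_le_self hρ.le (by
      have : (0 : ℝ) ≤ n := n.cast_nonneg
      linarith)
    have h2 := mem_ball_iff_norm.1 (hp j)
    calc ‖m (k j)‖ = ‖(m (k j) - p j) + (p j - l) + l‖ := by congr 1; ring
      _ ≤ ‖m (k j) - p j‖ + ‖p j - l‖ + ‖l‖ := norm_add₃_le
      _ ≤ _ := by linarith [hk j])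
  rw [Finset.card_image_of_injective _ hinj, Finset.card_univ, Fintype.card_fin] at this
  omega

/-- A pseudomode at `l` bounds the Riesz constant from below in terms of the distance of `l` from
the eigenvalues. -/
lemma sq_mul_norm_sq_le {z : ℕ → L2} {m : ℕ → ℂ}
    (hq : ContinuousOn (fun x : ℝ => q x) (Icc (-1) 1)) (hε : ε ≠ 0)
    (hz : ∀ k, IsSolution q ε (m k) (z k) 0) {W : L2 →L[ℂ] l2}
    (hW : ∀ φ k, W φ k = bilin (z k) φ) {A B : ℝ} (hA : 0 ≤ A)
    (hB : ∀ φ, ‖W φ‖ ^ 2 ≤ B * ‖φ‖ ^ 2) (hA' : ∀ φ, ‖φ‖ ^ 2 ≤ A * ‖W φ‖ ^ 2)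
    {l : ℂ} {d : ℝ} (hd : 0 < d) (hdist : ∀ k, d ≤ ‖m k - l‖) {φ r : L2}
    (h : IsSolution q ε l φ r) : d ^ 2 * ‖φ‖ ^ 2 ≤ A * B * ‖r‖ ^ 2 := by
  have key : ‖(d : ℂ) • W φ‖ ≤ ‖W r‖ := by
    refine lp.norm_mono (by norm_num) fun k => ?_
    have e := h.lagrange hq hε (hz k)
    rw [bilin_comm φ 0, bilin_zero_left, sub_zero, bilin_comm, bilin_comm φ, ← hW, ← hW] at e
    have e' : W r k = (m k - l) * W φ k := by linear_combination e
    rw [lp.coeFn_smul, Pi.smul_apply, norm_smul, e', norm_mul, Complex.norm_real,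
      Real.norm_of_nonneg hd.le]
    gcongr
    exact hdist k
  rw [norm_smul, Complex.norm_real, Real.norm_of_nonneg hd.le] at key
  calc d ^ 2 * ‖φ‖ ^ 2 ≤ d ^ 2 * (A * ‖W φ‖ ^ 2) := by gcongr; exact hA' φ
    _ = A * (d * ‖W φ‖) ^ 2 := by ring
    _ ≤ A * ‖W r‖ ^ 2 := by gcongr
    _ ≤ A * (B * ‖r‖ ^ 2) := by gcongr; exact hB r
    _ = _ := by ring

lemma exists_eigenvalue_system {z : ℕ → L2} (hz : IsNormedEigensystem (modelOp q ε) z) :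
    ∃ m : ℕ → ℂ, Function.Injective m ∧ (∀ k, IsEigenfunction (modelOp q ε) (m k) (z k)) ∧
      ∀ l y, IsEigenfunction (modelOp q ε) l y → ∃ k, ∃ c : ℂ, l = m k ∧ y = c • z k := by
  obtain ⟨⟨m, hm, hmz⟩, -, hall⟩ := hz
  refine ⟨m, hm, hmz, fun l y hy => ?_⟩
  obtain ⟨k, c, rfl⟩ := hall l y hy
  refine ⟨k, c, ?_, rfl⟩
  have h1 := (isEigenfunction_iff.1 hy).2
  have h2 := (isEigenfunction_iff.1 (hmz k)).2.smul c
  rw [smul_zero, IsSolution, zero_add] at h2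
  rw [IsSolution, zero_add] at h1
  obtain ⟨hd1, e1⟩ := exists_modelOp_eq_iff.2 h1
  obtain ⟨hd2, e2⟩ := exists_modelOp_eq_iff.2 h2
  exact smul_left_injective ℂ hy.1 (e1.symm.trans e2)

/-- Polynomial factors are absorbed by the exponential. -/
lemma exists_exp_le_of_poly {c τ : ℝ} (hc : 0 < c) (hτ : 0 < τ) :
    ∃ ε₁ > (0 : ℝ), ∀ ε, 0 < ε → ε < ε₁ →
      Real.exp (τ / ε) ≤ c * ε ^ 8 * Real.exp (2 * τ / ε) := by
  refine ⟨c * τ ^ 9 / Nat.factorial 9, by positivity, fun ε hε h => ?_⟩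
  have h1 := Real.pow_div_factorial_le_exp (τ / ε) (by positivity) 9
  have h2 : 1 ≤ c * ε ^ 8 * Real.exp (τ / ε) := by
    calc 1 ≤ c * τ ^ 9 / Nat.factorial 9 / ε := by rw [le_div_iff₀ hε]; linarith
      _ = c * ε ^ 8 * ((τ / ε) ^ 9 / Nat.factorial 9) := by field_simp
      _ ≤ _ := by gcongr
  calc Real.exp (τ / ε) = 1 * Real.exp (τ / ε) := (one_mul _).symm
    _ ≤ c * ε ^ 8 * Real.exp (τ / ε) * Real.exp (τ / ε) := by gcongr
    _ = _ := by rw [mul_assoc, ← Real.exp_add]; congr 2; ring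

/-- Exponentially good pseudomodes in a disc make the Riesz constant exponentially large: the disc
contains a point whose distance from the spectrum is bounded below by a power of `ε` divided by the
upper frame bound. -/
lemma exists_le_rieszConstant (hq : ContinuousOn (fun x : ℝ => q x) (Icc (-1) 1)) {l : ℂ}
    {ρ τ ε₀ : ℝ} (hρ : 0 < ρ) (hτ : 0 < τ) (hε₀ : 0 < ε₀)
    (hpm : ∀ ε, 0 < ε → ε < ε₀ → ∀ l' ∈ Metric.ball l ρ, ∃ φ r : L2, φ ≠ 0 ∧
      IsSolution q ε l' φ r ∧ ‖r‖ ≤ Real.exp (-(τ / ε)) * ‖φ‖) :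
    ∃ η > (0 : ℝ), ∃ ε₁ > (0 : ℝ), ∀ ε : ℝ, 0 < ε → ε < ε₁ →
      NoAssociatedFunctions (modelOp q ε) →
      ∀ z : ℕ → L2, IsNormedEigensystem (modelOp q ε) z →
        ENNReal.ofReal (Real.exp (η / ε)) ≤ rieszConstant z := by
  obtain ⟨Q, hQ⟩ := isCompact_Icc.exists_bound_of_continuousOn hq
  set M : ℝ := ‖l‖ + 2 * ρ
  have hM : 0 ≤ M := by positivity
  set P : ℝ := 64 * (Q ^ 2 + (M + 1) ^ 2)
  have hP : 0 ≤ P := by positivity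
  obtain ⟨ε₁, hε₁, habs⟩ := exists_exp_le_of_poly (c := (ρ / (2 * (P + 1))) ^ 2) (by positivity) hτ
  refine ⟨τ / 3, by positivity, min (min ε₀ 1) ε₁, by positivity, fun ε hε hlt hNA z hz => ?_⟩
  obtain ⟨⟨hlt0, hlt1⟩, hlt2⟩ := by simpa only [lt_min_iff] using hlt
  obtain ⟨m, hm, hmz, hall⟩ := exists_eigenvalue_system hz
  have hsol := fun k => (isEigenfunction_iff.1 (hmz k)).2
  refine le_iInf fun T => le_iInf fun hT => ?_
  -- `T` is the Gram operator of the conjugate functions, whose coefficients `⟪star z_k, φ⟫` are the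
  -- values of the bilinear form
  have hT' : ∀ j k, T (lp.single 2 j (1 : ℂ)) k = ⟪star (z k), star (z j)⟫_ℂ := by
    intro j k
    refine (hT j k).trans ?_
    rw [← star_star (z j)]
    change bilin _ _ = bilin _ _
    rw [star_star, bilin_comm]
  obtain ⟨W, hW, hWs, hWB, hWA⟩ := exists_analysis_operator T hT' fun φ hφ =>
    eq_zero_of_forall_bilin_eq_zero hq hε hNA hm hmz hall hφ
  have bessel := sum_norm_inner_sq_le (T := (T : l2 →L[ℂ] l2)) (y := fun k => star (z k)) hT'
  set B := ‖(T : l2 →L[ℂ] l2)‖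
  set A := ‖(T.symm : l2 →L[ℂ] l2)‖
  have hB0 : 0 ≤ B := norm_nonneg _
  have hA0 : 0 ≤ A := norm_nonneg _
  -- The diagonal entries of the Gram matrix are `1`, so both frame bounds are at least `1`.
  have hWz : 1 ≤ ‖W (star (z 0))‖ := by
    have := lp.norm_apply_le_norm (by norm_num) (W (star (z 0))) 0
    rwa [hW, inner_self_eq_norm_sq_to_K, L2_norm_star, hz.2.1 0, RCLike.ofReal_one, one_pow,
      norm_one] at this
  have hB1 : 1 ≤ B := by
    have := hWB (star (z 0))
    rw [L2_norm_star, hz.2.1 0] at this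
    nlinarith
  have hA1 : 1 ≤ A := by
    obtain ⟨g, hg⟩ := hWs (lp.single 2 0 1)
    have h1 : ‖W g‖ = 1 := by rw [hg, lp.norm_single (by norm_num), norm_one]
    have h2 : 1 ≤ ‖g‖ := by
      have := norm_inner_le_norm (𝕜 := ℂ) (star (z 0)) g
      rwa [← hW, hg, lp.single_apply_self, norm_one, L2_norm_star, hz.2.1 0, one_mul] at this
    have h3 := hWA g
    rw [h1] at h3
    nlinarith
  set n : ℕ := ⌊P * B / ε ^ 4⌋₊
  obtain ⟨l', hl', hfar⟩ := exists_far_point (m := m) (l := l) hρ (n := n) fun s hs => by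
    have := card_eigenvalues_le hq hε hlt1.le hQ hsol hz.2.1 hB0 (fun s φ => bessel φ s) hs hM
    refine Nat.le_floor ?_
    rw [le_div_iff₀ (by positivity)]
    linarith
  obtain ⟨φ, r, hφ, hs, hr⟩ := hpm ε hε hlt0 l' hl'
  have hn : (n : ℝ) + 1 ≤ (P + 1) * B / ε ^ 4 := by
    have h1 : (n : ℝ) ≤ P * B / ε ^ 4 := Nat.floor_le (by positivity)
    have h2 : 1 ≤ B / ε ^ 4 := by
      rw [le_div_iff₀ (by positivity), one_mul]
      exact (pow_le_one₀ hε.le hlt1.le).trans hB1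
    calc (n : ℝ) + 1 ≤ P * B / ε ^ 4 + B / ε ^ 4 := add_le_add h1 h2
      _ = _ := by ring
  have hd : ρ / (2 * (P + 1)) * ε ^ 4 ≤ B * (ρ / (2 * (n + 1))) := by
    rw [le_div_iff₀ (by positivity)] at hn
    rw [div_mul_eq_mul_div, ← mul_div_assoc, div_le_div_iff₀ (by positivity) (by positivity)]
    nlinarith [mul_le_mul_of_nonneg_left hn hρ.le]
  have hφ0 : 0 < ‖φ‖ := norm_pos_iff.2 hφ
  have h1 := sq_mul_norm_sq_le hq hε.ne' hsol hW hA0 hWB hWA (by positivity) hfar hs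
  have h2 : (ρ / (2 * ((n : ℝ) + 1))) ^ 2 ≤ A * B * Real.exp (-(τ / ε)) ^ 2 := by
    refine le_of_mul_le_mul_right ?_ (pow_pos hφ0 2)
    calc _ ≤ A * B * ‖r‖ ^ 2 := h1
      _ ≤ A * B * (Real.exp (-(τ / ε)) * ‖φ‖) ^ 2 := by gcongr
      _ = _ := by ring
  have h3 : Real.exp (τ / ε) ≤ (A * B) ^ 3 := by
    calc Real.exp (τ / ε) ≤ (ρ / (2 * (P + 1))) ^ 2 * ε ^ 8 * Real.exp (2 * τ / ε) :=
          habs ε hε hlt2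
      _ = (ρ / (2 * (P + 1)) * ε ^ 4) ^ 2 * Real.exp (2 * τ / ε) := by ring
      _ ≤ (B * (ρ / (2 * (n + 1)))) ^ 2 * Real.exp (2 * τ / ε) := by gcongr
      _ = B ^ 2 * (ρ / (2 * (n + 1))) ^ 2 * Real.exp (2 * τ / ε) := by ring
      _ ≤ B ^ 2 * (A * B * Real.exp (-(τ / ε)) ^ 2) * Real.exp (2 * τ / ε) := by gcongr
      _ = A * B ^ 3 * (Real.exp (-(τ / ε)) ^ 2 * Real.exp (2 * τ / ε)) := by ring
      _ = A * B ^ 3 * 1 := by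
          rw [← Real.exp_nat_mul, ← Real.exp_add, Nat.cast_ofNat]
          congr 1
          rw [Real.exp_eq_one_iff]
          ring
      _ ≤ A ^ 3 * B ^ 3 * 1 := by gcongr; exact le_self_pow₀ hA1 (by norm_num)
      _ = _ := by ring
  have h4 : Real.exp (τ / 3 / ε) ≤ B * A := by
    refine le_of_pow_le_pow_left₀ (n := 3) (by norm_num) (by positivity) ?_
    rw [← Real.exp_nat_mul, mul_comm B A]
    refine le_of_eq_of_le ?_ h3
    congr 1
    push_cast
    ring
  rw [← ofReal_norm, ← ofReal_norm, ← ENNReal.ofReal_mul (norm_nonneg _)]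
  exact ENNReal.ofReal_le_ofReal h4

end RieszConstant

/-! ### Approximate WKB solutions in a complex disc -/

/-- A holomorphic phase `S` on the disc `ball x₀ (2δ)` with derivatives `S₁`, `S₂`, where `S₁` is
close to `-iκ`, so that `Re S` increases in the directions close to `i`, and the disc is small
compared with the bound `M` of `S₂`. -/
structure IsPhase (x₀ δ κ M : ℝ) (S S₁ S₂ : ℂ → ℂ) : Prop where
  delta_pos : 0 < δ
  kappa_pos : 0 < κ
  hasDerivAt : ∀ x ∈ Metric.ball (x₀ : ℂ) (2 * δ), HasDerivAt S (S₁ x) x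
  hasDerivAt_one : ∀ x ∈ Metric.ball (x₀ : ℂ) (2 * δ), HasDerivAt S₁ (S₂ x) x
  differentiableOn : DifferentiableOn ℂ S₂ (Metric.ball (x₀ : ℂ) (2 * δ))
  norm_deriv_add_le : ∀ x ∈ Metric.ball (x₀ : ℂ) (2 * δ), ‖S₁ x + Complex.I * κ‖ ≤ κ / 4
  norm_deriv_two_le : ∀ x ∈ Metric.ball (x₀ : ℂ) (2 * δ), ‖S₂ x‖ ≤ M
  small : 24 * δ * M ≤ κ

/-- The part of the disc `ball x₀ (2δ)` in the cone of opening `π/2` above the point `x₀ - iδ`. It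
contains the real interval `[x₀ - δ, x₀ + δ]`. -/
def coneSector (x₀ δ : ℝ) : Set ℂ :=
  {x | x ∈ Metric.ball (x₀ : ℂ) (2 * δ) ∧ |x.re - x₀| ≤ x.im + δ}

lemma coneSector_apex_mem {x₀ δ : ℝ} (hδ : 0 < δ) :
    (x₀ : ℂ) - δ * Complex.I ∈ Metric.ball (x₀ : ℂ) (2 * δ) := by
  rw [mem_ball_iff_norm, sub_sub_cancel_left, norm_neg, norm_mul, Complex.norm_I,
    Complex.norm_real, Real.norm_of_nonneg hδ.le]
  linarith

lemma ofReal_mem_coneSector {x₀ δ x : ℝ} (hδ : 0 < δ) (hx : |x - x₀| ≤ δ) :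
    (x : ℂ) ∈ coneSector x₀ δ := by
  refine ⟨?_, by simpa using hx⟩
  rw [mem_ball_iff_norm, ← Complex.ofReal_sub, Complex.norm_real, Real.norm_eq_abs]
  linarith

lemma coneSector_segment {x₀ δ : ℝ} (hδ : 0 < δ) {x : ℂ} (hx : x ∈ coneSector x₀ δ) {t : ℝ}
    (ht : t ∈ Icc (0 : ℝ) 1) :
    ((x₀ : ℂ) - δ * Complex.I) + t * (x - (x₀ - δ * Complex.I)) ∈ coneSector x₀ δ := by
  constructor
  · have := (convex_ball (x₀ : ℂ) (2 * δ)).add_smul_sub_mem (coneSector_apex_mem hδ) hx.1 ht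
    simpa using this
  · have h := hx.2
    simp only [Complex.add_re, Complex.sub_re, Complex.ofReal_re, Complex.mul_re, Complex.I_re,
      Complex.ofReal_im, Complex.I_im, Complex.add_im, Complex.sub_im, Complex.mul_im]
    ring_nf
    rw [show -(x₀ * t) + t * x.re = t * (x.re - x₀) by ring, abs_mul, abs_of_nonneg ht.1]
    nlinarith [mul_le_mul_of_nonneg_left h ht.1]

namespace IsPhase

variable {x₀ δ κ M : ℝ} {S S₁ S₂ : ℂ → ℂ}

/-- Along the rays from the apex of the cone `Re S` increases at a definite rate. -/
lemma re_mul_ge (h : IsPhase x₀ δ κ M S S₁ S₂) {x y : ℂ} (hx : x ∈ coneSector x₀ δ)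
    (hy : y ∈ Metric.ball (x₀ : ℂ) (2 * δ)) :
    κ / 4 * ‖x - (x₀ - δ * Complex.I)‖ ≤ (S₁ y * (x - (x₀ - δ * Complex.I))).re := by
  set d := x - (x₀ - δ * Complex.I)
  have hd : |d.re| ≤ d.im := by simpa [d] using hx.2
  have h1 : ‖d‖ ≤ 2 * d.im := by
    have := Complex.norm_le_abs_re_add_abs_im d
    rw [abs_of_nonneg ((abs_nonneg _).trans hd)] at this
    linarith
  have h2 : ‖(S₁ y + Complex.I * κ) * d‖ ≤ κ / 4 * ‖d‖ := by
    rw [norm_mul]; gcongr; exact h.norm_deriv_add_le y hy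
  have h3 : (S₁ y * d).re = ((S₁ y + Complex.I * κ) * d).re + κ * d.im := by
    simp; ring
  have h4 := (abs_le.1 ((Complex.abs_re_le_norm _).trans h2)).1
  rw [h3]
  nlinarith [h.kappa_pos]

/-- One step of the iteration for `w'' + (2 S'/ε) w' + (S''/ε) w = 0`: a solution of
`v'' + (2 S'/ε) v' = -(S''/ε) g`, obtained from `(exp (2S/ε) v')' = -(S''/ε) g exp (2S/ε)` by two
integrations from the apex. As `Re S` increases along the rays from the apex, the first integration
compensates the factor `1/ε`, and the second one costs a factor `O(δ)`; hence the bounds are uniform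
in `ε`. -/
lemma exists_iterate (h : IsPhase x₀ δ κ M S S₁ S₂) {ε C : ℝ} (hε : 0 < ε) {g : ℂ → ℂ}
    (hg : DifferentiableOn ℂ g (Metric.ball (x₀ : ℂ) (2 * δ)))
    (hgC : ∀ x ∈ coneSector x₀ δ, ‖g x‖ ≤ C) :
    ∃ v v₁ : ℂ → ℂ, (∀ x ∈ Metric.ball (x₀ : ℂ) (2 * δ), HasDerivAt v (v₁ x) x) ∧
      (∀ x ∈ Metric.ball (x₀ : ℂ) (2 * δ),
        HasDerivAt v₁ (-(S₂ x / ε * g x) - 2 / ε * S₁ x * v₁ x) x) ∧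
      (∀ x ∈ coneSector x₀ δ, ‖v₁ x‖ ≤ 2 * M / κ * C) ∧
      ∀ x ∈ coneSector x₀ δ, ‖v x‖ ≤ C / 3 := by
  have hδ := h.delta_pos
  have hκ := h.kappa_pos
  set b : ℂ := x₀ - δ * Complex.I with hb
  have hbU : b ∈ Metric.ball (x₀ : ℂ) (2 * δ) := coneSector_apex_mem hδ
  have hM : 0 ≤ M := (norm_nonneg _).trans (h.norm_deriv_two_le b hbU)
  have hSd : DifferentiableOn ℂ S (Metric.ball (x₀ : ℂ) (2 * δ)) := fun x hx =>
    (h.hasDerivAt x hx).differentiableAt.differentiableWithinAt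
  have hE : ∀ x ∈ Metric.ball (x₀ : ℂ) (2 * δ), ∀ a : ℂ,
      HasDerivAt (fun x => Complex.exp (a * S x)) (Complex.exp (a * S x) * (a * S₁ x)) x :=
    fun x hx a => ((h.hasDerivAt x hx).const_mul a).cexp
  obtain ⟨P, hPb, hP⟩ := (DifferentiableOn.isExactOn_ball (f := fun x =>
    -(S₂ x / ε * g x) * Complex.exp (2 / ε * S x))
    (((h.differentiableOn.div_const _).mul hg).neg.mul
      (hSd.const_mul _).cexp)).with_val_at b 0
  let v₁ : ℂ → ℂ := fun x => Complex.exp (-(2 / ε) * S x) * P x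
  have hv₁ : ∀ x ∈ Metric.ball (x₀ : ℂ) (2 * δ),
      HasDerivAt v₁ (-(S₂ x / ε * g x) - 2 / ε * S₁ x * v₁ x) x := by
    intro x hx
    have := (hE x hx (-(2 / ε))).mul (hP x hx)
    refine this.congr_deriv ?_
    have e : Complex.exp (-(2 / ε) * S x) * Complex.exp (2 / ε * S x) = 1 := by
      rw [← Complex.exp_add]; simp
    simp only [v₁]
    linear_combination -(S₂ x / ε * g x) * e
  obtain ⟨v, hvb, hv⟩ := (DifferentiableOn.isExactOn_ball (f := v₁) fun x hx =>
    (hv₁ x hx).differentiableAt.differentiableWithinAt).with_val_at b 0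
  have bound₁ : ∀ x ∈ coneSector x₀ δ, ‖v₁ x‖ ≤ 2 * M / κ * C := by
    intro x hx
    have hC : 0 ≤ C := (norm_nonneg _).trans (hgC x hx)
    let γ : ℝ → ℂ := fun t => b + t * (x - b)
    have hγ : ∀ t : ℝ, HasDerivAt γ (x - b) t := fun t => by
      have := ((Complex.ofRealCLM.hasDerivAt (x := t)).mul_const (x - b)).const_add b
      refine this.congr_deriv ?_
      simp
    have hγT : ∀ t ∈ Icc (0 : ℝ) 1, γ t ∈ coneSector x₀ δ := fun t ht =>
      coneSector_segment hδ hx ht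
    have hSγ : ∀ t ∈ Icc (0 : ℝ) 1,
        HasDerivAt (fun t => (S (γ t)).re) (S₁ (γ t) * (x - b)).re t := fun t ht =>
      (Complex.reCLM.hasFDerivAt.comp_hasDerivAt t
        ((h.hasDerivAt _ (hγT t ht).1).comp t (hγ t)))
    have hB : ∀ t ∈ Icc (0 : ℝ) 1, HasDerivAt
        (fun t => 2 * M / κ * C * Real.exp (2 / ε * (S (γ t)).re))
        (2 * M / κ * C * (Real.exp (2 / ε * (S (γ t)).re) *
          (2 / ε * (S₁ (γ t) * (x - b)).re))) t := fun t ht =>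
      ((hSγ t ht).const_mul (2 / ε)).exp.const_mul _
    have hPγ : ∀ t ∈ Icc (0 : ℝ) 1, HasDerivAt (fun t => P (γ t))
        (-(S₂ (γ t) / ε * g (γ t)) * Complex.exp (2 / ε * S (γ t)) * (x - b)) t := fun t ht =>
      (hP _ (hγT t ht).1).comp t (hγ t)
    have key := image_norm_le_of_norm_deriv_right_le_deriv_boundary' (a := 0) (b := 1)
      (fun t ht => (hPγ t ht).continuousAt.continuousWithinAt)
      (fun t ht => (hPγ t (Ico_subset_Icc_self ht)).hasDerivWithinAt)
      (by simp only [γ, Complex.ofReal_zero, zero_mul, add_zero, hPb, norm_zero]; positivity)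
      (fun t ht => (hB t ht).continuousAt.continuousWithinAt)
      (fun t ht => (hB t (Ico_subset_Icc_self ht)).hasDerivWithinAt)
      (fun t ht => by
        have ht' := hγT t (Ico_subset_Icc_self ht)
        have hexp : ‖Complex.exp (2 / ε * S (γ t))‖ = Real.exp (2 / ε * (S (γ t)).re) := by
          rw [Complex.norm_exp]
          congr 1
          rw [show (2 / ε : ℂ) = ((2 / ε : ℝ) : ℂ) by push_cast; rfl, Complex.re_ofReal_mul]
        rw [norm_mul, norm_mul, norm_neg, norm_mul, norm_div, hexp, Complex.norm_real,
          Real.norm_of_nonneg hε.le]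
        have r1 := h.re_mul_ge hx ht'.1
        rw [← hb] at r1
        calc ‖S₂ (γ t)‖ / ε * ‖g (γ t)‖ * Real.exp (2 / ε * (S (γ t)).re) * ‖x - b‖
            ≤ M / ε * C * Real.exp (2 / ε * (S (γ t)).re) * ‖x - b‖ := by
              gcongr
              · exact h.norm_deriv_two_le _ ht'.1
              · exact hgC _ ht'
          _ = 2 * M / κ * C * (Real.exp (2 / ε * (S (γ t)).re) *
                (2 / ε * (κ / 4 * ‖x - b‖))) := by field_simp; ring
          _ ≤ _ := by gcongr)
      (right_mem_Icc.2 zero_le_one)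
    simp only [γ, Complex.ofReal_one, one_mul, add_sub_cancel] at key
    simp only [v₁]
    rw [norm_mul, Complex.norm_exp]
    have e : (-(2 / ε) * S x : ℂ).re = -(2 / ε * (S x).re) := by
      rw [show (-(2 / ε) : ℂ) = ((-(2 / ε) : ℝ) : ℂ) by push_cast; rfl, Complex.re_ofReal_mul]
      ring
    rw [e]
    calc _ ≤ Real.exp (-(2 / ε * (S x).re)) *
          (2 * M / κ * C * Real.exp (2 / ε * (S x).re)) := by gcongr
      _ = 2 * M / κ * C := by rw [Real.exp_neg]; field_simp
  refine ⟨v, v₁, hv, hv₁, bound₁, fun x hx => ?_⟩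
  have hC : 0 ≤ C := (norm_nonneg _).trans (hgC x hx)
  have hseg : ∀ y ∈ segment ℝ b x, y ∈ coneSector x₀ δ := by
    intro y hy
    rw [segment_eq_image'] at hy
    obtain ⟨t, ht, rfl⟩ := hy
    have := coneSector_segment hδ hx ht
    rwa [← Complex.real_smul] at this
  have := (convex_segment b x).norm_image_sub_le_of_norm_hasDerivWithin_le
    (fun y hy => (hv y (hseg y hy).1).hasDerivWithinAt) (fun y hy => bound₁ y (hseg y hy))
    (left_mem_segment ℝ b x) (right_mem_segment ℝ b x)
  rw [hvb, sub_zero] at this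
  have hxb : ‖x - b‖ ≤ 4 * δ := by
    have h1 := mem_ball_iff_norm.1 hx.1
    have h2 := mem_ball_iff_norm'.1 hbU
    calc ‖x - b‖ = ‖(x - x₀) + (x₀ - b)‖ := by congr 1; ring
      _ ≤ _ := by linarith [norm_add_le (x - x₀) (x₀ - b)]
  calc ‖v x‖ ≤ 2 * M / κ * C * ‖x - b‖ := this
    _ ≤ 2 * M / κ * C * (4 * δ) := by gcongr
    _ = (24 * δ * M) / κ * C / 3 := by ring
    _ ≤ 1 * C / 3 := by gcongr; exact (div_le_one hκ).2 h.small
    _ = C / 3 := by ring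

/-- The amplitude of an approximate WKB solution: `w'' + (2 S'/ε) w' + (S''/ε) w = (S''/ε) g` with
`g = O(3⁻ᴺ)`. -/
lemma exists_amplitude (h : IsPhase x₀ δ κ M S S₁ S₂) {ε : ℝ} (hε : 0 < ε) (N : ℕ) :
    ∃ w w₁ g : ℂ → ℂ, (∀ x ∈ Metric.ball (x₀ : ℂ) (2 * δ), HasDerivAt w (w₁ x) x) ∧
      (∀ x ∈ Metric.ball (x₀ : ℂ) (2 * δ),
        HasDerivAt w₁ (S₂ x / ε * (g x - w x) - 2 / ε * S₁ x * w₁ x) x) ∧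
      DifferentiableOn ℂ g (Metric.ball (x₀ : ℂ) (2 * δ)) ∧
      (∀ x ∈ coneSector x₀ δ, ‖w x - 1‖ ≤ 1 / 2) ∧
      (∀ x ∈ coneSector x₀ δ, ‖w₁ x‖ ≤ 3 * M / κ) ∧
      ∀ x ∈ coneSector x₀ δ, ‖g x‖ ≤ (1 / 3) ^ N := by
  have hκ := h.kappa_pos
  have hM : 0 ≤ M := (norm_nonneg _).trans (h.norm_deriv_two_le _ (coneSector_apex_mem h.delta_pos))
  -- partial sums of the geometric series `∑ 3⁻ⁿ`, so that the bounds can be proved by induction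
  suffices H : ∃ w w₁ g : ℂ → ℂ, (∀ x ∈ Metric.ball (x₀ : ℂ) (2 * δ), HasDerivAt w (w₁ x) x) ∧
      (∀ x ∈ Metric.ball (x₀ : ℂ) (2 * δ),
        HasDerivAt w₁ (S₂ x / ε * (g x - w x) - 2 / ε * S₁ x * w₁ x) x) ∧
      DifferentiableOn ℂ g (Metric.ball (x₀ : ℂ) (2 * δ)) ∧
      (∀ x ∈ coneSector x₀ δ, ‖w x - 1‖ ≤ (1 - (1 / 3) ^ N) / 2) ∧
      (∀ x ∈ coneSector x₀ δ, ‖w₁ x‖ ≤ 3 * M / κ * (1 - (1 / 3) ^ N)) ∧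
      ∀ x ∈ coneSector x₀ δ, ‖g x‖ ≤ (1 / 3) ^ N by
    obtain ⟨w, w₁, g, h1, h2, h3, h4, h5, h6⟩ := H
    have hp : (0 : ℝ) ≤ (1 / 3) ^ N := by positivity
    refine ⟨w, w₁, g, h1, h2, h3, fun x hx => (h4 x hx).trans (by linarith),
      fun x hx => (h5 x hx).trans ?_, h6⟩
    exact mul_le_of_le_one_right (by positivity) (by linarith)
  induction N with
  | zero =>
    refine ⟨fun _ => 1, fun _ => 0, fun _ => 1, fun x _ => hasDerivAt_const x _, fun x _ => ?_,
      differentiableOn_const _, by simp, by simp, by simp⟩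
    simpa using hasDerivAt_const x (0 : ℂ)
  | succ N ih =>
    obtain ⟨w, w₁, g, h1, h2, h3, h4, h5, h6⟩ := ih
    obtain ⟨v, v₁, k1, k2, k3, k4⟩ := h.exists_iterate hε h3 h6
    refine ⟨fun x => w x + v x, fun x => w₁ x + v₁ x, v, fun x hx => (h1 x hx).add (k1 x hx),
      fun x hx => ((h2 x hx).add (k2 x hx)).congr_deriv (by ring),
      fun x hx => (k1 x hx).differentiableAt.differentiableWithinAt, fun x hx => ?_,
      fun x hx => ?_, fun x hx => ?_⟩
    · have e : w x + v x - 1 = (w x - 1) + v x := by ring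
      rw [e, pow_succ]
      linarith [norm_add_le (w x - 1) (v x), h4 x hx, k4 x hx]
    · refine (norm_add_le _ _).trans ((add_le_add (h5 x hx) (k3 x hx)).trans_eq ?_)
      rw [pow_succ]
      ring
    · rw [pow_succ]
      linarith [k4 x hx]

end IsPhase

/-! ### Pseudomodes -/

/-- A cutoff equal to `1` on `[x₀ - δ/2, x₀ + δ/2]` and to `0` off `[x₀ - δ, x₀ + δ]`, with its
first two derivatives. -/
lemma exists_cutoff (x₀ : ℝ) {δ : ℝ} (hδ : 0 < δ) :
    ∃ (χ χ₁ χ₂ : ℝ → ℝ) (X₁ X₂ : ℝ), (∀ x, HasDerivAt χ (χ₁ x) x) ∧ (∀ x, HasDerivAt χ₁ (χ₂ x) x) ∧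
      Continuous χ₂ ∧ (∀ x, |χ x| ≤ 1) ∧ (∀ x, |χ₁ x| ≤ X₁) ∧ (∀ x, |χ₂ x| ≤ X₂) ∧
      (∀ x, |x - x₀| ≤ δ / 2 → χ x = 1) ∧
      (∀ x, |x - x₀| < δ / 2 → χ₁ x = 0 ∧ χ₂ x = 0) ∧
      ∀ x, δ < |x - x₀| → χ x = 0 ∧ χ₁ x = 0 ∧ χ₂ x = 0 := by
  let f : ContDiffBump x₀ := ⟨δ / 2, δ, by linarith, by linarith⟩
  have hf : ContDiff ℝ (1 + 1) f := f.contDiff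
  have hf1 : ContDiff ℝ 1 (deriv f) := (contDiff_succ_iff_deriv.1 hf).2.2
  have hd : ∀ x, HasDerivAt f (deriv f x) x := fun x =>
    (hf.differentiable (by norm_num) x).hasDerivAt
  have hd1 : ∀ x, HasDerivAt (deriv f) (deriv (deriv f) x) x := fun x =>
    (hf1.differentiable (by norm_num) x).hasDerivAt
  have hc2 : Continuous (deriv (deriv f)) := hf1.continuous_deriv le_rfl
  obtain ⟨X₁, hX₁⟩ := hf1.continuous.bounded_above_of_compact_support f.hasCompactSupport.deriv
  obtain ⟨X₂, hX₂⟩ := hc2.bounded_above_of_compact_support f.hasCompactSupport.deriv.deriv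
  have hconst : ∀ (x C : ℝ), (f : ℝ → ℝ) =ᶠ[nhds x] (fun _ => C) →
      deriv f x = 0 ∧ deriv (deriv f) x = 0 := by
    intro x C h
    have h1 := h.deriv
    exact ⟨by simpa using h1.eq_of_nhds, by simpa using h1.deriv.eq_of_nhds⟩
  refine ⟨f, deriv f, deriv (deriv f), X₁, X₂, hd, hd1, hc2, fun x => ?_, hX₁, hX₂, fun x hx => ?_,
    fun x hx => ?_, fun x hx => ?_⟩
  · rw [abs_of_nonneg f.nonneg]
    exact f.le_one
  · exact f.one_of_mem_closedBall (by rwa [Metric.mem_closedBall, Real.dist_eq])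
  · exact hconst x 1 (f.eventuallyEq_one_of_mem_ball (by rwa [Metric.mem_ball, Real.dist_eq]))
  · have h0 : (f : ℝ → ℝ) =ᶠ[nhds x] fun _ => 0 := by
      have : ∀ᶠ y in nhds x, δ < |y - x₀| :=
        (isOpen_lt continuous_const (by fun_prop)).mem_nhds hx
      filter_upwards [this] with y hy
      exact f.zero_of_le_dist (by rw [Real.dist_eq]; exact hy.le)
    exact ⟨h0.eq_of_nhds, hconst x 0 h0⟩

lemma le_norm_L2 {f : L2} {x₀ s v : ℝ} (hs : 0 ≤ s) (hx₀ : |x₀| + s < 1) (hv : 0 ≤ v)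
    {y : ℝ → ℂ} (hf : f =ᵐ[(volume : Measure ℝ).restrict (Ioo (-1) 1)] y)
    (hy : ∀ x, |x - x₀| ≤ s → v ≤ ‖y x‖) : √(2 * s) * v ≤ ‖f‖ := by
  have hsub : Icc (x₀ - s) (x₀ + s) ⊆ Ioo (-1 : ℝ) 1 := fun x hx =>
    ⟨by linarith [neg_abs_le x₀, hx.1], by linarith [le_abs_self x₀, hx.2]⟩
  have hi : IntegrableOn (fun x => ‖f x‖ ^ 2) (Ioo (-1 : ℝ) 1) :=
    (Lp.memLp f).integrable_norm_pow (by norm_num)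
  have h1 : ∫ _ in Icc (x₀ - s) (x₀ + s), v ^ 2 ≤ ∫ x in Ioo (-1 : ℝ) 1, ‖f x‖ ^ 2 := by
    refine le_trans ?_ (setIntegral_mono_set hi (.of_forall fun x => by positivity)
      hsub.eventuallyLE)
    refine setIntegral_mono_on_ae (integrable_const _) (hi.mono_set hsub) measurableSet_Icc ?_
    have hf' := (ae_restrict_iff' measurableSet_Ioo).1 hf
    filter_upwards [hf'] with x hx hxI
    rw [hx (hsub hxI)]
    gcongr
    exact hy x (abs_le.2 ⟨by linarith [hxI.1], by linarith [hxI.2]⟩)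
  rw [integral_norm_sq_L2, setIntegral_const, Real.volume_real_Icc_of_le (by linarith),
    smul_eq_mul] at h1
  refine abs_le_of_sq_le_sq' (a := √(2 * s) * v) ?_ (norm_nonneg f) |>.2
  rw [mul_pow, Real.sq_sqrt (by positivity)]
  linarith

/-- A twice continuously differentiable function with the boundary values `0` belongs to the domain
of `L`, and `(L - l) φ` is the classical differential expression. -/
lemma exists_isSolution {q : ℂ → ℂ} {ε : ℝ} (hq : ContinuousOn (fun x : ℝ => q x) (Icc (-1) 1))
    (hε : ε ≠ 0) (l : ℂ) {φ φ₁ φ₂ : ℝ → ℂ} (h1 : ∀ x, HasDerivAt φ (φ₁ x) x)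
    (h2 : ∀ x, HasDerivAt φ₁ (φ₂ x) x) (hc : Continuous φ₂) (h3 : φ (-1) = 0) (h4 : φ 1 = 0) :
    ∃ f r : L2, IsSolution q ε l f r ∧
      f =ᵐ[(volume : Measure ℝ).restrict (Ioo (-1) 1)] φ ∧
      r =ᵐ[(volume : Measure ℝ).restrict (Ioo (-1) 1)]
        fun x => Complex.I * (ε : ℂ) ^ 2 * φ₂ x + (q x - l) * φ x := by
  have hφc : Continuous φ := continuous_iff_continuousAt.2 fun x => (h1 x).continuousAt
  have hφ₁c : Continuous φ₁ := continuous_iff_continuousAt.2 fun x => (h2 x).continuousAt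
  have hφ := memLp_of_continuousOn hφc.continuousOn
  have hr := memLp_of_continuousOn (z := fun x : ℝ => Complex.I * (ε : ℂ) ^ 2 * φ₂ x
    + (q x - l) * φ x) ((continuousOn_const.mul hc.continuousOn).add
      ((hq.sub continuousOn_const).mul hφc.continuousOn))
  refine ⟨hφ.toLp, hr.toLp, (IsSolution.iff_exists_primitive hq hε).2 ⟨φ, φ₁,
    .of_hasDerivAt (fun x _ => h1 x) hφ₁c.continuousOn,
    (IsPrimitive.of_hasDerivAt (fun x _ => h2 x) hc.continuousOn).congr_ae ?_, h3, h4,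
    hφ.coeFn_toLp⟩, hφ.coeFn_toLp, hr.coeFn_toLp⟩
  have hc : Complex.I * (ε : ℂ) ^ 2 ≠ 0 := by simp [hε]
  filter_upwards [hr.coeFn_toLp] with x e
  rw [e, eq_div_iff hc]
  ring

/-- A phase whose real part has a pronounced maximum inside `[x₀ - δ, x₀ + δ]` yields a pseudomode
with exponentially small residual. All constants are independent of the spectral parameter. -/
lemma exists_pseudomode_of_phase {q : ℂ → ℂ}
    (hq : ContinuousOn (fun x : ℝ => q x) (Icc (-1) 1))
    {x₀ δ κ M c s : ℝ} (hδ : 0 < δ) (hδ1 : |x₀| + δ < 1) (hκ : 0 < κ) (hM : 0 ≤ M) (hc : 0 < c)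
    (hs : 0 < s) (hsδ : s ≤ δ / 2) :
    ∃ ε₀ > (0 : ℝ), ∀ ε, 0 < ε → ε < ε₀ → ∀ (l : ℂ) (S S₁ S₂ : ℂ → ℂ),
      IsPhase x₀ δ κ M S S₁ S₂ →
      (∀ x : ℝ, |x - x₀| ≤ δ → S₁ x ^ 2 = Complex.I * (q x - l)) →
      (∀ x : ℝ, |x - x₀| ≤ δ → (S x).re ≤ c) →
      (∀ x : ℝ, δ / 2 ≤ |x - x₀| → |x - x₀| ≤ δ → (S x).re ≤ -(3 * c)) →
      (∀ x : ℝ, |x - x₀| ≤ s → -c ≤ (S x).re) →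
      ∃ φ r : L2, φ ≠ 0 ∧ IsSolution q ε l φ r ∧ ‖r‖ ≤ Real.exp (-(c / ε)) * ‖φ‖ := by
  obtain ⟨χ, χ₁, χ₂, X₁, X₂, hχ, hχ₁, hχ₂, bχ, bχ₁, bχ₂, χone, χzero, χout⟩ := exists_cutoff x₀ hδ
  have hX₁ : 0 ≤ X₁ := (abs_nonneg _).trans (bχ₁ 0)
  have hX₂ : 0 ≤ X₂ := (abs_nonneg _).trans (bχ₂ 0)
  set K : ℝ := 2 * X₁ * (3 * M / κ + 5 * κ / 4 * (3 / 2)) + X₂ * (3 / 2) + M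
  have hK : 0 ≤ K := by positivity
  refine ⟨min 1 (c * √(s / 2) / (2 * K + 1)), by positivity,
    fun ε hε hεlt l S S₁ S₂ h hS₁ b1 b2 b3 => ?_⟩
  obtain ⟨hε1, hε2⟩ := lt_min_iff.1 hεlt
  -- `Re S ≤ c`, so a remainder `exp (-4c/ε)` in the amplitude leaves `exp (-3c/ε)` in the residual
  set N : ℕ := ⌈4 * c / ε⌉₊
  have hN : (1 / 3 : ℝ) ^ N ≤ Real.exp (-(4 * c / ε)) := by
    calc (1 / 3 : ℝ) ^ N ≤ (Real.exp (-1)) ^ N := by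
          gcongr
          rw [Real.exp_neg, one_div]
          exact inv_anti₀ (Real.exp_pos _) (by linarith [Real.exp_one_lt_d9])
      _ = Real.exp (-N) := by rw [← Real.exp_nat_mul]; ring_nf
      _ ≤ _ := Real.exp_le_exp.2 (neg_le_neg (Nat.le_ceil _))
  obtain ⟨w, w₁, g, hw, hw₁, hg, bw, bw₁, bg⟩ := h.exists_amplitude hε N
  have hεc : (ε : ℂ) ≠ 0 := Complex.ofReal_ne_zero.2 hε.ne'
  let U : Set ℂ := Metric.ball (x₀ : ℂ) (2 * δ)
  let Y : ℂ → ℂ := fun x => Complex.exp (S x / ε) * w x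
  let Y₁ : ℂ → ℂ := fun x => Complex.exp (S x / ε) * (w₁ x + S₁ x / ε * w x)
  let Y₂ : ℂ → ℂ := fun x => Complex.exp (S x / ε) * (S₂ x / ε * g x + (S₁ x / ε) ^ 2 * w x)
  have hY : ∀ x ∈ U, HasDerivAt Y (Y₁ x) x := fun x hx =>
    (((h.hasDerivAt x hx).div_const (ε : ℂ)).cexp.mul (hw x hx)).congr_deriv (by
      simp only [Y₁]; ring)
  have hY₁ : ∀ x ∈ U, HasDerivAt Y₁ (Y₂ x) x := fun x hx =>
    (((h.hasDerivAt x hx).div_const (ε : ℂ)).cexp.mul ((hw₁ x hx).add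
      (((h.hasDerivAt_one x hx).div_const (ε : ℂ)).mul (hw x hx)))).congr_deriv (by
        simp only [Y₂, Pi.add_apply, Pi.mul_apply]; ring)
  have hUn : ∀ x ∈ U, U ∈ nhds x := fun x hx => Metric.isOpen_ball.mem_nhds hx
  have hY₂ : ∀ x ∈ U, ContinuousAt Y₂ x := fun x hx => by
    have c1 := (h.hasDerivAt x hx).continuousAt
    have c2 := (h.hasDerivAt_one x hx).continuousAt
    have c3 := (h.differentiableOn.differentiableAt (hUn x hx)).continuousAt
    have c4 := (hg.differentiableAt (hUn x hx)).continuousAt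
    have c5 := (hw x hx).continuousAt
    exact (c1.div_const _).cexp.mul (((c3.div_const _).mul c4).add
      (((c2.div_const _).pow 2).mul c5))
  have memU : ∀ x : ℝ, |x - x₀| < 2 * δ → (x : ℂ) ∈ U := fun x hx => by
    rw [mem_ball_iff_norm, ← Complex.ofReal_sub, Complex.norm_real]
    exact hx
  let φ : ℝ → ℂ := fun x => χ x * Y x
  let φ₁ : ℝ → ℂ := fun x => χ₁ x * Y x + χ x * Y₁ x
  let φ₂ : ℝ → ℂ := fun x => χ₂ x * Y x + 2 * χ₁ x * Y₁ x + χ x * Y₂ x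
  have hout : ∀ x : ℝ, ¬ |x - x₀| < 2 * δ → ∀ᶠ y in nhds x, φ y = 0 ∧ φ₁ y = 0 ∧ φ₂ y = 0 := by
    intro x hx
    have hx' : δ < |x - x₀| := by linarith
    have : ∀ᶠ y in nhds x, δ < |y - x₀| :=
      (isOpen_lt continuous_const (by fun_prop)).mem_nhds hx'
    filter_upwards [this] with y hy
    obtain ⟨a1, a2, a3⟩ := χout y hy
    simp [φ, φ₁, φ₂, a1, a2, a3]
  have zero_ext : ∀ (f f' : ℝ → ℂ) (x : ℝ), (∀ᶠ y in nhds x, f y = 0) → f' x = 0 →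
      HasDerivAt f (f' x) x := fun f f' x hf hf' => by
    rw [hf']
    exact (hasDerivAt_const x (0 : ℂ)).congr_of_eventuallyEq hf
  have hφ : ∀ x, HasDerivAt φ (φ₁ x) x := by
    intro x
    by_cases hx : |x - x₀| < 2 * δ
    · exact (hχ x).ofReal_comp.mul (hY x (memU x hx)).comp_ofReal
    · have := hout x hx
      exact zero_ext _ _ x (this.mono fun y hy => hy.1) this.self_of_nhds.2.1
  have hφ₁ : ∀ x, HasDerivAt φ₁ (φ₂ x) x := by
    intro x
    by_cases hx : |x - x₀| < 2 * δ
    · exact (((hχ₁ x).ofReal_comp.mul (hY x (memU x hx)).comp_ofReal).add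
        ((hχ x).ofReal_comp.mul (hY₁ x (memU x hx)).comp_ofReal)).congr_deriv (by
          simp only [φ₂]; ring)
    · have := hout x hx
      exact zero_ext _ _ x (this.mono fun y hy => hy.2.1) this.self_of_nhds.2.2
  have hφ₂ : Continuous φ₂ := by
    refine continuous_iff_continuousAt.2 fun x => ?_
    by_cases hx : |x - x₀| < 2 * δ
    · have e0 : ContinuousAt (fun x : ℝ => (χ x : ℂ)) x := (hχ x).ofReal_comp.continuousAt
      have e1 : ContinuousAt (fun x : ℝ => (χ₁ x : ℂ)) x := (hχ₁ x).ofReal_comp.continuousAt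
      have e2 : ContinuousAt (fun x : ℝ => (χ₂ x : ℂ)) x :=
        (Complex.continuous_ofReal.comp hχ₂).continuousAt
      have f0 := (hY x (memU x hx)).comp_ofReal.continuousAt
      have f1 := (hY₁ x (memU x hx)).comp_ofReal.continuousAt
      have f2 : ContinuousAt (fun x : ℝ => Y₂ x) x :=
        ContinuousAt.comp (g := Y₂) (hY₂ x (memU x hx)) Complex.continuous_ofReal.continuousAt
      exact ((e2.mul f0).add ((continuousAt_const.mul e1).mul f1)).add (e0.mul f2)
    · have h0 : φ₂ =ᶠ[nhds x] fun _ => 0 := (hout x hx).mono fun y hy => hy.2.2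
      exact (continuousAt_const (y := (0 : ℂ))).congr h0.symm
  have hend : ∀ x : ℝ, |x| = 1 → φ x = 0 := fun x hx => by
    have : δ < |x - x₀| := by linarith [abs_sub_abs_le_abs_sub x x₀]
    simp [φ, (χout x this).1]
  obtain ⟨f, r, hfr, hf, hr⟩ := exists_isSolution hq hε.ne' l hφ hφ₁ hφ₂ (hend (-1) (by simp))
    (hend 1 (by simp))
  have nexp : ∀ x : ℂ, ‖Complex.exp (S x / ε)‖ = Real.exp ((S x).re / ε) := fun x => by
    rw [Complex.norm_exp, Complex.div_ofReal_re]
  have wlo : ∀ x ∈ coneSector x₀ δ, 1 / 2 ≤ ‖w x‖ := fun x hx => by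
    have := norm_sub_norm_le (1 : ℂ) (1 - w x)
    rw [sub_sub_cancel, norm_one, norm_sub_rev] at this
    linarith [bw x hx]
  have whi : ∀ x ∈ coneSector x₀ δ, ‖w x‖ ≤ 3 / 2 := fun x hx => by
    have := norm_add_le (w x - 1) 1
    rw [sub_add_cancel, norm_one] at this
    linarith [bw x hx]
  have lower : √(s / 2) * Real.exp (-(c / ε)) ≤ ‖f‖ := by
    have h1 : ∀ x : ℝ, |x - x₀| ≤ s → 1 / 2 * Real.exp (-(c / ε)) ≤ ‖φ x‖ := by
      intro x hx
      have hxT := ofReal_mem_coneSector hδ (by linarith : |x - x₀| ≤ δ)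
      simp only [φ, Y]
      rw [χone x (hx.trans hsδ), Complex.ofReal_one, one_mul, norm_mul, nexp, mul_comm]
      gcongr
      · rw [← neg_div]
        gcongr
        exact b3 x hx
      · exact wlo x hxT
    have := le_norm_L2 hs.le (by linarith) (by positivity) hf h1
    refine le_trans (le_of_eq ?_) this
    rw [show 2 * s = 2 ^ 2 * (s / 2) by ring, Real.sqrt_mul (by positivity),
      Real.sqrt_sq (by norm_num)]
    ring
  have resid : ∀ x : ℝ, ‖Complex.I * (ε : ℂ) ^ 2 * φ₂ x + (q x - l) * φ x‖ ≤
      K * Real.exp (-(3 * c / ε)) := by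
    intro x
    by_cases hx : |x - x₀| ≤ δ
    · have hxT := ofReal_mem_coneSector hδ hx
      have hsplit : Complex.I * (ε : ℂ) ^ 2 * φ₂ x + (q x - l) * φ x =
          Complex.I * (ε : ℂ) ^ 2 * (2 * χ₁ x * Y₁ x + χ₂ x * Y x) +
            Complex.I * ε * χ x * Complex.exp (S x / ε) * S₂ x * g x := by
        have e2 : Y₂ x = Complex.exp (S x / ε) * (S₂ x / ε * g x) +
            Complex.I * (q x - l) / (ε : ℂ) ^ 2 * Y x := by
          simp only [Y₂, Y, div_pow, hS₁ x hx]
          ring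
        simp only [φ₂, φ, e2]
        field_simp
        linear_combination (χ x * Y x * (q x - l)) * Complex.I_sq
      have t2 : ‖Complex.I * ε * χ x * Complex.exp (S x / ε) * S₂ x * g x‖ ≤
          M * Real.exp (-(3 * c / ε)) := by
        simp only [norm_mul, Complex.norm_I, nexp, Complex.norm_real, Real.norm_eq_abs,
          abs_of_pos hε, one_mul]
        calc ε * |χ x| * Real.exp ((S x).re / ε) * ‖S₂ x‖ * ‖g x‖
            ≤ 1 * 1 * Real.exp (c / ε) * M * Real.exp (-(4 * c / ε)) := by
              gcongr
              · exact bχ x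
              · exact b1 x hx
              · exact h.norm_deriv_two_le x hxT.1
              · exact (bg x hxT).trans hN
          _ = M * (Real.exp (c / ε) * Real.exp (-(4 * c / ε))) := by ring
          _ = _ := by rw [← Real.exp_add]; congr 2; ring
      have t1 : ‖Complex.I * (ε : ℂ) ^ 2 * (2 * χ₁ x * Y₁ x + χ₂ x * Y x)‖ ≤
          (2 * X₁ * (3 * M / κ + 5 * κ / 4 * (3 / 2)) + X₂ * (3 / 2)) *
            Real.exp (-(3 * c / ε)) := by
        by_cases hx2 : |x - x₀| < δ / 2
        · obtain ⟨z1, z2⟩ := χzero x hx2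
          simp only [z1, z2, Complex.ofReal_zero, mul_zero, zero_mul, add_zero, norm_zero]
          positivity
        · have hE : Real.exp ((S x).re / ε) ≤ Real.exp (-(3 * c / ε)) := by
            rw [← neg_div]
            gcongr
            exact b2 x (not_lt.1 hx2) hx
          have bS₁ : ‖S₁ x‖ ≤ 5 * κ / 4 := by
            have h1 := h.norm_deriv_add_le x hxT.1
            have h2 := norm_sub_le (S₁ x + Complex.I * κ) (Complex.I * κ)
            rw [add_sub_cancel_right, norm_mul, Complex.norm_I, Complex.norm_real,
              Real.norm_of_nonneg hκ.le] at h2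
            linarith
          have bY : ‖Y x‖ ≤ Real.exp (-(3 * c / ε)) * (3 / 2) := by
            simp only [Y]
            rw [norm_mul, nexp]
            gcongr
            exact whi x hxT
          have bY₁ : ‖Y₁ x‖ ≤ Real.exp (-(3 * c / ε)) * (3 * M / κ + 5 * κ / 4 / ε * (3 / 2)) := by
            simp only [Y₁]
            rw [norm_mul, nexp]
            gcongr
            refine (norm_add_le _ _).trans ?_
            rw [norm_mul, norm_div, Complex.norm_real, Real.norm_of_nonneg hε.le]
            gcongr
            · exact bw₁ x hxT
            · exact whi x hxT
          rw [norm_mul, norm_mul, norm_pow, Complex.norm_I, Complex.norm_real,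
            Real.norm_of_nonneg hε.le, one_mul]
          have hsum : ‖2 * χ₁ x * Y₁ x + χ₂ x * Y x‖ ≤ 2 * X₁ * ‖Y₁ x‖ + X₂ * ‖Y x‖ := by
            refine (norm_add_le _ _).trans ?_
            simp only [norm_mul, Complex.norm_real, Real.norm_eq_abs, Complex.norm_ofNat]
            gcongr
            · exact bχ₁ x
            · exact bχ₂ x
          have hε2 : ε ^ 2 ≤ 1 := pow_le_one₀ hε.le hε1.le
          have hε3 : ε ^ 2 * (3 * M / κ + 5 * κ / 4 / ε * (3 / 2)) ≤
              3 * M / κ + 5 * κ / 4 * (3 / 2) := by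
            have e : ε ^ 2 * (3 * M / κ + 5 * κ / 4 / ε * (3 / 2)) =
                ε ^ 2 * (3 * M / κ) + ε * (5 * κ / 4 * (3 / 2)) := by field_simp
            rw [e]
            exact add_le_add (mul_le_of_le_one_left (by positivity) hε2)
              (mul_le_of_le_one_left (by positivity) hε1.le)
          calc ε ^ 2 * ‖2 * χ₁ x * Y₁ x + χ₂ x * Y x‖
              ≤ ε ^ 2 * (2 * X₁ * (Real.exp (-(3 * c / ε)) * (3 * M / κ + 5 * κ / 4 / ε * (3 / 2)))
                + X₂ * (Real.exp (-(3 * c / ε)) * (3 / 2))) := by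
                gcongr
                exact hsum.trans (by gcongr)
            _ = (2 * X₁ * (ε ^ 2 * (3 * M / κ + 5 * κ / 4 / ε * (3 / 2))) +
                ε ^ 2 * (X₂ * (3 / 2))) * Real.exp (-(3 * c / ε)) := by ring
            _ ≤ _ := mul_le_mul_of_nonneg_right (add_le_add
                (mul_le_mul_of_nonneg_left hε3 (by positivity))
                (mul_le_of_le_one_left (by positivity) hε2)) (Real.exp_pos _).le
      rw [hsplit]
      refine (norm_add_le _ _).trans ((add_le_add t1 t2).trans_eq ?_)
      simp only [K]
      ring
    · obtain ⟨a1, a2, a3⟩ := χout x (not_le.1 hx)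
      simp only [φ₂, φ, a1, a2, a3, Complex.ofReal_zero, mul_zero, zero_mul, add_zero, norm_zero]
      positivity
  have upper : ‖r‖ ≤ 2 * (K * Real.exp (-(3 * c / ε))) := by
    refine L2_norm_le_of_ae_bound (by positivity) ?_
    filter_upwards [hr] with x hx
    rw [hx]
    exact resid x
  have hsq : 0 < √(s / 2) := Real.sqrt_pos.2 (by positivity)
  refine ⟨f, r, ?_, hfr, ?_⟩
  · rintro rfl
    rw [norm_zero] at lower
    exact absurd lower (not_le.2 (by positivity))
  · have h1 : 2 * K ≤ √(s / 2) * Real.exp (c / ε) := by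
      rw [lt_div_iff₀ (by positivity)] at hε2
      have h2 : 2 * K + 1 ≤ √(s / 2) * (c / ε) := by
        rw [← mul_div_assoc, le_div_iff₀ hε]
        linarith
      have h3 : c / ε ≤ Real.exp (c / ε) := by linarith [Real.add_one_le_exp (c / ε)]
      linarith [mul_le_mul_of_nonneg_left h3 hsq.le]
    calc ‖r‖ ≤ 2 * K * Real.exp (-(3 * c / ε)) := by linarith
      _ ≤ √(s / 2) * Real.exp (c / ε) * Real.exp (-(3 * c / ε)) := by gcongr
      _ = Real.exp (-(c / ε)) * (√(s / 2) * Real.exp (-(c / ε))) := by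
          rw [mul_assoc, ← Real.exp_add, mul_left_comm, ← Real.exp_add]
          congr 2
          ring
      _ ≤ _ := by gcongr

/-! ### Phases near a point of the strip -/

/-- A continuous function that takes the value `μ` only at isolated points passes, somewhere between
a point where it is below `μ` and a point where it is above `μ`, from values below `μ` to values
above `μ`. -/
lemma exists_crossing {g : ℝ → ℝ} {a b μ : ℝ} (hab : a ≤ b) (hg : ContinuousOn g (Icc a b))
    (ha : g a < μ) (hb : μ < g b)
    (hiso : ∀ x ∈ Ioo a b, g x = μ → ∀ᶠ y in nhdsWithin x {x}ᶜ, g y ≠ μ) :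
    ∃ x₀ ∈ Ioo a b, g x₀ = μ ∧ ∃ δ > 0, (∀ x ∈ Ioo (x₀ - δ) x₀, g x < μ) ∧
      ∀ x ∈ Ioo x₀ (x₀ + δ), μ < g x := by
  let E : Set ℝ := {x | x ∈ Icc a b ∧ μ < g x}
  have hEb : b ∈ E := ⟨right_mem_Icc.2 hab, hb⟩
  have hbdd : BddBelow E := ⟨a, fun x hx => hx.1.1⟩
  set x₀ := sInf E with hx₀
  have hmem : x₀ ∈ Icc a b := ⟨le_csInf ⟨b, hEb⟩ fun x hx => hx.1.1, csInf_le hbdd hEb⟩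
  have hbelow : ∀ x ∈ Icc a b, x < x₀ → g x ≤ μ := fun x hx hlt => by
    by_contra! h
    exact not_le.2 hlt (csInf_le hbdd ⟨hx, h⟩)
  have hge : μ ≤ g x₀ := by
    have hcl : x₀ ∈ closure E := csInf_mem_closure ⟨b, hEb⟩ hbdd
    exact closure_minimal (t := Icc a b ∩ g ⁻¹' Ici μ) (fun x hx => ⟨hx.1, hx.2.le⟩)
      (hg.preimage_isClosed_of_isClosed isClosed_Icc isClosed_Ici) hcl |>.2
  have hax : a < x₀ := lt_of_le_of_ne hmem.1 fun h => by rw [← h] at hge; linarith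
  have hle : g x₀ ≤ μ := by
    have hcl : x₀ ∈ closure (Ico a x₀) := by
      rw [closure_Ico hax.ne]
      exact right_mem_Icc.2 hax.le
    exact closure_minimal (t := Icc a b ∩ g ⁻¹' Iic μ)
      (fun x hx => ⟨⟨hx.1, hx.2.le.trans hmem.2⟩, hbelow x ⟨hx.1, hx.2.le.trans hmem.2⟩ hx.2⟩)
      (hg.preimage_isClosed_of_isClosed isClosed_Icc isClosed_Iic) hcl |>.2
  have hxb : x₀ < b := lt_of_le_of_ne hmem.2 fun h => by rw [h] at hle; linarith
  have hev := hiso x₀ ⟨hax, hxb⟩ (hle.antisymm hge)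
  obtain ⟨r, hr, hball⟩ := Metric.mem_nhdsWithin_iff.1 hev
  set δ := min r (min (x₀ - a) (b - x₀)) with hδ
  have hδr : δ ≤ r := min_le_left _ _
  have hδa : δ ≤ x₀ - a := (min_le_right _ _).trans (min_le_left _ _)
  have hδb : δ ≤ b - x₀ := (min_le_right _ _).trans (min_le_right _ _)
  have hne : ∀ x, |x - x₀| < δ → x ≠ x₀ → g x ≠ μ := fun x hx hxne =>
    hball ⟨by rw [Metric.mem_ball, Real.dist_eq]; linarith, hxne⟩
  refine ⟨x₀, ⟨hax, hxb⟩, hle.antisymm hge, δ,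
    lt_min hr (lt_min (by linarith) (by linarith)), fun x hx => ?_, fun x hx => ?_⟩
  · refine lt_of_le_of_ne (hbelow x ⟨by linarith [hx.1], by linarith [hx.2]⟩ hx.2)
      (hne x ?_ hx.2.ne)
    rw [abs_lt]
    constructor <;> linarith [hx.1, hx.2]
  · by_contra! h
    -- `E` has points between `x₀` and `x`, and `g` omits the value `μ` there
    obtain ⟨y, hyE, hyx⟩ := exists_lt_of_csInf_lt ⟨b, hEb⟩ (hx.1 : sInf E < x)
    have hyx₀ : x₀ < y := lt_of_le_of_ne (csInf_le hbdd hyE) fun h' => by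
      have := hyE.2
      rw [← h'] at this
      linarith
    have hsub : Icc y x ⊆ Icc a b := Icc_subset_Icc (by linarith) (by linarith [hx.2])
    obtain ⟨z, hz, hgz⟩ := intermediate_value_Icc' hyx.le (hg.mono hsub) ⟨h, hyE.2.le⟩
    refine hne z ?_ (by linarith [hz.1]) hgz
    rw [abs_lt]
    constructor <;> linarith [hz.1, hz.2, hx.2]

/-- The phase `S = -i ∫ √(-i (q - l))`, where `√` is the principal branch, for `l` near
`μ - iκ²` on a disc where `q` is close to `μ`. -/
lemma exists_isPhase {q : ℂ → ℂ} {x₀ δ κ M μ : ℝ} {l : ℂ} (hδ : 0 < δ) (hκ : 0 < κ)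
    (hq : DifferentiableOn ℂ q (Metric.ball (x₀ : ℂ) (2 * δ)))
    (hqμ : ∀ x ∈ Metric.ball (x₀ : ℂ) (2 * δ), ‖q x - μ‖ ≤ κ ^ 2 / 8)
    (hq' : ∀ x ∈ Metric.ball (x₀ : ℂ) (2 * δ), ‖deriv q x‖ ≤ M * κ)
    (hM : 24 * δ * M ≤ κ) (hl : ‖l - (μ - Complex.I * κ ^ 2)‖ ≤ κ ^ 2 / 8) :
    ∃ S S₁ S₂ : ℂ → ℂ, IsPhase x₀ δ κ M S S₁ S₂ ∧ S x₀ = 0 ∧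
      ∀ x ∈ Metric.ball (x₀ : ℂ) (2 * δ), S₁ x ^ 2 = Complex.I * (q x - l) := by
  set U := Metric.ball (x₀ : ℂ) (2 * δ) with hU
  let f : ℂ → ℂ := fun x => -Complex.I * (q x - l)
  let R : ℂ → ℂ := fun x => f x ^ (1 / 2 : ℂ)
  have hf : ∀ x ∈ U, ‖f x - κ ^ 2‖ ≤ κ ^ 2 / 4 := fun x hx => by
    have e : f x - κ ^ 2 =
        -Complex.I * (q x - μ) + Complex.I * (l - (μ - Complex.I * κ ^ 2)) := by
      simp only [f]
      linear_combination (-(κ : ℂ) ^ 2) * Complex.I_sq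
    rw [e]
    refine (norm_add_le _ _).trans ?_
    rw [norm_mul, norm_mul, norm_neg, Complex.norm_I, one_mul, one_mul]
    linarith [hqμ x hx]
  have hre : ∀ x ∈ U, 0 < (f x).re := fun x hx => by
    have h1 := (Complex.abs_re_le_norm _).trans (hf x hx)
    have e : ((κ : ℂ) ^ 2).re = κ ^ 2 := by
      rw [← Complex.ofReal_pow, Complex.ofReal_re]
    rw [Complex.sub_re, e, abs_le] at h1
    nlinarith [h1.1, sq_pos_of_pos hκ]
  have hslit : ∀ x ∈ U, f x ∈ Complex.slitPlane := fun x hx => Or.inl (hre x hx)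
  have hR2 : ∀ x, R x ^ 2 = f x := fun x => by
    simp only [R]
    rw [← Complex.cpow_nat_mul]
    norm_num
  have hRre : ∀ x ∈ U, 0 ≤ (R x).re := fun x hx => by
    have h0 : f x ≠ 0 := Complex.slitPlane_ne_zero (hslit x hx)
    have harg := Complex.abs_arg_lt_pi_div_two_iff.2 (Or.inl (hre x hx))
    rw [abs_lt] at harg
    have e : (R x).re = Real.exp (Real.log ‖f x‖ / 2) * Real.cos ((f x).arg / 2) := by
      simp only [R]
      rw [Complex.cpow_def_of_ne_zero h0, Complex.exp_re]
      congr 2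
      · simp [Complex.log_re, div_eq_mul_inv]
      · simp [Complex.log_im, div_eq_mul_inv]
    rw [e]
    refine mul_nonneg (Real.exp_pos _).le (Real.cos_nonneg_of_mem_Icc ⟨?_, ?_⟩) <;>
      linarith [Real.pi_pos]
  have hRκ : ∀ x ∈ U, ‖R x - κ‖ ≤ κ / 4 := fun x hx => by
    have h1 : ‖R x - κ‖ * ‖R x + κ‖ ≤ κ ^ 2 / 4 := by
      rw [← norm_mul]
      convert hf x hx using 2
      rw [← hR2 x]
      ring
    have h2 : κ ≤ ‖R x + κ‖ := by
      refine le_trans ?_ (Complex.re_le_norm _)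
      rw [Complex.add_re, Complex.ofReal_re]
      linarith [hRre x hx]
    have h3 : ‖R x - κ‖ * κ ≤ κ ^ 2 / 4 :=
      (mul_le_mul_of_nonneg_left h2 (norm_nonneg _)).trans h1
    refine le_of_mul_le_mul_right (h3.trans_eq ?_) hκ
    ring
  have hRnorm : ∀ x ∈ U, κ / 2 ≤ ‖R x‖ := fun x hx => by
    have h1 := norm_sub_norm_le (κ : ℂ) (R x)
    rw [Complex.norm_real, Real.norm_of_nonneg hκ.le, norm_sub_rev] at h1
    linarith [hRκ x hx]
  have hR0 : ∀ x ∈ U, R x ≠ 0 := fun x hx => norm_pos_iff.1 (by linarith [hRnorm x hx])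
  have hqd : ∀ x ∈ U, HasDerivAt q (deriv q x) x := fun x hx =>
    (hq.differentiableAt (Metric.isOpen_ball.mem_nhds hx)).hasDerivAt
  have hRd : ∀ x ∈ U, HasDerivAt (fun x => -Complex.I * R x) (-deriv q x / (2 * R x)) x := by
    intro x hx
    have hfd : HasDerivAt f (-Complex.I * deriv q x) x := ((hqd x hx).sub_const l).const_mul _
    refine ((hfd.cpow_const (c := (1 / 2 : ℂ)) (hslit x hx)).const_mul (-Complex.I)).congr_deriv ?_
    have e : f x ^ ((1 / 2 : ℂ) - 1) = (R x)⁻¹ := by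
      simp only [R]
      rw [← Complex.cpow_neg]
      norm_num
    rw [e]
    have := hR0 x hx
    field_simp
    linear_combination (deriv q x) * Complex.I_sq
  have hRdiff : DifferentiableOn ℂ (fun x => -Complex.I * R x) U := fun x hx =>
    (hRd x hx).differentiableAt.differentiableWithinAt
  obtain ⟨S, hS0, hS⟩ := hRdiff.isExactOn_ball.with_val_at x₀ 0
  refine ⟨S, fun x => -Complex.I * R x, fun x => -deriv q x / (2 * R x),
    ⟨hδ, hκ, hS, hRd, ?_, fun x hx => ?_, fun x hx => ?_, hM⟩, hS0, fun x hx => ?_⟩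
  · have hR : DifferentiableOn ℂ R U := by
      have := hRdiff.const_mul Complex.I
      refine this.congr fun x _ => ?_
      linear_combination (R x) * Complex.I_sq
    exact (hq.deriv Metric.isOpen_ball).neg.div (hR.const_mul 2)
      fun x hx => mul_ne_zero two_ne_zero (hR0 x hx)
  · have e : -Complex.I * R x + Complex.I * κ = -Complex.I * (R x - κ) := by ring
    rw [e, norm_mul, norm_neg, Complex.norm_I, one_mul]
    exact hRκ x hx
  · rw [norm_div, norm_neg, norm_mul, Complex.norm_ofNat, div_le_iff₀
      (by linarith [hRnorm x hx])]
    have hM0 : 0 ≤ M := by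
      by_contra! h
      exact not_lt.2 ((norm_nonneg _).trans (hq' x hx)) (mul_neg_of_neg_of_pos h hκ)
    nlinarith [hq' x hx, hRnorm x hx]
  · rw [mul_pow, hR2]
    simp only [f]
    linear_combination (-Complex.I * (q x - l)) * Complex.I_sq

/-- Two phases that belong to the parameters `l` and `l'` differ by `O(|l - l'|)`. -/
lemma IsPhase.norm_sub_phase_le {q : ℂ → ℂ} {x₀ δ κ M : ℝ} {l l' : ℂ} {S S₁ S₂ T T₁ T₂ : ℂ → ℂ}
    (hS : IsPhase x₀ δ κ M S S₁ S₂) (hT : IsPhase x₀ δ κ M T T₁ T₂) (h0 : S x₀ = T x₀)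
    (hS₁ : ∀ x ∈ Metric.ball (x₀ : ℂ) (2 * δ), S₁ x ^ 2 = Complex.I * (q x - l))
    (hT₁ : ∀ x ∈ Metric.ball (x₀ : ℂ) (2 * δ), T₁ x ^ 2 = Complex.I * (q x - l'))
    {x : ℂ} (hx : x ∈ Metric.ball (x₀ : ℂ) (2 * δ)) :
    ‖S x - T x‖ ≤ ‖l - l'‖ / κ * ‖x - x₀‖ := by
  have hκ := hS.kappa_pos
  have hb : ∀ x ∈ Metric.ball (x₀ : ℂ) (2 * δ), ‖S₁ x - T₁ x‖ ≤ ‖l - l'‖ / κ := fun x hx => by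
    have h1 : ‖S₁ x - T₁ x‖ * ‖S₁ x + T₁ x‖ = ‖l - l'‖ := by
      rw [← norm_mul, show (S₁ x - T₁ x) * (S₁ x + T₁ x) = -Complex.I * (l - l') by
        linear_combination hS₁ x hx - hT₁ x hx, norm_mul, norm_neg, Complex.norm_I, one_mul]
    have h2 : κ ≤ ‖S₁ x + T₁ x‖ := by
      have e : 2 * Complex.I * (κ : ℂ) =
          (S₁ x + Complex.I * κ) + (T₁ x + Complex.I * κ) - (S₁ x + T₁ x) := by ring
      have h3 : ‖2 * Complex.I * (κ : ℂ)‖ ≤ κ / 4 + κ / 4 + ‖S₁ x + T₁ x‖ := by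
        rw [e]
        refine (norm_sub_le _ _).trans (add_le_add_left ((norm_add_le _ _).trans ?_) _)
        exact add_le_add (hS.norm_deriv_add_le x hx) (hT.norm_deriv_add_le x hx)
      rw [norm_mul, norm_mul, Complex.norm_ofNat, Complex.norm_I, Complex.norm_real,
        Real.norm_of_nonneg hκ.le] at h3
      linarith
    rw [le_div_iff₀ hκ, ← h1]
    exact mul_le_mul_of_nonneg_left h2 (norm_nonneg _)
  have hx₀ : (x₀ : ℂ) ∈ Metric.ball (x₀ : ℂ) (2 * δ) :=
    Metric.mem_ball_self (by linarith [hS.delta_pos])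
  have := (convex_ball (x₀ : ℂ) (2 * δ)).norm_image_sub_le_of_norm_hasDerivWithin_le
    (f := fun x => S x - T x)
    (fun x hx => ((hS.hasDerivAt x hx).sub (hT.hasDerivAt x hx)).hasDerivWithinAt) hb hx₀ hx
  simpa [h0] using this

lemma IsPhase.norm_sub_center_le {x₀ δ κ M : ℝ} {S S₁ S₂ : ℂ → ℂ} (hS : IsPhase x₀ δ κ M S S₁ S₂)
    {x : ℂ} (hx : x ∈ Metric.ball (x₀ : ℂ) (2 * δ)) : ‖S x - S x₀‖ ≤ 2 * κ * ‖x - x₀‖ := by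
  have hκ := hS.kappa_pos
  refine (convex_ball (x₀ : ℂ) (2 * δ)).norm_image_sub_le_of_norm_hasDerivWithin_le
    (fun x hx => (hS.hasDerivAt x hx).hasDerivWithinAt) (fun x hx => ?_)
    (Metric.mem_ball_self (by linarith [hS.delta_pos])) hx
  have h1 := norm_sub_le (S₁ x + Complex.I * κ) (Complex.I * κ)
  rw [add_sub_cancel_right, norm_mul, Complex.norm_I, Complex.norm_real,
    Real.norm_of_nonneg hκ.le] at h1
  linarith [hS.norm_deriv_add_le x hx]

lemma ofReal_mem_ball {x₀ δ x : ℝ} (hδ : 0 < δ) (hx : |x - x₀| ≤ δ) :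
    (x : ℂ) ∈ Metric.ball (x₀ : ℂ) (2 * δ) := by
  rw [mem_ball_iff_norm, ← Complex.ofReal_sub, Complex.norm_real, Real.norm_eq_abs]
  linarith

/-- If `q - μ` changes its sign from `-` to `+` at `x₀`, the real part of the phase that belongs to
`l = μ - iκ²` has a strict maximum there, since its derivative has the sign of `μ - q`. -/
lemma IsPhase.exists_re_le {q : ℂ → ℂ} {x₀ δ κ M : ℝ} {l : ℂ} {S S₁ S₂ : ℂ → ℂ}
    (hS : IsPhase x₀ δ κ M S S₁ S₂) (h0 : S x₀ = 0)
    (hS₁ : ∀ x ∈ Metric.ball (x₀ : ℂ) (2 * δ), S₁ x ^ 2 = Complex.I * (q x - l))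
    (hleft : ∀ x ∈ Ioo (x₀ - δ) x₀, (q x).re < l.re)
    (hright : ∀ x ∈ Ioo x₀ (x₀ + δ), l.re < (q x).re) :
    ∃ c > 0, (∀ x : ℝ, |x - x₀| ≤ δ → (S x).re ≤ 0) ∧
      ∀ x : ℝ, δ / 2 ≤ |x - x₀| → |x - x₀| ≤ δ → (S x).re ≤ -c := by
  have hδ := hS.delta_pos
  have hκ := hS.kappa_pos
  have hd : ∀ x : ℝ, |x - x₀| ≤ δ → HasDerivAt (fun x : ℝ => (S x).re) (S₁ x).re x := fun x hx =>
    (hS.hasDerivAt x (ofReal_mem_ball hδ hx)).real_of_complex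
  have habs : ∀ {x : ℝ}, x ∈ Icc (x₀ - δ) (x₀ + δ) → |x - x₀| ≤ δ := fun {x} hx =>
    abs_le.2 ⟨by linarith [hx.1], by linarith [hx.2]⟩
  have him : ∀ x : ℝ, |x - x₀| ≤ δ → (S₁ x).im < 0 := fun x hx => by
    have h1 := (Complex.abs_im_le_norm _).trans
      (hS.norm_deriv_add_le x (ofReal_mem_ball hδ hx))
    rw [Complex.add_im, abs_le] at h1
    have e : (Complex.I * (κ : ℂ)).im = κ := by simp
    rw [e] at h1
    linarith [h1.2]
  have hsign : ∀ x : ℝ, |x - x₀| ≤ δ → 2 * (S₁ x).re * (S₁ x).im = (q x).re - l.re := fun x hx => by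
    have h1 := congrArg Complex.im (hS₁ x (ofReal_mem_ball hδ hx))
    rw [sq, Complex.mul_im, Complex.I_mul_im, Complex.sub_re] at h1
    linarith
  have hcont : ContinuousOn (fun x : ℝ => (S x).re) (Icc (x₀ - δ) (x₀ + δ)) := fun x hx =>
    (hd x (habs hx)).continuousAt.continuousWithinAt
  have hmono : StrictMonoOn (fun x : ℝ => (S x).re) (Icc (x₀ - δ) x₀) := by
    refine strictMonoOn_of_deriv_pos (convex_Icc _ _)
      (hcont.mono (Icc_subset_Icc_right (by linarith))) fun x hx => ?_
    rw [interior_Icc] at hx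
    have hx' := habs ⟨hx.1.le, hx.2.le.trans (by linarith)⟩
    rw [(hd x hx').deriv]
    by_contra! h
    nlinarith [him x hx', hsign x hx', hleft x hx]
  have hanti : StrictAntiOn (fun x : ℝ => (S x).re) (Icc x₀ (x₀ + δ)) := by
    refine strictAntiOn_of_deriv_neg (convex_Icc _ _)
      (hcont.mono (Icc_subset_Icc_left (by linarith))) fun x hx => ?_
    rw [interior_Icc] at hx
    have hx' := habs ⟨by linarith [hx.1], hx.2.le⟩
    rw [(hd x hx').deriv]
    by_contra! h
    nlinarith [him x hx', hsign x hx', hright x hx]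
  have hz : (S x₀).re = 0 := by rw [h0, Complex.zero_re]
  have hL : (S ((x₀ - δ / 2 : ℝ) : ℂ)).re < (S x₀).re :=
    hmono ⟨by linarith, by linarith⟩ ⟨by linarith, le_rfl⟩ (by linarith)
  have hR : (S ((x₀ + δ / 2 : ℝ) : ℂ)).re < (S x₀).re :=
    hanti ⟨le_rfl, by linarith⟩ ⟨by linarith, by linarith⟩ (by linarith)
  rw [hz] at hL hR
  refine ⟨min (-(S ((x₀ - δ / 2 : ℝ) : ℂ)).re) (-(S ((x₀ + δ / 2 : ℝ) : ℂ)).re),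
    lt_min (by linarith) (by linarith), fun x hx => ?_, fun x hx1 hx2 => ?_⟩
  · rw [abs_le] at hx
    rw [← hz]
    rcases le_total x x₀ with h | h
    · exact hmono.monotoneOn ⟨by linarith, h⟩ ⟨by linarith, le_rfl⟩ h
    · exact hanti.antitoneOn ⟨le_rfl, by linarith⟩ ⟨h, by linarith⟩ h
  · rw [abs_le] at hx2
    rcases le_total x x₀ with h | h
    · rw [abs_of_nonpos (by linarith)] at hx1
      have h1 : (S x).re ≤ (S ((x₀ - δ / 2 : ℝ) : ℂ)).re :=
        hmono.monotoneOn ⟨by linarith, h⟩ ⟨by linarith, by linarith⟩ (by linarith)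
      linarith [min_le_left (-(S ((x₀ - δ / 2 : ℝ) : ℂ)).re) (-(S ((x₀ + δ / 2 : ℝ) : ℂ)).re)]
    · rw [abs_of_nonneg (by linarith)] at hx1
      have h1 : (S x).re ≤ (S ((x₀ + δ / 2 : ℝ) : ℂ)).re :=
        hanti.antitoneOn ⟨by linarith, by linarith⟩ ⟨h, by linarith⟩ (by linarith)
      linarith [min_le_right (-(S ((x₀ - δ / 2 : ℝ) : ℂ)).re) (-(S ((x₀ + δ / 2 : ℝ) : ℂ)).re)]

/-- A profile of class `AM` takes each real value only at isolated points, since it is not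
constant. -/
lemma OrrSommerfeldModel.IsAM.eventually_re_ne {q : ℂ → ℂ} {G : Set ℂ} (hq : IsAM q G) {x μ : ℝ}
    (hx : x ∈ Ioo (-1 : ℝ) 1) :
    ∀ᶠ y : ℝ in nhdsWithin x {x}ᶜ, (q y).re ≠ μ := by
  have hxG := hq.segment_subset x (Ioo_subset_Icc_self hx)
  have hval : ∀ y ∈ Icc (-1 : ℝ) 1, (q y).re = μ → q y = μ := fun y hy h =>
    Complex.ext (by simpa using h) (by simpa using hq.real_on_segment y hy)
  have hreal : Filter.Tendsto (fun y : ℝ => (y : ℂ)) (nhdsWithin x {x}ᶜ)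
      (nhdsWithin (x : ℂ) {(x : ℂ)}ᶜ) :=
    Complex.continuous_ofReal.continuousWithinAt.tendsto_nhdsWithin fun y hy => by
      simpa using hy
  have key : ∀ᶠ z in nhdsWithin (x : ℂ) {(x : ℂ)}ᶜ, q z ≠ μ := by
    by_contra hcon
    have hfr : ∃ᶠ z in nhdsWithin (x : ℂ) {(x : ℂ)}ᶜ, q z = (fun _ : ℂ => (μ : ℂ)) z := hcon
    have heq := hq.analytic.eqOn_of_preconnected_of_frequently_eq
      (analyticOnNhd_const (v := (μ : ℂ))) hq.isConnected.isPreconnected hxG hfr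
    have e1 := heq (by simpa using hq.segment_subset (-1) (by norm_num))
    have e2 := heq (by simpa using hq.segment_subset 1 (by norm_num))
    have := hq.endpoints_lt
    rw [e1, e2] at this
    exact lt_irrefl _ this
  have hIcc : ∀ᶠ y : ℝ in nhdsWithin x {x}ᶜ, y ∈ Icc (-1 : ℝ) 1 :=
    mem_nhdsWithin_of_mem_nhds (Icc_mem_nhds hx.1 hx.2)
  filter_upwards [hreal.eventually key, hIcc] with y hy hyI h
  exact hy (hval y hyI h)

lemma OrrSommerfeldModel.IsAM.continuousOn_segment {q : ℂ → ℂ} {G : Set ℂ} (hq : IsAM q G) :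
    ContinuousOn (fun x : ℝ => q x) (Icc (-1) 1) :=
  hq.analytic.continuousOn.comp Complex.continuous_ofReal.continuousOn hq.segment_subset

/-- Near every point of the strip, exponentially good pseudomodes exist uniformly. -/
lemma exists_pseudomode {q : ℂ → ℂ} {G : Set ℂ} (hq : IsAM q G) {l₀ : ℂ} (hl₀ : l₀ ∈ strip q) :
    ∃ ρ > (0 : ℝ), ∃ τ > (0 : ℝ), ∃ ε₀ > (0 : ℝ), ∀ ε, 0 < ε → ε < ε₀ →
      ∀ l ∈ Metric.ball l₀ ρ, ∃ φ r : L2, φ ≠ 0 ∧ IsSolution q ε l φ r ∧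
        ‖r‖ ≤ Real.exp (-(τ / ε)) * ‖φ‖ := by
  obtain ⟨ha, hb, him⟩ := hl₀
  obtain ⟨x₀, hx₀, hqx₀, δ₁, hδ₁, hleft, hright⟩ := exists_crossing (a := -1) (b := 1)
    (g := fun x : ℝ => (q x).re) (by norm_num)
    (Complex.continuous_re.comp_continuousOn hq.continuousOn_segment)
    (by simpa using ha) (by simpa using hb) fun x hx _ => hq.eventually_re_ne hx
  set κ := √(-l₀.im) with hκdef
  have hκ : 0 < κ := Real.sqrt_pos.2 (by linarith)
  have hκ2 : κ ^ 2 = -l₀.im := Real.sq_sqrt (by linarith)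
  have hl₀e : l₀ = l₀.re - Complex.I * κ ^ 2 := by
    rw [← Complex.ofReal_pow, hκ2]
    apply Complex.ext <;> simp
  have hx₀I := Ioo_subset_Icc_self hx₀
  have hx₀G := hq.segment_subset x₀ hx₀I
  have hqv : q x₀ = l₀.re :=
    Complex.ext (by simpa using hqx₀) (by simpa using hq.real_on_segment x₀ hx₀I)
  have hA := hq.analytic x₀ hx₀G
  obtain ⟨r, hr, hball⟩ : ∃ r > 0, Metric.ball (x₀ : ℂ) r ⊆ {z | z ∈ G ∧
      ‖q z - l₀.re‖ < κ ^ 2 / 8 ∧ ‖deriv q z‖ < ‖deriv q x₀‖ + 1} := by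
    refine Metric.mem_nhds_iff.1 (Filter.inter_mem (hq.isOpen.mem_nhds hx₀G)
      (Filter.inter_mem ?_ ?_))
    · refine (hA.continuousAt.sub continuousAt_const).norm.eventually_lt continuousAt_const ?_
      simp only [Pi.sub_apply, hqv, sub_self, norm_zero]
      positivity
    · exact hA.deriv.continuousAt.norm.eventually_lt continuousAt_const (lt_add_one _)
  set B := ‖deriv q x₀‖ + 1 with hB
  have hB0 : 0 < B := by positivity
  have hxabs : |x₀| < 1 := abs_lt.2 hx₀
  set δ := min (min δ₁ (r / 2)) (min ((1 - |x₀|) / 2) (κ ^ 2 / (24 * B))) with hδdef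
  have hδ : 0 < δ := lt_min (lt_min hδ₁ (by linarith)) (lt_min (by linarith) (by positivity))
  have hd1 : δ ≤ δ₁ := (min_le_left _ _).trans (min_le_left _ _)
  have hd2 : δ ≤ r / 2 := (min_le_left _ _).trans (min_le_right _ _)
  have hd3 : δ ≤ (1 - |x₀|) / 2 := (min_le_right _ _).trans (min_le_left _ _)
  have hd4 : δ ≤ κ ^ 2 / (24 * B) := (min_le_right _ _).trans (min_le_right _ _)
  have hsub : Metric.ball (x₀ : ℂ) (2 * δ) ⊆ Metric.ball (x₀ : ℂ) r :=
    Metric.ball_subset_ball (by linarith)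
  have hM : 24 * δ * (B / κ) ≤ κ := by
    rw [le_div_iff₀ (by positivity)] at hd4
    rw [← mul_div_assoc, div_le_iff₀ hκ]
    nlinarith
  have phase : ∀ l : ℂ, ‖l - l₀‖ ≤ κ ^ 2 / 8 → ∃ S S₁ S₂ : ℂ → ℂ,
      IsPhase x₀ δ κ (B / κ) S S₁ S₂ ∧ S x₀ = 0 ∧
        ∀ x ∈ Metric.ball (x₀ : ℂ) (2 * δ), S₁ x ^ 2 = Complex.I * (q x - l) := fun l hl => by
    refine exists_isPhase (μ := l₀.re) hδ hκ (fun x hx => ?_) (fun x hx => ?_) (fun x hx => ?_) hM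
      (by rwa [← hl₀e])
    · exact (hq.analytic x (hball (hsub hx)).1).differentiableAt.differentiableWithinAt
    · exact (hball (hsub hx)).2.1.le
    · rw [div_mul_cancel₀ _ hκ.ne']
      exact (hball (hsub hx)).2.2.le
  obtain ⟨T, T₁, T₂, hT, hT0, hT₁⟩ := phase l₀ (by rw [sub_self, norm_zero]; positivity)
  -- One quarter of the depth `C` is spent on the change of the phase with `l`.
  obtain ⟨C, hC, hTle, hTC⟩ := hT.exists_re_le hT0 hT₁
    (fun x hx => hleft x ⟨by linarith [hx.1], hx.2⟩)
    (fun x hx => hright x ⟨hx.1, by linarith [hx.2]⟩)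
  set c := C / 4 with hc
  have hc0 : 0 < c := by positivity
  set s := min (δ / 2) (c / (2 * κ)) with hs
  have hs0 : 0 < s := lt_min (by linarith) (by positivity)
  obtain ⟨ε₀, hε₀, hmain⟩ := exists_pseudomode_of_phase (q := q) (x₀ := x₀) (δ := δ) (κ := κ)
    (M := B / κ) (c := c) (s := s) hq.continuousOn_segment hδ (by linarith) hκ (by positivity) hc0
    hs0 (min_le_left _ _)
  refine ⟨min (κ ^ 2 / 8) (c * κ / δ), lt_min (by positivity) (by positivity), c, hc0, ε₀, hε₀,
    fun ε h1 h2 l hl => ?_⟩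
  rw [mem_ball_iff_norm] at hl
  obtain ⟨S, S₁, S₂, hS, hS0, hS₁⟩ := phase l (hl.le.trans (min_le_left _ _))
  have hnorm : ∀ x : ℝ, ‖(x : ℂ) - x₀‖ = |x - x₀| := fun x => by
    rw [← Complex.ofReal_sub, Complex.norm_real, Real.norm_eq_abs]
  have hdiff : ∀ x : ℝ, |x - x₀| ≤ δ → (S x).re ≤ (T x).re + c := fun x hx => by
    have h3 := hS.norm_sub_phase_le hT (hS0.trans hT0.symm) hS₁ hT₁ (ofReal_mem_ball hδ hx)
    rw [hnorm] at h3
    have h4 : ‖l - l₀‖ ≤ c * κ / δ := hl.le.trans (min_le_right _ _)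
    have h5 : ‖l - l₀‖ / κ * |x - x₀| ≤ c * κ / δ / κ * δ := by gcongr
    have h6 : c * κ / δ / κ * δ = c := by field_simp
    have h7 := Complex.re_le_norm (S x - T x)
    rw [Complex.sub_re] at h7
    linarith
  refine hmain ε h1 h2 l S S₁ S₂ hS (fun x hx => hS₁ x (ofReal_mem_ball hδ hx))
    (fun x hx => ?_) (fun x hx1 hx2 => ?_) (fun x hx => ?_)
  · linarith [hdiff x hx, hTle x hx]
  · linarith [hdiff x hx2, hTC x hx1 hx2]
  · have hxδ : |x - x₀| ≤ δ := hx.trans ((min_le_left _ _).trans (by linarith))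
    have h3 := hS.norm_sub_center_le (ofReal_mem_ball hδ hxδ)
    rw [hS0, sub_zero, hnorm] at h3
    have h4 : 2 * κ * |x - x₀| ≤ 2 * κ * (c / (2 * κ)) := by
      have := hx.trans (min_le_right _ _)
      gcongr
    have h5 : 2 * κ * (c / (2 * κ)) = c := by field_simp
    have h6 := (abs_le.1 (Complex.abs_re_le_norm (S x))).1
    linarith

/-! ### The domain bounded by the limit curves -/

/-- A point outside the open strip and off the segment `[a, b]` can leave to infinity along one of
the rays that avoid both. -/
lemma exists_ray {q : ℂ → ℂ} (ha : (q (-1)).im = 0) (hb : (q 1).im = 0)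
    (hab : (q (-1)).re < (q 1).re) {z : ℂ}
    (hz : z ∉ strip q) (hseg : z ∉ segment ℝ (q (-1)) (q 1)) :
    ∃ v : ℂ, v ≠ 0 ∧ ∀ t : ℝ, 0 ≤ t → z + t * v ∉ strip q ∪ segment ℝ (q (-1)) (q 1) := by
  have hsegre : ∀ w ∈ segment ℝ (q (-1)) (q 1),
      w.im = 0 ∧ (q (-1)).re ≤ w.re ∧ w.re ≤ (q 1).re := by
    rintro _ ⟨s, t, hs, ht, hst, rfl⟩
    obtain rfl : s = 1 - t := by linarith
    simp only [Complex.add_im, Complex.add_re, Complex.smul_im, Complex.smul_re, smul_eq_mul, ha,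
      hb]
    refine ⟨by ring, ?_, ?_⟩ <;> nlinarith
  have hmemseg : ∀ w : ℂ, w.im = 0 → (q (-1)).re ≤ w.re → w.re ≤ (q 1).re →
      w ∈ segment ℝ (q (-1)) (q 1) := by
    intro w h0 h1 h2
    set t := (w.re - (q (-1)).re) / ((q 1).re - (q (-1)).re) with ht
    have hd : 0 < (q 1).re - (q (-1)).re := sub_pos.2 hab
    refine ⟨1 - t, t, ?_, by rw [ht]; exact div_nonneg (by linarith) hd.le, by ring, ?_⟩
    · rw [sub_nonneg, ht, div_le_one hd]
      linarith
    · apply Complex.ext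
      · simp only [Complex.add_re, Complex.smul_re, smul_eq_mul, ht]
        field_simp
        ring
      · simp [ha, hb, h0]
  by_cases h1 : z.re < (q (-1)).re
  · refine ⟨-1, by simp, fun t ht => ?_⟩
    have e : (z + t * (-1 : ℂ)).re = z.re - t := by simp [sub_eq_add_neg]
    rintro (h | h)
    · have := h.1
      linarith
    · have := (hsegre _ h).2.1
      linarith
  by_cases h2 : (q 1).re < z.re
  · refine ⟨1, by simp, fun t ht => ?_⟩
    have e : (z + t * (1 : ℂ)).re = z.re + t := by simp
    rintro (h | h)
    · have := h.2.1
      linarith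
    · have := (hsegre _ h).2.2
      linarith
  rw [not_lt] at h1 h2
  by_cases h3 : 0 < z.im
  · refine ⟨Complex.I, Complex.I_ne_zero, fun t ht => ?_⟩
    have e : (z + t * Complex.I).im = z.im + t := by simp
    rintro (h | h)
    · have := h.2.2
      linarith
    · have := (hsegre _ h).1
      linarith
  -- otherwise `z` lies on a vertical side of the strip, below its vertex
  have h4 : z.im < 0 := lt_of_le_of_ne (not_lt.1 h3) fun h => hseg (hmemseg z h h1 h2)
  refine ⟨-Complex.I, by simp, fun t ht => ?_⟩
  have e : (z + t * -Complex.I).im = z.im - t := by simp [sub_eq_add_neg]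
  have e' : (z + t * -Complex.I).re = z.re := by simp
  rintro (h | h)
  · exact hz ⟨by rw [← e']; exact h.1, by rw [← e']; exact h.2.1, h4⟩
  · have := (hsegre _ h).1
    linarith

lemma Omega_subset_strip {q : ℂ → ℂ} {G : Set ℂ} (hq : IsAM q G) (l₀ : ℂ) :
    Omega q G l₀ ⊆ strip q := by
  intro z hz
  by_contra hzs
  have ha : (q (-1)).im = 0 := by simpa using hq.real_on_segment (-1) (by norm_num)
  have hb : (q 1).im = 0 := by simpa using hq.real_on_segment 1 (by norm_num)
  have hcont : contour q G l₀ ⊆ strip q ∪ segment ℝ (q (-1)) (q 1) := by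
    rintro w ((⟨f, -, -, f0, -, hf, t, ht, rfl⟩ | ⟨f, -, -, f0, -, hf, t, ht, rfl⟩) | hw)
    · rcases ht.1.eq_or_lt with rfl | h
      · rw [f0]
        exact Or.inr (right_mem_segment ℝ _ _)
      · exact Or.inl (hf t ⟨h, ht.2⟩).1
    · rcases ht.1.eq_or_lt with rfl | h
      · rw [f0]
        exact Or.inr (left_mem_segment ℝ _ _)
      · exact Or.inl (hf t ⟨h, ht.2⟩).1
    · exact Or.inr hw
  obtain ⟨v, hv, hray⟩ := exists_ray ha hb hq.endpoints_lt hzs fun h => hz.1 (Or.inr h)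
  have hsub : (fun t : ℝ => z + t * v) '' Ici 0 ⊆
      connectedComponentIn (contour q G l₀)ᶜ z := by
    refine IsPreconnected.subset_connectedComponentIn ?_ ⟨0, mem_Ici.2 le_rfl, by simp⟩ ?_
    · exact isPreconnected_Ici.image _ (by fun_prop)
    · rintro _ ⟨t, ht, rfl⟩ h
      exact hray t ht (hcont h)
  obtain ⟨C, hC⟩ := (hz.2.subset hsub).exists_norm_le
  have hv0 : 0 < ‖v‖ := norm_pos_iff.2 hv
  have hC0 : 0 ≤ C := (norm_nonneg _).trans (hC _ ⟨0, mem_Ici.2 le_rfl, rfl⟩)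
  set t := (C + ‖z‖ + 1) / ‖v‖ with ht
  have ht0 : 0 ≤ t := by positivity
  have h1 := hC _ ⟨t, ht0, rfl⟩
  have h2 := norm_sub_le (z + t * v) z
  rw [add_sub_cancel_left, norm_mul, Complex.norm_real, Real.norm_of_nonneg ht0, ht,
    div_mul_cancel₀ _ hv0.ne'] at h2
  simp only at h1
  rw [ht] at h1
  linarith

/-! ### The estimates -/

/-- A pseudomode bounds the norm of the resolvent from below. -/
lemma le_resolventNorm {q : ℂ → ℂ} {ε a : ℝ} {l : ℂ} {φ r : L2} (hφ : φ ≠ 0)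
    (hs : IsSolution q ε l φ r) (hr : ‖r‖ ≤ Real.exp (-a) * ‖φ‖) :
    ENNReal.ofReal (Real.exp a) ≤ resolventNorm (modelOp q ε) l := by
  refine le_iInf₂ fun R hR => ?_
  obtain ⟨h, hA⟩ := exists_modelOp_eq_iff.2 hs
  have h1 : R r = φ := by
    have := hR.2 ⟨φ, h⟩
    rw [hA] at this
    simpa using this
  have hφ0 : 0 < ‖φ‖ := norm_pos_iff.2 hφ
  have h2 : ‖φ‖ ≤ ‖R‖ * Real.exp (-a) * ‖φ‖ := by
    calc ‖φ‖ = ‖R r‖ := by rw [h1]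
      _ ≤ ‖R‖ * ‖r‖ := R.le_opNorm r
      _ ≤ ‖R‖ * (Real.exp (-a) * ‖φ‖) := by gcongr
      _ = _ := by ring
  have h3 : 1 ≤ ‖R‖ * Real.exp (-a) := le_of_mul_le_mul_right (by rwa [one_mul]) hφ0
  rw [← ofReal_norm]
  refine ENNReal.ofReal_le_ofReal ?_
  rw [Real.exp_neg, ← div_eq_mul_inv, le_div_iff₀ (Real.exp_pos _), one_mul] at h3
  exact h3

/-- The bound on the resolvent is uniform on the compact subsets of the strip. -/
lemma exists_le_resolventNorm {q : ℂ → ℂ} {G : Set ℂ} (hq : IsAM q G) {K : Set ℂ}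
    (hK : IsCompact K) (hKs : K ⊆ strip q) :
    ∃ τ > (0 : ℝ), ∃ ε₀ > (0 : ℝ), ∀ ε : ℝ, 0 < ε → ε < ε₀ → ∀ l ∈ K,
      ENNReal.ofReal (Real.exp (τ / ε)) ≤ resolventNorm (modelOp q ε) l := by
  let p : Set ℂ → Prop := fun s => ∃ τ > (0 : ℝ), ∃ ε₀ > (0 : ℝ), ∀ ε : ℝ, 0 < ε → ε < ε₀ →
    ∀ l ∈ s, ENNReal.ofReal (Real.exp (τ / ε)) ≤ resolventNorm (modelOp q ε) l
  refine hK.induction_on (p := p) ⟨1, one_pos, 1, one_pos, fun _ _ _ _ h => absurd h (by simp)⟩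
    ?_ ?_ fun l₀ hl₀ => ?_
  · rintro s t hst ⟨τ, hτ, ε₀, hε₀, h⟩
    exact ⟨τ, hτ, ε₀, hε₀, fun ε h1 h2 l hl => h ε h1 h2 l (hst hl)⟩
  · rintro s t ⟨τ, hτ, ε₀, hε₀, h⟩ ⟨τ', hτ', ε₀', hε₀', h'⟩
    refine ⟨min τ τ', lt_min hτ hτ', min ε₀ ε₀', lt_min hε₀ hε₀', fun ε h1 h2 l hl => ?_⟩
    rcases hl with hl | hl
    · refine le_trans ?_ (h ε h1 (h2.trans_le (min_le_left _ _)) l hl)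
      gcongr
      exact min_le_left _ _
    · refine le_trans ?_ (h' ε h1 (h2.trans_le (min_le_right _ _)) l hl)
      gcongr
      exact min_le_right _ _
  · obtain ⟨ρ, hρ, τ, hτ, ε₀, hε₀, h⟩ := exists_pseudomode hq (hKs hl₀)
    refine ⟨Metric.ball l₀ ρ, mem_nhdsWithin_of_mem_nhds (Metric.ball_mem_nhds l₀ hρ), τ, hτ, ε₀,
      hε₀, fun ε h1 h2 l hl => ?_⟩
    obtain ⟨φ, r, hφ, hs, hr⟩ := h ε h1 h2 l hl
    exact le_resolventNorm hφ hs hr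

theorem theorem5 (q : ℂ → ℂ) (G : Set ℂ) (hq : IsAM q G) :
    (∀ l₀ ∈ curvePlus q G ∩ curveMinus q G, ∀ K ⊆ Omega q G l₀, IsCompact K →
      ∃ τ > (0 : ℝ), ∃ ε₀ > (0 : ℝ), ∀ ε : ℝ, 0 < ε → ε < ε₀ → ∀ l ∈ K,
        ENNReal.ofReal (Real.exp (τ / ε)) ≤ resolventNorm (modelOp q ε) l) ∧
    (∃ η > (0 : ℝ), ∃ ε₁ > (0 : ℝ), ∀ ε : ℝ, 0 < ε → ε < ε₁ →
      NoAssociatedFunctions (modelOp q ε) →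
      ∀ z : ℕ → L2, IsNormedEigensystem (modelOp q ε) z →
        ENNReal.ofReal (Real.exp (η / ε)) ≤ rieszConstant z) := by
  refine ⟨fun l₀ _ K hKO hK =>
    exists_le_resolventNorm hq hK (hKO.trans (Omega_subset_strip hq l₀)), ?_⟩
  have hl : (((q (-1)).re + (q 1).re) / 2 : ℝ) - Complex.I ∈ strip q := by
    have := hq.endpoints_lt
    refine ⟨?_, ?_, ?_⟩
    · rw [Complex.sub_re, Complex.ofReal_re, Complex.I_re]
      linarith
    · rw [Complex.sub_re, Complex.ofReal_re, Complex.I_re]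
      linarith
    · rw [Complex.sub_im, Complex.ofReal_im, Complex.I_im]
      norm_num
  obtain ⟨ρ, hρ, τ, hτ, ε₀, hε₀, h⟩ := exists_pseudomode hq hl
  exact exists_le_rieszConstant hq.continuousOn_segment hρ hτ hε₀ h
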